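/- A category with families (CwF) is a category $\mathcal{C}$ with a terminal object and a family $\mathbb{C}$ (types $\mathbb{C}.\mathsf{Ty}$ and, dependent on them, terms $\mathbb{C}.\mathsf{Tm}$) in presheaves over $\mathcal{C}$ whose terms are locally representable, i.e. with context extensions $\Gamma.A$. A $(\Sigma,\Pi_{\mathsf{rep}})$-CwF is a CwF with a restriction $\mathbb{C}_{\mathsf{rep}}\to\mathbb{C}$ of its family (the representable types), such that $\mathbb{C}$ and $\mathbb{C}_{\mathsf{rep}}$ both have $\mathbf{1}$- and $\Sigma$-types and $\mathbb{C}$ has $\Pi$-types with arities in $\mathbb{C}_{\mathsf{rep}}$. A $(\Sigma,\Pi_{\mathsf{rep}},\mathsf{Eq})$-CwF is a $(\Sigma,\Pi_{\mathsf{rep}})$-CwF whose family $\mathbb{C}$ also has extensional equality types (equality types with reflexivity terms, equality reflection and uniqueness of equality proofs). Morphisms preserve all the structure strictly. A second-order generalized algebraic theory (SOGAT) is a $(\Sigma,\Pi_{\mathsf{rep}})$-CwF $\mathcal{T}$ with a cellular presentation: $\mathcal{T}$ is obtained from the initial $(\Sigma,\Pi_{\mathsf{rep}})$-CwF by transfinitely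 composing free extensions by families of new types, new representable types, new terms and new equations between terms. The types and representable types adjoined in this way are the generating sorts; each generating sort $\mathsf{S}$ is a type of $\mathcal{T}$ over a context $\partial\mathsf{S}$. Homotopy relations on $\mathcal{T}$ consist, for every generating sort $\mathsf{S}$, of a type $x\sim_{\mathsf{S}(\sigma)}y$ over $(\sigma:\partial\mathsf{S},\,x,y:\mathsf{S}(\sigma))$ and a term $\mathsf{hrefl}(x):x\sim_{\mathsf{S}(\sigma)}x$ over $(\sigma:\partial\mathsf{S},\,x:\mathsf{S}(\sigma))$. A homotopy in $\mathcal{T}$ consists of a generating sort $\mathsf{S}$, a context $\Gamma$, a morphism $\sigma:\Gamma\to\partial\mathsf{S}$ and terms $x,y:\mathsf{S}(\sigma)$ and $p:x\sim_{\mathsf{S}(\sigma)}y$ over $\Gamma$. For a family $E$ of homotopies in $\mathcal{T}$, the equational extension $\mathcal{T}\to\mathcal{T}_E$ is the extension of $\mathcal{T}$ freely generated by the equations $x=y$ and $p=\mathsf{hrefl}(x)$ for all the homotopies $(\mathsf{S},\Gamma,\sigma,x,y,p)$ in $E$. **Proposition.** Let $\mathcal{T}$ be a SOGAT equipped with homotopy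 relations, let $E$ be a family of homotopies in $\mathcal{T}$, and let $\mathcal{T}_E$ be the equational extension of $\mathcal{T}$ by $E$. Let $\mathcal{T}^1_E$, with $F:\mathcal{T}_E\to\mathcal{T}^1_E$, be initial among the $(\Sigma,\Pi_{\mathsf{rep}},\mathsf{Eq})$-CwFs $\mathcal{D}$ equipped with an internal model of $\mathcal{T}_E$, i.e. with a $(\Sigma,\Pi_{\mathsf{rep}})$-CwF morphism $\mathcal{T}_E\to\mathcal{D}$. Then $F$ is bijective on terms: for every context $\Gamma$ of $\mathcal{T}_E$ and every type $A$ of $\mathcal{T}_E$ over $\Gamma$, the map $$\mathbb{T}_E.\mathsf{Tm}(\Gamma,A)\to\mathbb{T}^1_E.\mathsf{Tm}(F(\Gamma),F(A)),\qquad a\mapsto F(a),$$ is a bijection. -/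

import Mathlib

open CategoryTheory

universe u

/-! ## Categories with families -/

/-- A category with families: a category with a (chosen) terminal object `nil`, together with a
family in presheaves, given as a presheaf of types `Ty`, a presheaf of terms `Tm` and a natural map
`typ : Tm → Ty` (so the dependent set of terms of type `A` is the fibre of `typ` over `A`,
see `CwF.Term`), which is locally representable: for every type `A` over `Γ` there is an extended
context `ext A` with a projection `p A`, a generic term `q A`, and the universal property of
`pair`. Substitution is written `tySub σ A`, `tmSub σ t`. -/
structure CwF where
  Ctx : Type u
  [cat : Category.{u} Ctx]
  nil : Ctx
  nilIsTerminal : Limits.IsTerminal nil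
  Ty : Ctx → Type u
  tySub : ∀ {Γ Δ : Ctx}, (Δ ⟶ Γ) → Ty Γ → Ty Δ
  tySub_id : ∀ {Γ : Ctx} (A : Ty Γ), tySub (𝟙 Γ) A = A
  tySub_comp : ∀ {Γ Δ Θ : Ctx} (τ : Θ ⟶ Δ) (σ : Δ ⟶ Γ) (A : Ty Γ),
    tySub (τ ≫ σ) A = tySub τ (tySub σ A)
  Tm : Ctx → Type u
  tmSub : ∀ {Γ Δ : Ctx}, (Δ ⟶ Γ) → Tm Γ → Tm Δ
  tmSub_id : ∀ {Γ : Ctx} (t : Tm Γ), tmSub (𝟙 Γ) t = t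
  tmSub_comp : ∀ {Γ Δ Θ : Ctx} (τ : Θ ⟶ Δ) (σ : Δ ⟶ Γ) (t : Tm Γ),
    tmSub (τ ≫ σ) t = tmSub τ (tmSub σ t)
  typ : ∀ {Γ : Ctx}, Tm Γ → Ty Γ
  typ_sub : ∀ {Γ Δ : Ctx} (σ : Δ ⟶ Γ) (t : Tm Γ), typ (tmSub σ t) = tySub σ (typ t)
  ext : ∀ {Γ : Ctx}, Ty Γ → Ctx
  p : ∀ {Γ : Ctx} (A : Ty Γ), ext A ⟶ Γ
  q : ∀ {Γ : Ctx} (A : Ty Γ), Tm (ext A)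
  typ_q : ∀ {Γ : Ctx} (A : Ty Γ), typ (q A) = tySub (p A) A
  pair : ∀ {Γ Δ : Ctx} (σ : Δ ⟶ Γ) (A : Ty Γ) (a : Tm Δ), typ a = tySub σ A → (Δ ⟶ ext A)
  pair_p : ∀ {Γ Δ : Ctx} (σ : Δ ⟶ Γ) (A : Ty Γ) (a : Tm Δ) (h : typ a = tySub σ A),
    pair σ A a h ≫ p A = σ
  pair_q : ∀ {Γ Δ : Ctx} (σ : Δ ⟶ Γ) (A : Ty Γ) (a : Tm Δ) (h : typ a = tySub σ A),
    tmSub (pair σ A a h) (q A) = a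
  pair_uniq : ∀ {Γ Δ : Ctx} (σ : Δ ⟶ Γ) (A : Ty Γ) (a : Tm Δ) (h : typ a = tySub σ A)
    (τ : Δ ⟶ ext A), τ ≫ p A = σ → tmSub τ (q A) = a → τ = pair σ A a h

attribute [instance] CwF.cat

namespace CwF

/-- The set of terms of type `A`. -/
def Term (C : CwF.{u}) {Γ : C.Ctx} (A : C.Ty Γ) : Type u := {t : C.Tm Γ // C.typ t = A}

variable {C D : CwF.{u}}

/-- Substitution of a term of type `A`, landing in any type `A'` equal to `A[σ]`. -/
def Term.sub {Γ Δ : C.Ctx} {A : C.Ty Γ} (t : C.Term A) (σ : Δ ⟶ Γ) {A' : C.Ty Δ}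
    (h : A' = C.tySub σ A) : C.Term A' :=
  ⟨C.tmSub σ t.1, by rw [C.typ_sub, t.2, h]⟩

/-- The generic term, as a term of type `A[p]`. -/
def gen {Γ : C.Ctx} (A : C.Ty Γ) : C.Term (C.tySub (C.p A) A) := ⟨C.q A, C.typ_q A⟩

/-- The substitution `⟨σ, a⟩ : Δ ⟶ Γ.A`. -/
def cons {Γ Δ : C.Ctx} (σ : Δ ⟶ Γ) {A : C.Ty Γ} (a : C.Term (C.tySub σ A)) : Δ ⟶ C.ext A :=
  C.pair σ A a.1 a.2

/-- The substitution `⟨id, a⟩ : Γ ⟶ Γ.A`. -/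
def inst {Γ : C.Ctx} {A : C.Ty Γ} (a : C.Term A) : Γ ⟶ C.ext A :=
  C.pair (𝟙 Γ) A a.1 (by rw [a.2, C.tySub_id])

/-- The substitution `⟨σ ∘ p, q⟩ : Δ.A' ⟶ Γ.A`, where `A' = A[σ]`. -/
def up {Γ Δ : C.Ctx} (σ : Δ ⟶ Γ) {A : C.Ty Γ} {A' : C.Ty Δ} (h : A' = C.tySub σ A) :
    C.ext A' ⟶ C.ext A :=
  C.pair (C.p A' ≫ σ) A (C.q A') (by rw [C.typ_q, h, C.tySub_comp])

/-- A (strict) morphism of categories with families: a functor with actions on types and terms,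
strictly preserving the terminal object and the context extensions. -/
@[ext]
structure Hom (C D : CwF.{u}) where
  F : C.Ctx ⥤ D.Ctx
  ty : ∀ {Γ : C.Ctx}, C.Ty Γ → D.Ty (F.obj Γ)
  ty_sub : ∀ {Γ Δ : C.Ctx} (σ : Δ ⟶ Γ) (A : C.Ty Γ), ty (C.tySub σ A) = D.tySub (F.map σ) (ty A)
  tm : ∀ {Γ : C.Ctx}, C.Tm Γ → D.Tm (F.obj Γ)
  tm_sub : ∀ {Γ Δ : C.Ctx} (σ : Δ ⟶ Γ) (t : C.Tm Γ), tm (C.tmSub σ t) = D.tmSub (F.map σ) (tm t)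
  typ_tm : ∀ {Γ : C.Ctx} (t : C.Tm Γ), D.typ (tm t) = ty (C.typ t)
  obj_nil : F.obj C.nil = D.nil
  obj_ext : ∀ {Γ : C.Ctx} (A : C.Ty Γ), F.obj (C.ext A) = D.ext (ty A)
  map_p : ∀ {Γ : C.Ctx} (A : C.Ty Γ), F.map (C.p A) = eqToHom (obj_ext A) ≫ D.p (ty A)
  tm_q : ∀ {Γ : C.Ctx} (A : C.Ty Γ), tm (C.q A) = D.tmSub (eqToHom (obj_ext A)) (D.q (ty A))

/-- The action of a morphism on terms of type `A`, landing in any type `A'` equal to `F A`. -/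
def Term.map {Γ : C.Ctx} {A : C.Ty Γ} (t : C.Term A) (F : C.Hom D) {A' : D.Ty (F.F.obj Γ)}
    (h : A' = F.ty A) : D.Term A' :=
  ⟨F.tm t.1, by rw [F.typ_tm, t.2, h]⟩

/-- The identity morphism. -/
def Hom.id (C : CwF.{u}) : C.Hom C where
  F := 𝟭 _
  ty A := A
  ty_sub _ _ := rfl
  tm t := t
  tm_sub _ _ := rfl
  typ_tm _ := rfl
  obj_nil := rfl
  obj_ext _ := rfl
  map_p A := by simp
  tm_q A := by simp [C.tmSub_id]

/-- The composite of two morphisms (in diagrammatic order). -/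
def Hom.comp {C D E : CwF.{u}} (F : C.Hom D) (G : D.Hom E) : C.Hom E where
  F := F.F ⋙ G.F
  ty A := G.ty (F.ty A)
  ty_sub σ A := by simp [F.ty_sub, G.ty_sub]
  tm t := G.tm (F.tm t)
  tm_sub σ t := by simp [F.tm_sub, G.tm_sub]
  typ_tm t := by rw [G.typ_tm, F.typ_tm]
  obj_nil := by simp [F.obj_nil, G.obj_nil]
  obj_ext A := by simp [F.obj_ext, G.obj_ext]
  map_p A := by simp [F.map_p, G.map_p, eqToHom_map]
  tm_q A := by
    rw [F.tm_q, G.tm_sub, G.tm_q, ← E.tmSub_comp, eqToHom_map, eqToHom_trans]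

/-! ## Type structures -/

/-- A restriction of the family of types of `C`: a presheaf of types with a natural map to the
presheaf of all types. The terms of a restricted type are the terms of its image. -/
structure Restriction (C : CwF.{u}) where
  Ty : C.Ctx → Type u
  sub : ∀ {Γ Δ : C.Ctx}, (Δ ⟶ Γ) → Ty Γ → Ty Δ
  sub_id : ∀ {Γ : C.Ctx} (A : Ty Γ), sub (𝟙 Γ) A = A
  sub_comp : ∀ {Γ Δ Θ : C.Ctx} (τ : Θ ⟶ Δ) (σ : Δ ⟶ Γ) (A : Ty Γ),
    sub (τ ≫ σ) A = sub τ (sub σ A)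
  incl : ∀ {Γ : C.Ctx}, Ty Γ → C.Ty Γ
  incl_sub : ∀ {Γ Δ : C.Ctx} (σ : Δ ⟶ Γ) (A : Ty Γ), incl (sub σ A) = C.tySub σ (incl A)

/-- The trivial restriction, consisting of all types. -/
@[reducible] def all (C : CwF.{u}) : Restriction C where
  Ty := C.Ty
  sub := C.tySub
  sub_id := C.tySub_id
  sub_comp := C.tySub_comp
  incl A := A
  incl_sub _ _ := rfl

/-- A `1`-type structure on a restricted family: a type `one` with exactly one term,
stable under substitution. -/
structure UnitStr (R : Restriction C) where
  one : ∀ Γ : C.Ctx, R.Ty Γ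
  one_sub : ∀ {Γ Δ : C.Ctx} (σ : Δ ⟶ Γ), R.sub σ (one Γ) = one Δ
  star : ∀ Γ : C.Ctx, C.Term (R.incl (one Γ))
  star_uniq : ∀ {Γ : C.Ctx} (t : C.Term (R.incl (one Γ))), t = star Γ

/-- A `Σ`-type structure on a restricted family: types `sig A B`, with a bijection (natural in the
context) between terms of `sig A B` and pairs of terms of `A` and of the instance of `B`.
An internal family `B : A → R` over `Γ` is a type of `R` over the extended context `Γ.A`. -/
structure SigmaStr (R : Restriction C) where
  sig : ∀ {Γ : C.Ctx} (A : R.Ty Γ), R.Ty (C.ext (R.incl A)) → R.Ty Γ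
  sig_sub : ∀ {Γ Δ : C.Ctx} (σ : Δ ⟶ Γ) (A : R.Ty Γ) (B : R.Ty (C.ext (R.incl A))),
    R.sub σ (sig A B) = sig (R.sub σ A) (R.sub (up σ (R.incl_sub σ A)) B)
  pair : ∀ {Γ : C.Ctx} (A : R.Ty Γ) (B : R.Ty (C.ext (R.incl A))) (a : C.Term (R.incl A)),
    C.Term (R.incl (R.sub (inst a) B)) → C.Term (R.incl (sig A B))
  fst : ∀ {Γ : C.Ctx} (A : R.Ty Γ) (B : R.Ty (C.ext (R.incl A))),
    C.Term (R.incl (sig A B)) → C.Term (R.incl A)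
  snd : ∀ {Γ : C.Ctx} (A : R.Ty Γ) (B : R.Ty (C.ext (R.incl A))) (t : C.Term (R.incl (sig A B))),
    C.Term (R.incl (R.sub (inst (fst A B t)) B))
  fst_pair : ∀ {Γ : C.Ctx} (A : R.Ty Γ) (B : R.Ty (C.ext (R.incl A))) (a : C.Term (R.incl A))
    (b : C.Term (R.incl (R.sub (inst a) B))), fst A B (pair A B a b) = a
  snd_pair : ∀ {Γ : C.Ctx} (A : R.Ty Γ) (B : R.Ty (C.ext (R.incl A))) (a : C.Term (R.incl A))
    (b : C.Term (R.incl (R.sub (inst a) B))), (snd A B (pair A B a b)).1 = b.1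
  pair_fst_snd : ∀ {Γ : C.Ctx} (A : R.Ty Γ) (B : R.Ty (C.ext (R.incl A)))
    (t : C.Term (R.incl (sig A B))), pair A B (fst A B t) (snd A B t) = t
  fst_sub : ∀ {Γ Δ : C.Ctx} (σ : Δ ⟶ Γ) (A : R.Ty Γ) (B : R.Ty (C.ext (R.incl A)))
    (t : C.Term (R.incl (sig A B))),
    (fst _ _ (t.sub σ (by rw [← sig_sub, R.incl_sub]))).1 = C.tmSub σ (fst A B t).1
  snd_sub : ∀ {Γ Δ : C.Ctx} (σ : Δ ⟶ Γ) (A : R.Ty Γ) (B : R.Ty (C.ext (R.incl A)))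
    (t : C.Term (R.incl (sig A B))),
    (snd _ _ (t.sub σ (by rw [← sig_sub, R.incl_sub]))).1 = C.tmSub σ (snd A B t).1

/-- A `Π`-type structure on the family of all types, with arities in the restricted family `R`:
types `pi A B`, with a bijection (natural in the context) between terms of `B` over `Γ.A`
and terms of `pi A B` over `Γ`. -/
structure PiStr (R : Restriction C) where
  pi : ∀ {Γ : C.Ctx} (A : R.Ty Γ), C.Ty (C.ext (R.incl A)) → C.Ty Γ
  pi_sub : ∀ {Γ Δ : C.Ctx} (σ : Δ ⟶ Γ) (A : R.Ty Γ) (B : C.Ty (C.ext (R.incl A))),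
    C.tySub σ (pi A B) = pi (R.sub σ A) (C.tySub (up σ (R.incl_sub σ A)) B)
  lam : ∀ {Γ : C.Ctx} (A : R.Ty Γ) (B : C.Ty (C.ext (R.incl A))), C.Term B ≃ C.Term (pi A B)
  lam_sub : ∀ {Γ Δ : C.Ctx} (σ : Δ ⟶ Γ) (A : R.Ty Γ) (B : C.Ty (C.ext (R.incl A)))
    (b : C.Term B),
    (lam (R.sub σ A) _ (b.sub (up σ (R.incl_sub σ A)) rfl)).1 = C.tmSub σ (lam A B b).1

/-- An extensional equality type structure on the family of all types: equality types with
reflexivity terms, satisfying equality reflection and uniqueness of equality proofs.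
Stability of `refl` under substitution follows from uniqueness, and so do the existence and
uniqueness of the eliminator: by reflection and uniqueness, every instance of a type depending on
`y : A` and `e : eq A x y` is strictly equal to its instance at `x` and `refl A x`
(see `EqStr.elim_type_eq`). -/
structure EqStr (C : CwF.{u}) where
  eq : ∀ {Γ : C.Ctx} (A : C.Ty Γ) (_x _y : C.Term A), C.Ty Γ
  eq_sub : ∀ {Γ Δ : C.Ctx} (σ : Δ ⟶ Γ) (A : C.Ty Γ) (x y : C.Term A),
    C.tySub σ (eq A x y) = eq (C.tySub σ A) (x.sub σ rfl) (y.sub σ rfl)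
  refl : ∀ {Γ : C.Ctx} (A : C.Ty Γ) (x : C.Term A), C.Term (eq A x x)
  reflection : ∀ {Γ : C.Ctx} (A : C.Ty Γ) (x y : C.Term A), C.Term (eq A x y) → x = y
  uniq : ∀ {Γ : C.Ctx} (A : C.Ty Γ) (x : C.Term A) (e : C.Term (eq A x x)), e = refl A x

/-! ## Preservation of type structures by morphisms -/

/-- An action of a morphism on restricted types, compatible with its action on all types. -/
@[ext]
structure RestrictionHom (F : C.Hom D) (R : Restriction C) (S : Restriction D) where
  map : ∀ {Γ : C.Ctx}, R.Ty Γ → S.Ty (F.F.obj Γ)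
  map_sub : ∀ {Γ Δ : C.Ctx} (σ : Δ ⟶ Γ) (A : R.Ty Γ), map (R.sub σ A) = S.sub (F.F.map σ) (map A)
  incl_map : ∀ {Γ : C.Ctx} (A : R.Ty Γ), S.incl (map A) = F.ty (R.incl A)

/-- The action of a morphism on all types. -/
@[reducible] def Hom.all (F : C.Hom D) : RestrictionHom F C.all D.all where
  map A := F.ty A
  map_sub := F.ty_sub
  incl_map _ := rfl

section

variable {F : C.Hom D} {R : Restriction C} {S : Restriction D}

/-- The comparison of extended contexts `F(Γ).F(A) ⟶ F(Γ.A)` (an identity up to equality). -/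
def RestrictionHom.extHom (φ : RestrictionHom F R S) {Γ : C.Ctx} (A : R.Ty Γ) :
    D.ext (S.incl (φ.map A)) ⟶ F.F.obj (C.ext (R.incl A)) :=
  eqToHom (by rw [φ.incl_map, F.obj_ext])

/-- Strict preservation of `1`-types (preservation of `star` is automatic). -/
def UnitStr.Preserved (φ : RestrictionHom F R S) (U : UnitStr R) (V : UnitStr S) : Prop :=
  ∀ Γ : C.Ctx, φ.map (U.one Γ) = V.one (F.F.obj Γ)

/-- Strict preservation of `Σ`-types and of the projections (hence of pairs). -/
structure SigmaStr.Preserved (φ : RestrictionHom F R S) (U : SigmaStr R) (V : SigmaStr S) :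
    Prop where
  map_sig : ∀ {Γ : C.Ctx} (A : R.Ty Γ) (B : R.Ty (C.ext (R.incl A))),
    φ.map (U.sig A B) = V.sig (φ.map A) (S.sub (φ.extHom A) (φ.map B))
  map_fst : ∀ {Γ : C.Ctx} (A : R.Ty Γ) (B : R.Ty (C.ext (R.incl A)))
    (t : C.Term (R.incl (U.sig A B))),
    (V.fst _ _ (t.map F (by rw [← map_sig, φ.incl_map]))).1 = F.tm (U.fst A B t).1
  map_snd : ∀ {Γ : C.Ctx} (A : R.Ty Γ) (B : R.Ty (C.ext (R.incl A)))
    (t : C.Term (R.incl (U.sig A B))),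
    (V.snd _ _ (t.map F (by rw [← map_sig, φ.incl_map]))).1 = F.tm (U.snd A B t).1

/-- Strict preservation of `Π`-types and of abstraction (hence of application). -/
structure PiStr.Preserved (φ : RestrictionHom F R S) (U : PiStr R) (V : PiStr S) : Prop where
  map_pi : ∀ {Γ : C.Ctx} (A : R.Ty Γ) (B : C.Ty (C.ext (R.incl A))),
    F.ty (U.pi A B) = V.pi (φ.map A) (D.tySub (φ.extHom A) (F.ty B))
  map_lam : ∀ {Γ : C.Ctx} (A : R.Ty Γ) (B : C.Ty (C.ext (R.incl A))) (b : C.Term B),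
    (V.lam (φ.map A) _ ((b.map F rfl).sub (φ.extHom A) rfl)).1 = F.tm (U.lam A B b).1

/-- Strict preservation of equality types (preservation of `refl` is automatic). -/
structure EqStr.Preserved (F : C.Hom D) (U : EqStr C) (V : EqStr D) : Prop where
  map_eq : ∀ {Γ : C.Ctx} (A : C.Ty Γ) (x y : C.Term A),
    F.ty (U.eq A x y) = V.eq (F.ty A) (x.map F rfl) (y.map F rfl)

end

/-! ### Elimination for extensional equality types -/

theorem EqStr.eq_inst (U : EqStr C) {Γ : C.Ctx} (A : C.Ty Γ) (x y : C.Term A) :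
    C.tySub (inst y) (U.eq (C.tySub (C.p A) A) (x.sub (C.p A) rfl) (gen A)) = U.eq A x y := by
  have key : ∀ (B : C.Ty Γ) (hB : B = A) (a b : C.Term B), a.1 = x.1 → b.1 = y.1 →
      U.eq B a b = U.eq A x y := by
    rintro B rfl a b ha hb
    rw [Subtype.ext ha, Subtype.ext hb]
  rw [U.eq_sub]
  refine key _ ?_ _ _ ?_ ?_
  · rw [← C.tySub_comp, inst, C.pair_p, C.tySub_id]
  · change C.tmSub _ (C.tmSub _ _) = _
    rw [← C.tmSub_comp, inst, C.pair_p, C.tmSub_id]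
  · exact C.pair_q _ _ _ _

/-- The substitution `⟨id, y, e⟩` into the context `Γ.(y : A).(e : eq A x y)`. -/
def EqStr.inst₂ (U : EqStr C) {Γ : C.Ctx} {A : C.Ty Γ} {x : C.Term A} (y : C.Term A)
    (e : C.Term (U.eq A x y)) :
    Γ ⟶ C.ext (U.eq (C.tySub (C.p A) A) (x.sub (C.p A) rfl) (gen A)) :=
  C.pair (inst y) _ e.1 (by rw [e.2, U.eq_inst])

theorem EqStr.elim_type_eq (U : EqStr C) {Γ : C.Ctx} {A : C.Ty Γ} (x : C.Term A)
    (P : C.Ty (C.ext (U.eq (C.tySub (C.p A) A) (x.sub (C.p A) rfl) (gen A))))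
    (y : C.Term A) (e : C.Term (U.eq A x y)) :
    C.tySub (U.inst₂ y e) P = C.tySub (U.inst₂ x (U.refl A x)) P := by
  obtain rfl := U.reflection A x y e
  rw [U.uniq A x e]

/-! ### Identities and composition -/

/-- The identity action on restricted types. -/
def RestrictionHom.id (R : Restriction C) : RestrictionHom (Hom.id C) R R where
  map A := A
  map_sub _ _ := rfl
  incl_map _ := rfl

section

variable {E : CwF.{u}} {F : C.Hom D} {G : D.Hom E}
  {R : Restriction C} {S : Restriction D} {T : Restriction E}

/-- The composite of two actions on restricted types. -/
def RestrictionHom.comp (φ : RestrictionHom F R S) (ψ : RestrictionHom G S T) :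
    RestrictionHom (F.comp G) R T where
  map A := ψ.map (φ.map A)
  map_sub σ A := by rw [φ.map_sub, ψ.map_sub]; rfl
  incl_map A := (ψ.incl_map _).trans (congrArg G.ty (φ.incl_map A))

theorem RestrictionHom.extHom_comp (φ : RestrictionHom F R S) (ψ : RestrictionHom G S T)
    {Γ : C.Ctx} (A : R.Ty Γ) :
    (φ.comp ψ).extHom A = ψ.extHom (φ.map A) ≫ G.F.map (φ.extHom A) := by
  simp only [RestrictionHom.extHom, eqToHom_map, eqToHom_trans]
  rfl

theorem SigmaStr.fst_congr (U : SigmaStr R) {Γ : C.Ctx} {A : R.Ty Γ}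
    {B B' : R.Ty (C.ext (R.incl A))} (h : B = B') (t : C.Term (R.incl (U.sig A B)))
    (t' : C.Term (R.incl (U.sig A B'))) (ht : t.1 = t'.1) :
    (U.fst A B t).1 = (U.fst A B' t').1 := by
  subst h
  rw [Subtype.ext ht]

theorem SigmaStr.snd_congr (U : SigmaStr R) {Γ : C.Ctx} {A : R.Ty Γ}
    {B B' : R.Ty (C.ext (R.incl A))} (h : B = B') (t : C.Term (R.incl (U.sig A B)))
    (t' : C.Term (R.incl (U.sig A B'))) (ht : t.1 = t'.1) :
    (U.snd A B t).1 = (U.snd A B' t').1 := by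
  subst h
  rw [Subtype.ext ht]

theorem PiStr.lam_congr (U : PiStr R) {Γ : C.Ctx} {A : R.Ty Γ}
    {B B' : C.Ty (C.ext (R.incl A))} (h : B = B') (t : C.Term B) (t' : C.Term B')
    (ht : t.1 = t'.1) : (U.lam A B t).1 = (U.lam A B' t').1 := by
  subst h
  rw [Subtype.ext ht]

theorem UnitStr.Preserved.id (U : UnitStr R) : U.Preserved (RestrictionHom.id R) U :=
  fun _ => rfl

theorem UnitStr.Preserved.comp {φ : RestrictionHom F R S} {ψ : RestrictionHom G S T}
    {U : UnitStr R} {V : UnitStr S} {W : UnitStr T} (h : U.Preserved φ V) (k : V.Preserved ψ W) :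
    U.Preserved (φ.comp ψ) W :=
  fun Γ => (congrArg ψ.map (h Γ)).trans (k _)

theorem SigmaStr.Preserved.id (U : SigmaStr R) : U.Preserved (RestrictionHom.id R) U where
  map_sig A B := by
    change U.sig A B = U.sig A (R.sub (𝟙 _) B)
    rw [R.sub_id]
  map_fst A B t := U.fst_congr (R.sub_id B) _ _ rfl
  map_snd A B t := U.snd_congr (R.sub_id B) _ _ rfl

theorem SigmaStr.Preserved.comp {φ : RestrictionHom F R S} {ψ : RestrictionHom G S T}
    {U : SigmaStr R} {V : SigmaStr S} {W : SigmaStr T} (h : U.Preserved φ V)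
    (k : V.Preserved ψ W) : U.Preserved (φ.comp ψ) W := by
  have key : ∀ {Γ : C.Ctx} (A : R.Ty Γ) (B : R.Ty (C.ext (R.incl A))),
      T.sub ((φ.comp ψ).extHom A) ((φ.comp ψ).map B) =
        T.sub (ψ.extHom (φ.map A)) (ψ.map (S.sub (φ.extHom A) (φ.map B))) := by
    intro Γ A B
    rw [ψ.map_sub, ← T.sub_comp, RestrictionHom.extHom_comp]
    rfl
  have hsig : ∀ {Γ : C.Ctx} (A : R.Ty Γ) (B : R.Ty (C.ext (R.incl A))),
      (φ.comp ψ).map (U.sig A B) = W.sig ((φ.comp ψ).map A)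
        (T.sub ((φ.comp ψ).extHom A) ((φ.comp ψ).map B)) := by
    intro Γ A B
    rw [key]
    exact (congrArg ψ.map (h.map_sig A B)).trans (k.map_sig _ _)
  refine ⟨hsig, fun A B t => ?_, fun A B t => ?_⟩
  · refine Eq.trans ?_ ((k.map_fst _ _ (t.map F (by rw [← h.map_sig, φ.incl_map]))).trans
      (congrArg G.tm (h.map_fst A B t)))
    exact W.fst_congr (key A B) _ _ rfl
  · refine Eq.trans ?_ ((k.map_snd _ _ (t.map F (by rw [← h.map_sig, φ.incl_map]))).trans
      (congrArg G.tm (h.map_snd A B t)))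
    exact W.snd_congr (key A B) _ _ rfl

theorem PiStr.Preserved.id (U : PiStr R) : U.Preserved (RestrictionHom.id R) U where
  map_pi A B := by
    change U.pi A B = U.pi A (C.tySub (𝟙 _) B)
    rw [C.tySub_id]
  map_lam A B b := U.lam_congr (C.tySub_id B) _ _ (C.tmSub_id _)

theorem PiStr.Preserved.comp {φ : RestrictionHom F R S} {ψ : RestrictionHom G S T}
    {U : PiStr R} {V : PiStr S} {W : PiStr T} (h : U.Preserved φ V)
    (k : V.Preserved ψ W) : U.Preserved (φ.comp ψ) W := by
  have key : ∀ {Γ : C.Ctx} (A : R.Ty Γ) (B : C.Ty (C.ext (R.incl A))),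
      E.tySub ((φ.comp ψ).extHom A) ((F.comp G).ty B) =
        E.tySub (ψ.extHom (φ.map A)) (G.ty (D.tySub (φ.extHom A) (F.ty B))) := by
    intro Γ A B
    rw [G.ty_sub, ← E.tySub_comp, RestrictionHom.extHom_comp]
    rfl
  refine ⟨fun A B => ?_, fun A B b => ?_⟩
  · rw [key]
    exact (congrArg G.ty (h.map_pi A B)).trans (k.map_pi _ _)
  · refine Eq.trans ?_ ((k.map_lam _ _ ((b.map F rfl).sub (φ.extHom A) rfl)).trans
      (congrArg G.tm (h.map_lam A B b)))
    refine W.lam_congr (key A B) _ _ ?_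
    change E.tmSub _ (G.tm (F.tm b.1)) = E.tmSub _ (G.tm (D.tmSub _ (F.tm b.1)))
    rw [G.tm_sub]
    exact (congrArg (fun f => E.tmSub f (G.tm (F.tm b.1))) (RestrictionHom.extHom_comp φ ψ A)).trans
      (E.tmSub_comp _ _ _)

theorem EqStr.Preserved.id (U : EqStr C) : EqStr.Preserved (Hom.id C) U U :=
  ⟨fun _ _ _ => rfl⟩

theorem EqStr.Preserved.comp {U : EqStr C} {V : EqStr D} {W : EqStr E}
    (h : EqStr.Preserved F U V) (k : EqStr.Preserved G V W) :
    EqStr.Preserved (F.comp G) U W :=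
  ⟨fun A x y => (congrArg G.ty (h.map_eq A x y)).trans (k.map_eq _ _ _)⟩

end

end CwF

/-! ## The categories of `(Σ, Π_rep)`-CwFs and of `(Σ, Π_rep, Eq)`-CwFs -/

/-- A `(Σ, Π_rep)`-CwF: a CwF with a restriction `rep` of its family (the representable types),
`1`- and `Σ`-types on both families, and `Π`-types with representable arities. -/
structure SigmaPiCwF extends CwF.{u} where
  rep : toCwF.Restriction
  unit : CwF.UnitStr toCwF.all
  sigma : CwF.SigmaStr toCwF.all
  repUnit : CwF.UnitStr rep
  repSigma : CwF.SigmaStr rep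
  pi : CwF.PiStr rep

namespace SigmaPiCwF

/-- A morphism of `(Σ, Π_rep)`-CwFs: a CwF morphism with an action on representable types,
strictly preserving all the type structures. -/
@[ext]
structure Hom (C D : SigmaPiCwF.{u}) extends CwF.Hom C.toCwF D.toCwF where
  rep : CwF.RestrictionHom toHom C.rep D.rep
  map_unit : C.unit.Preserved toHom.all D.unit
  map_sigma : C.sigma.Preserved toHom.all D.sigma
  map_repUnit : C.repUnit.Preserved rep D.repUnit
  map_repSigma : C.repSigma.Preserved rep D.repSigma
  map_pi : C.pi.Preserved rep D.pi

instance : Category.{u} SigmaPiCwF.{u} where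
  Hom := Hom
  id C :=
    { toHom := CwF.Hom.id C.toCwF
      rep := CwF.RestrictionHom.id C.rep
      map_unit := CwF.UnitStr.Preserved.id _
      map_sigma := CwF.SigmaStr.Preserved.id _
      map_repUnit := CwF.UnitStr.Preserved.id _
      map_repSigma := CwF.SigmaStr.Preserved.id _
      map_pi := CwF.PiStr.Preserved.id _ }
  comp F G :=
    { toHom := F.toHom.comp G.toHom
      rep := F.rep.comp G.rep
      map_unit := F.map_unit.comp G.map_unit
      map_sigma := F.map_sigma.comp G.map_sigma
      map_repUnit := F.map_repUnit.comp G.map_repUnit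
      map_repSigma := F.map_repSigma.comp G.map_repSigma
      map_pi := F.map_pi.comp G.map_pi }
  id_comp _ := rfl
  comp_id _ := rfl
  assoc _ _ _ := rfl

end SigmaPiCwF

/-- A `(Σ, Π_rep, Eq)`-CwF: a `(Σ, Π_rep)`-CwF with extensional equality types. -/
structure SigmaPiEqCwF extends SigmaPiCwF.{u} where
  eqStr : CwF.EqStr toCwF

namespace SigmaPiEqCwF

/-- A morphism of `(Σ, Π_rep, Eq)`-CwFs: a morphism of `(Σ, Π_rep)`-CwFs strictly preserving
equality types. -/
@[ext]
structure Hom (C D : SigmaPiEqCwF.{u}) where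
  hom : C.toSigmaPiCwF ⟶ D.toSigmaPiCwF
  map_eq : CwF.EqStr.Preserved hom.toHom C.eqStr D.eqStr

instance : Category.{u} SigmaPiEqCwF.{u} where
  Hom := Hom
  id C := ⟨𝟙 C.toSigmaPiCwF, CwF.EqStr.Preserved.id _⟩
  comp F G := ⟨F.hom ≫ G.hom, F.map_eq.comp G.map_eq⟩
  id_comp _ := rfl
  comp_id _ := rfl
  assoc _ _ _ := rfl

/-- The forgetful functor from `(Σ, Π_rep, Eq)`-CwFs to `(Σ, Π_rep)`-CwFs. -/
def forget : SigmaPiEqCwF.{u} ⥤ SigmaPiCwF.{u} where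
  obj C := C.toSigmaPiCwF
  map F := Hom.hom F
  map_id _ := rfl
  map_comp _ _ := rfl

end SigmaPiEqCwF

namespace SigmaPiCwF

/-- The action of `F` on terms is bijective: for every type `A` over a context `Γ` of `C`, `F`
induces a bijection from the terms of `A` over `Γ` to the terms of `F A` over `F Γ`. -/
def BijectiveOnTerms {C D : SigmaPiCwF.{u}} (F : C ⟶ D) : Prop :=
  ∀ {Γ : C.Ctx} (A : C.Ty Γ),
    Function.Bijective (fun t : C.Term A => t.map F.toHom (A' := F.ty A) rfl)

/-! ## Cells -/

/-- A family of cells to be attached to `X`: new types, new representable types, new terms,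
and new equations between terms, each over some context of `X`. -/
structure Cells (X : SigmaPiCwF.{u}) where
  TyCell : Type u
  tyCtx : TyCell → X.Ctx
  RepCell : Type u
  repCtx : RepCell → X.Ctx
  TmCell : Type u
  tmCtx : TmCell → X.Ctx
  tmTy : ∀ c : TmCell, X.Ty (tmCtx c)
  EqCell : Type u
  eqCtx : EqCell → X.Ctx
  eqTy : ∀ c : EqCell, X.Ty (eqCtx c)
  lhs : ∀ c : EqCell, X.Term (eqTy c)
  rhs : ∀ c : EqCell, X.Term (eqTy c)

/-- An interpretation of the cells `K` in `Y`: a morphism `X ⟶ Y` with a choice of types,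
representable types and terms of `Y` for the cells, such that the equations hold. -/
structure Cells.Interp {X : SigmaPiCwF.{u}} (K : X.Cells) (Y : SigmaPiCwF.{u}) where
  hom : X ⟶ Y
  ty : ∀ c : K.TyCell, Y.Ty (hom.F.obj (K.tyCtx c))
  rep : ∀ c : K.RepCell, Y.rep.Ty (hom.F.obj (K.repCtx c))
  tm : ∀ c : K.TmCell, Y.Term (hom.ty (K.tmTy c))
  eq : ∀ c : K.EqCell, hom.tm (K.lhs c).1 = hom.tm (K.rhs c).1

/-- The image of an interpretation in `Y` under a morphism `Y ⟶ Z`. -/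
def Cells.Interp.comp {X Y Z : SigmaPiCwF.{u}} {K : X.Cells} (I : K.Interp Y) (h : Y ⟶ Z) :
    K.Interp Z where
  hom := I.hom ≫ h
  ty c := h.ty (I.ty c)
  rep c := h.rep.map (I.rep c)
  tm c := (I.tm c).map h.toHom rfl
  eq c := congrArg h.tm (I.eq c)

/-- The interpretation `I` is generic: interpretations in any `Z` correspond bijectively to
morphisms `Y ⟶ Z`. In other words, `I.hom : X ⟶ Y` is the extension of `X` freely generated by the
cells of `K`, that is, a pushout of a coproduct of generic extensions by a type, a representable
type, a term or an equation between terms. -/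
def Cells.Interp.IsGeneric {X Y : SigmaPiCwF.{u}} {K : X.Cells} (I : K.Interp Y) : Prop :=
  ∀ Z : SigmaPiCwF.{u}, Function.Bijective (fun h : Y ⟶ Z => I.comp h)

/-- The data exhibiting `f : X ⟶ Y` as a cell attachment. -/
structure CellAttachment {X Y : SigmaPiCwF.{u}} (f : X ⟶ Y) where
  cells : X.Cells
  interp : cells.Interp Y
  hom_eq : interp.hom = f
  isGeneric : interp.IsGeneric

/-! ## Second-order generalized algebraic theories -/

/-- A second-order generalized algebraic theory structure on `T`: a presentation of `T` as a
cellular `(Σ, Π_rep)`-CwF, that is, as a transfinite composition (indexed by a well-order `J`),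
starting from an initial `(Σ, Π_rep)`-CwF, of cell attachments. -/
structure SOGAT (T : SigmaPiCwF.{u}) where
  J : Type u
  [linearOrder : LinearOrder J]
  [orderBot : OrderBot J]
  [succOrder : SuccOrder J]
  [wellFoundedLT : WellFoundedLT J]
  base : SigmaPiCwF.{u}
  baseIsInitial : Limits.IsInitial base
  comp : TransfiniteCompositionOfShape J (baseIsInitial.to T)
  attach : ∀ j : J, ¬ IsMax j → CellAttachment (comp.F.map (homOfLE (Order.le_succ j)))

attribute [instance] SOGAT.linearOrder SOGAT.orderBot SOGAT.succOrder SOGAT.wellFoundedLT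

namespace SOGAT

variable {T : SigmaPiCwF.{u}} (P : SOGAT T)

/-- The generating sorts: the types and the representable types attached at the various stages. -/
structure GenTy where
  stage : P.J
  not_isMax : ¬ IsMax stage
  cell : (P.attach stage not_isMax).cells.TyCell ⊕ (P.attach stage not_isMax).cells.RepCell

variable {P}

/-- The morphism from the stage at which a generating sort is available to `T`. -/
def GenTy.toT (S : P.GenTy) : P.comp.F.obj (Order.succ S.stage) ⟶ T :=
  P.comp.incl.app (Order.succ S.stage)

/-- The interpretation in `T` of the cells attached at the stage of `S`. -/
def GenTy.interp (S : P.GenTy) : (P.attach S.stage S.not_isMax).cells.Interp T :=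
  (P.attach S.stage S.not_isMax).interp.comp S.toT

/-- The boundary `∂S`, a context of `T`. -/
def GenTy.bdry (S : P.GenTy) : T.Ctx :=
  match S.cell with
  | Sum.inl c => S.interp.hom.F.obj ((P.attach S.stage S.not_isMax).cells.tyCtx c)
  | Sum.inr c => S.interp.hom.F.obj ((P.attach S.stage S.not_isMax).cells.repCtx c)

/-- The generating sort, as a type of `T` over its boundary. -/
def GenTy.sort (S : P.GenTy) : T.Ty S.bdry :=
  match S with
  | ⟨j, hj, Sum.inl c⟩ => (GenTy.mk (P := P) j hj (Sum.inl c)).interp.ty c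
  | ⟨j, hj, Sum.inr c⟩ => T.rep.incl ((GenTy.mk (P := P) j hj (Sum.inr c)).interp.rep c)

end SOGAT

/-! ## Homotopy relations and equational extensions -/

/-- Homotopy relations on a SOGAT: for every generating sort `S`, a type `x ∼ y` over the context
`(σ : ∂S, x : S σ, y : S σ)`, with a term of type `x ∼ x` over `(σ : ∂S, x : S σ)`. -/
structure HomotopyRelations {T : SigmaPiCwF.{u}} (P : SOGAT T) where
  rel : ∀ S : P.GenTy, T.Ty (T.ext (T.tySub (T.p S.sort) S.sort))
  hrefl : ∀ S : P.GenTy, T.Term (T.tySub (CwF.inst (CwF.gen S.sort)) (rel S))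

namespace HomotopyRelations

variable {T : SigmaPiCwF.{u}} {P : SOGAT T} (R : HomotopyRelations P)

/-- The substitution `⟨σ, x, y⟩`. -/
def cons₂ {S : P.GenTy} {Γ : T.Ctx} (σ : Γ ⟶ S.bdry) (x y : T.Term (T.tySub σ S.sort)) :
    Γ ⟶ T.ext (T.tySub (T.p S.sort) S.sort) :=
  T.pair (CwF.cons σ x) _ y.1 (by rw [y.2, ← T.tySub_comp, CwF.cons, T.pair_p])

/-- A homotopy in `T`: a term `p` of type `x ∼ y` over `Γ`, for terms `x` and `y` of type `S σ`. -/
structure Homotopy where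
  S : P.GenTy
  Γ : T.Ctx
  σ : Γ ⟶ S.bdry
  x : T.Term (T.tySub σ S.sort)
  y : T.Term (T.tySub σ S.sort)
  p : T.Term (T.tySub (cons₂ σ x y) (R.rel S))

variable {R}

/-- The constant homotopy `hrefl x` on the left endpoint of a homotopy. -/
def Homotopy.hreflLeft (e : R.Homotopy) : T.Tm e.Γ :=
  T.tmSub (CwF.cons e.σ e.x) (R.hrefl e.S).1

/-- The morphism `G` sends every marked homotopy `p : x ∼ y` in `E` to a strict equality:
`G x = G y` and `G p = G (hrefl x)`. -/
def HoldsIn (E : Set R.Homotopy) {D : SigmaPiCwF.{u}} (G : T ⟶ D) : Prop :=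
  ∀ e ∈ E, G.tm e.x.1 = G.tm e.y.1 ∧ G.tm e.p.1 = G.tm e.hreflLeft

/-- The morphism `i : T ⟶ TE` is the equational extension of `T` by the family `E` of marked
homotopies: the extension of `T` freely generated by the equations `x = y` and `p = hrefl x` for
the homotopies `p : x ∼ y` in `E`. -/
def IsEquationalExtension (E : Set R.Homotopy) {TE : SigmaPiCwF.{u}} (i : T ⟶ TE) : Prop :=
  HoldsIn E i ∧
    ∀ (D : SigmaPiCwF.{u}) (G : T ⟶ D), HoldsIn E G → ∃! H : TE ⟶ D, i ≫ H = G

end HomotopyRelations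

end SigmaPiCwF

/-! ### Substitution calculus and the action of morphisms on extended contexts -/

namespace CwF

section

variable {C D : CwF.{u}}

/-! The proof is a gluing argument. Write `C` for the equational extension and `F : C ⟶ D` for the
initial morphism to a CwF with equality types. A CwF with equality types is built over `D`, and `F`
is lifted to a morphism `G` into it. Initiality gives a section `R` of the projection to `D` with `F
≫ R = G`, so the behaviour of `F` on terms can be read off from `G`.

A glued type is a type of `D` together with a relation between its terms over the contexts `F(Δ)`,
for `Δ` in `C`, and realizers, which are data from `C`. A glued term is a term of `D` with a natural
action producing realizers. For types in the image of `G` the relation says that the term is the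
image of a term of `C`, and that the realizer determines this term. Surjectivity of `F` follows from
the first part: for a term `u` of `F(A)`, the term `R(u)` of `G(A)`, evaluated at the identity
element, exhibits `u` as an image. Injectivity follows from the second: `F(t) = F(t')` forces `G(t)
= G(t')`, and the realizers stored in these determine `t` and `t'`.

Realizers also settle strictness. The elements of a `Σ`-type of `C` are only isomorphic to pairs,
and likewise for context extensions and `Π`-types, whereas morphisms must preserve the structure on
the nose. Realizers are formal tuples and abstractions of terms of `C`, so once each type has a
faithful realization compatible with the type formers, these isomorphisms become equalities. Types
with a chosen faithful realization form a CwF `Realized.sigmaPiCwF`, which maps strictly to the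
gluing by `Realized.toGluing`. Equality types of the gluing demand equality of realizers, and this
gives reflection.

It remains to choose realizations coherently on all of `C`, that is, to find a section of
`Realized.forget`. This is where the SOGAT presentation is used. The forgetful morphism is a trivial
fibration (`isTrivialFibration_forget`), so the cellular theory lifts through it. Being injective on
terms, it reflects equations, so the lift sends the marked homotopies to equalities and factors
through the extension (`IsTrivialFibration.exists_section`). The argument is assembled in
`bijectiveOnTerms_of_isInitial`. -/

theorem hom_ext {Γ Δ : C.Ctx} {A : C.Ty Γ} {σ τ : Δ ⟶ C.ext A} (hp : σ ≫ C.p A = τ ≫ C.p A)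
    (hq : C.tmSub σ (C.q A) = C.tmSub τ (C.q A)) : σ = τ := by
  have h : C.typ (C.tmSub τ (C.q A)) = C.tySub (τ ≫ C.p A) A := by
    rw [C.typ_sub, C.typ_q, C.tySub_comp]
  exact (C.pair_uniq _ A _ h σ hp hq).trans (C.pair_uniq _ A _ h τ rfl rfl).symm

attribute [simp] pair_p pair_q

@[simp]
theorem pair_p_assoc {Γ Δ Θ : C.Ctx} (σ : Δ ⟶ Γ) (A : C.Ty Γ) (a : C.Tm Δ)
    (h : C.typ a = C.tySub σ A) (τ : Γ ⟶ Θ) : C.pair σ A a h ≫ C.p A ≫ τ = σ ≫ τ := by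
  rw [← Category.assoc, pair_p]

@[simp]
theorem tmSub_comp_pair {Γ Δ Θ : C.Ctx} (τ : Θ ⟶ Δ) (σ : Δ ⟶ Γ) (A : C.Ty Γ) (a : C.Tm Δ)
    (h : C.typ a = C.tySub σ A) :
    C.tmSub (τ ≫ C.pair σ A a h) (C.q A) = C.tmSub τ a := by
  rw [C.tmSub_comp, C.pair_q]

theorem typ_sub_q {Γ Δ : C.Ctx} {A : C.Ty Γ} (σ : Δ ⟶ C.ext A) :
    C.typ (C.tmSub σ (C.q A)) = C.tySub (σ ≫ C.p A) A := by
  rw [C.typ_sub, C.typ_q, C.tySub_comp]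

@[simp]
theorem up_p {Γ Δ : C.Ctx} (σ : Δ ⟶ Γ) {A : C.Ty Γ} {A' : C.Ty Δ} (h : A' = C.tySub σ A) :
    up σ h ≫ C.p A = C.p A' ≫ σ :=
  C.pair_p _ _ _ _

@[simp]
theorem up_p_assoc {Γ Δ Θ : C.Ctx} (σ : Δ ⟶ Γ) {A : C.Ty Γ} {A' : C.Ty Δ}
    (h : A' = C.tySub σ A) (τ : Γ ⟶ Θ) : up σ h ≫ C.p A ≫ τ = C.p A' ≫ σ ≫ τ := by
  rw [← Category.assoc, up_p, Category.assoc]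

@[simp]
theorem up_q {Γ Δ : C.Ctx} (σ : Δ ⟶ Γ) {A : C.Ty Γ} {A' : C.Ty Δ} (h : A' = C.tySub σ A) :
    C.tmSub (up σ h) (C.q A) = C.q A' :=
  C.pair_q _ _ _ _

@[simp]
theorem comp_up_q {Γ Δ Θ : C.Ctx} (σ : Δ ⟶ Γ) {A : C.Ty Γ} {A' : C.Ty Δ}
    (h : A' = C.tySub σ A) (τ : Θ ⟶ C.ext A') :
    C.tmSub (τ ≫ up σ h) (C.q A) = C.tmSub τ (C.q A') := by
  rw [C.tmSub_comp, up_q]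

theorem up_id {Γ : C.Ctx} {A : C.Ty Γ} (h : A = C.tySub (𝟙 Γ) A) :
    up (𝟙 Γ) h = 𝟙 (C.ext A) :=
  hom_ext (by simp) (by simp [C.tmSub_id])

theorem up_comp {Γ Δ Θ : C.Ctx} (τ : Θ ⟶ Δ) (σ : Δ ⟶ Γ) {A : C.Ty Γ} {A' : C.Ty Δ}
    {A'' : C.Ty Θ} (h : A' = C.tySub σ A) (h' : A'' = C.tySub τ A') :
    up τ h' ≫ up σ h = up (τ ≫ σ) (by rw [h', h, C.tySub_comp]) :=
  hom_ext (by simp) (by simp)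

@[simp]
theorem inst_p {Γ : C.Ctx} {A : C.Ty Γ} (a : C.Term A) : inst a ≫ C.p A = 𝟙 Γ :=
  C.pair_p _ _ _ _

@[simp]
theorem inst_p_assoc {Γ Θ : C.Ctx} {A : C.Ty Γ} (a : C.Term A) (τ : Γ ⟶ Θ) :
    inst a ≫ C.p A ≫ τ = τ := by
  rw [← Category.assoc, inst_p, Category.id_comp]

@[simp]
theorem inst_q {Γ : C.Ctx} {A : C.Ty Γ} (a : C.Term A) : C.tmSub (inst a) (C.q A) = a.1 :=
  C.pair_q _ _ _ _

theorem inst_up {Γ Δ : C.Ctx} {A : C.Ty Γ} {A' : C.Ty Δ} (a : C.Term A) (a' : C.Term A')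
    (σ : Δ ⟶ Γ) (h : A' = C.tySub σ A) (ha : a'.1 = C.tmSub σ a.1) :
    inst a' ≫ up σ h = σ ≫ inst a := by
  refine hom_ext (by simp) ?_
  rw [comp_up_q, inst_q, C.tmSub_comp, inst_q, ha]

/-- The action of a morphism `F` on extended contexts, over a substitution `ρ` of the base. -/
def Hom.upMap (F : C.Hom D) {Γ : C.Ctx} {Γ' : D.Ctx} (ρ : F.F.obj Γ ⟶ Γ') {A : C.Ty Γ}
    {A' : D.Ty Γ'} (h : F.ty A = D.tySub ρ A') : F.F.obj (C.ext A) ⟶ D.ext A' :=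
  D.pair (F.F.map (C.p A) ≫ ρ) A' (F.tm (C.q A)) (by
    rw [F.typ_tm, C.typ_q, F.ty_sub, h, D.tySub_comp])

@[simp]
theorem Hom.upMap_p (F : C.Hom D) {Γ : C.Ctx} {Γ' : D.Ctx} (ρ : F.F.obj Γ ⟶ Γ') {A : C.Ty Γ}
    {A' : D.Ty Γ'} (h : F.ty A = D.tySub ρ A') :
    F.upMap ρ h ≫ D.p A' = F.F.map (C.p A) ≫ ρ :=
  D.pair_p _ _ _ _

@[simp]
theorem Hom.upMap_p_assoc (F : C.Hom D) {Γ : C.Ctx} {Γ' Θ : D.Ctx} (ρ : F.F.obj Γ ⟶ Γ')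
    {A : C.Ty Γ} {A' : D.Ty Γ'} (h : F.ty A = D.tySub ρ A') (τ : Γ' ⟶ Θ) :
    F.upMap ρ h ≫ D.p A' ≫ τ = F.F.map (C.p A) ≫ ρ ≫ τ := by
  rw [← Category.assoc, upMap_p, Category.assoc]

@[simp]
theorem Hom.upMap_q (F : C.Hom D) {Γ : C.Ctx} {Γ' : D.Ctx} (ρ : F.F.obj Γ ⟶ Γ') {A : C.Ty Γ}
    {A' : D.Ty Γ'} (h : F.ty A = D.tySub ρ A') :
    D.tmSub (F.upMap ρ h) (D.q A') = F.tm (C.q A) :=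
  D.pair_q _ _ _ _

@[simp]
theorem Hom.comp_upMap_q (F : C.Hom D) {Γ : C.Ctx} {Γ' Θ : D.Ctx} (ρ : F.F.obj Γ ⟶ Γ')
    {A : C.Ty Γ} {A' : D.Ty Γ'} (h : F.ty A = D.tySub ρ A') (τ : Θ ⟶ F.F.obj (C.ext A)) :
    D.tmSub (τ ≫ F.upMap ρ h) (D.q A') = D.tmSub τ (F.tm (C.q A)) := by
  rw [D.tmSub_comp, F.upMap_q]

/-- Reindexing on the source side is absorbed into the base substitution `ρ`; `upMap_up` does the
same on the target side. Squares of extended contexts then reduce to comparing bases. -/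
theorem Hom.map_up_upMap (F : C.Hom D) {Γ Δ : C.Ctx} {Γ' : D.Ctx} (σ : Δ ⟶ Γ)
    (ρ : F.F.obj Γ ⟶ Γ') {A : C.Ty Γ} {A' : D.Ty Γ'} {B : C.Ty Δ} (h : F.ty A = D.tySub ρ A')
    (h' : B = C.tySub σ A) :
    F.F.map (up σ h') ≫ F.upMap ρ h =
      F.upMap (F.F.map σ ≫ ρ) (by rw [h', F.ty_sub, h, D.tySub_comp]) := by
  refine hom_ext ?_ ?_
  · simp only [Category.assoc, upMap_p, ← F.F.map_comp_assoc, up_p]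
  · rw [comp_upMap_q, upMap_q, ← F.tm_sub, up_q]

theorem Hom.upMap_up (F : C.Hom D) {Γ : C.Ctx} {Γ' Γ'' : D.Ctx} (ρ : F.F.obj Γ ⟶ Γ')
    (τ : Γ' ⟶ Γ'') {A : C.Ty Γ} {A' : D.Ty Γ'} {A'' : D.Ty Γ''} (h : F.ty A = D.tySub ρ A')
    (h' : A' = D.tySub τ A'') :
    F.upMap ρ h ≫ up τ h' = F.upMap (ρ ≫ τ) (by rw [h, h', D.tySub_comp]) := by
  refine hom_ext ?_ ?_
  · simp
  · simp

/-- Strict preservation of context extension enters through `eqToHom`. Trading it for `up`, which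
has a universal property, keeps transports out of the later computations. -/
theorem Hom.eqToHom_upMap (F : C.Hom D) {Γ : C.Ctx} {Γ' : D.Ctx} (ρ : F.F.obj Γ ⟶ Γ')
    {A : C.Ty Γ} {A' : D.Ty Γ'} (h : F.ty A = D.tySub ρ A') {B : D.Ty (F.F.obj Γ)}
    (hB : B = F.ty A) (e : D.ext B = F.F.obj (C.ext A)) :
    eqToHom e ≫ F.upMap ρ h = up ρ (hB.trans h) := by
  subst hB
  refine hom_ext ?_ ?_
  · simp [F.map_p]
  · simp [F.tm_q, ← D.tmSub_comp, D.tmSub_id]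

theorem Hom.upMap_id (F : C.Hom D) {Γ : C.Ctx} {A : C.Ty Γ} (h : F.ty A = D.tySub (𝟙 _) (F.ty A)) :
    F.upMap (𝟙 _) h = eqToHom (F.obj_ext A) := by
  have := F.eqToHom_upMap (𝟙 _) h rfl (F.obj_ext A).symm
  rw [up_id] at this
  rw [← cancel_epi (eqToHom (F.obj_ext A).symm), this]
  simp

end

section

variable {C D : CwF.{u}} {F : C.Hom D} {R : Restriction C} {S : Restriction D}

theorem RestrictionHom.extHom_upMap (φ : RestrictionHom F R S) {Γ : C.Ctx} (A : R.Ty Γ)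
    {Γ' : D.Ctx} (ρ : F.F.obj Γ ⟶ Γ') {A' : D.Ty Γ'} (h : F.ty (R.incl A) = D.tySub ρ A') :
    φ.extHom A ≫ F.upMap ρ h = up ρ ((φ.incl_map A).trans h) :=
  F.eqToHom_upMap ρ h (φ.incl_map A) _

theorem RestrictionHom.map_incl (φ : RestrictionHom F R S) {Γ : C.Ctx} {A : R.Ty Γ}
    {Γ' : D.Ctx} {ρ : F.F.obj Γ ⟶ Γ'} {A' : S.Ty Γ'} (h : φ.map A = S.sub ρ A') :
    F.ty (R.incl A) = D.tySub ρ (S.incl A') := by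
  rw [← φ.incl_map, h, S.incl_sub]

theorem incl_eq_sub {Γ Δ : C.Ctx} {σ : Δ ⟶ Γ} {A : R.Ty Γ} {A' : R.Ty Δ} (h : A' = R.sub σ A) :
    R.incl A' = C.tySub σ (R.incl A) := by
  rw [h, R.incl_sub]

/-! ### Sigma types -/

namespace SigmaStr

variable (U : SigmaStr R)

/-- Instances of `A` and `B` are variables subject to equations because in applications they agree
with the substituted types only propositionally. -/
theorem sig_congr {Γ Δ : C.Ctx} {σ : Δ ⟶ Γ} {A : R.Ty Γ} {B : R.Ty (C.ext (R.incl A))}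
    {A' : R.Ty Δ} {B' : R.Ty (C.ext (R.incl A'))} (hA : A' = R.sub σ A)
    (hB : B' = R.sub (up σ (incl_eq_sub hA)) B) : U.sig A' B' = R.sub σ (U.sig A B) := by
  subst hA hB
  exact (U.sig_sub σ A B).symm

theorem fst_eq {Γ Δ : C.Ctx} {σ : Δ ⟶ Γ} {A : R.Ty Γ} {B : R.Ty (C.ext (R.incl A))}
    {A' A'' : R.Ty Δ} {B' : R.Ty (C.ext (R.incl A'))} {B'' : R.Ty (C.ext (R.incl A''))}
    (hA : A' = R.sub σ A) (hB : B' = R.sub (up σ (incl_eq_sub hA)) B)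
    (hA' : A'' = R.sub σ A) (hB' : B'' = R.sub (up σ (incl_eq_sub hA')) B)
    (t : C.Term (R.incl (U.sig A' B'))) (t' : C.Term (R.incl (U.sig A'' B'')))
    (ht : t.1 = t'.1) : (U.fst A' B' t).1 = (U.fst A'' B'' t').1 := by
  subst hA hB hA' hB'
  rw [Subtype.ext ht]

theorem snd_eq {Γ Δ : C.Ctx} {σ : Δ ⟶ Γ} {A : R.Ty Γ} {B : R.Ty (C.ext (R.incl A))}
    {A' A'' : R.Ty Δ} {B' : R.Ty (C.ext (R.incl A'))} {B'' : R.Ty (C.ext (R.incl A''))}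
    (hA : A' = R.sub σ A) (hB : B' = R.sub (up σ (incl_eq_sub hA)) B)
    (hA' : A'' = R.sub σ A) (hB' : B'' = R.sub (up σ (incl_eq_sub hA')) B)
    (t : C.Term (R.incl (U.sig A' B'))) (t' : C.Term (R.incl (U.sig A'' B'')))
    (ht : t.1 = t'.1) : (U.snd A' B' t).1 = (U.snd A'' B'' t').1 := by
  subst hA hB hA' hB'
  rw [Subtype.ext ht]

variable {Γ : C.Ctx} (A : R.Ty Γ) (B : R.Ty (C.ext (R.incl A)))

/-- The generic term of a `Σ`-type. -/
def genSig : C.Term (R.incl (U.sig (R.sub (C.p (R.incl (U.sig A B))) A)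
    (R.sub (up (C.p (R.incl (U.sig A B))) (R.incl_sub _ A)) B))) :=
  ⟨C.q _, by rw [C.typ_q, ← R.incl_sub, U.sig_sub]⟩

/-- The first projection `Γ.(sig A B) ⟶ Γ.A`. -/
def proj₁ : C.ext (R.incl (U.sig A B)) ⟶ C.ext (R.incl A) :=
  C.pair (C.p _) _ (U.fst _ _ (U.genSig A B)).1 (by rw [(U.fst _ _ _).2, R.incl_sub])

/-- The comparison map `Γ.(sig A B) ⟶ Γ.A.B`. -/
def unpair : C.ext (R.incl (U.sig A B)) ⟶ C.ext (R.incl B) :=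
  C.pair (U.proj₁ A B) _ (U.snd _ _ (U.genSig A B)).1 (by
    rw [(U.snd _ _ _).2, ← R.sub_comp, R.incl_sub _ B]
    congr 1
    exact hom_ext (by simp [proj₁]) (by simp [proj₁]))

@[simp]
theorem unpair_p_p : U.unpair A B ≫ C.p _ ≫ C.p _ = C.p _ := by
  simp [unpair, proj₁]

variable {A B}

/-- A map into the extended context amounts to a base `τ` and a term `t` of the instantiated
`Σ`-type; stability of the projection under substitution turns the generic projection into that of
`t`. -/
theorem fst_unpair {Δ : C.Ctx} (σ : Δ ⟶ C.ext (R.incl (U.sig A B))) {τ : Δ ⟶ Γ}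
    (hσ : σ ≫ C.p _ = τ) {A' : R.Ty Δ} {B' : R.Ty (C.ext (R.incl A'))} (hA : A' = R.sub τ A)
    (hB : B' = R.sub (up τ (incl_eq_sub hA)) B) (t : C.Term (R.incl (U.sig A' B')))
    (ht : t.1 = C.tmSub σ (C.q _)) :
    C.tmSub (σ ≫ U.unpair A B ≫ C.p _) (C.q _) = (U.fst A' B' t).1 := by
  subst hσ
  simp only [unpair, pair_p, proj₁, tmSub_comp_pair]
  rw [← U.fst_sub]
  refine U.fst_eq (R.sub_comp _ _ _).symm ?_ hA hB _ _ ht.symm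
  rw [← R.sub_comp (up σ _) (up _ _), up_comp]

theorem snd_unpair {Δ : C.Ctx} (σ : Δ ⟶ C.ext (R.incl (U.sig A B))) {τ : Δ ⟶ Γ}
    (hσ : σ ≫ C.p _ = τ) {A' : R.Ty Δ} {B' : R.Ty (C.ext (R.incl A'))} (hA : A' = R.sub τ A)
    (hB : B' = R.sub (up τ (incl_eq_sub hA)) B) (t : C.Term (R.incl (U.sig A' B')))
    (ht : t.1 = C.tmSub σ (C.q _)) :
    C.tmSub (σ ≫ U.unpair A B) (C.q _) = (U.snd A' B' t).1 := by
  subst hσ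
  simp only [unpair, tmSub_comp_pair]
  rw [← U.snd_sub]
  refine U.snd_eq (R.sub_comp _ _ _).symm ?_ hA hB _ _ ht.symm
  rw [← R.sub_comp (up σ _) (up _ _), up_comp]

theorem fst_inst_unpair (t : C.Term (R.incl (U.sig A B))) :
    inst t ≫ U.unpair A B ≫ C.p _ = inst (U.fst A B t) := by
  refine hom_ext (by simp) ?_
  rw [U.fst_unpair (inst t) (inst_p t) (R.sub_id A).symm (by rw [up_id, R.sub_id]) t
    (inst_q t).symm, inst_q]

theorem snd_inst_unpair (t : C.Term (R.incl (U.sig A B))) :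
    C.tmSub (inst t ≫ U.unpair A B) (C.q _) = (U.snd A B t).1 :=
  U.snd_unpair (inst t) (inst_p t) (R.sub_id A).symm (by rw [up_id, R.sub_id]) t (inst_q t).symm

theorem pair_eq {A' : R.Ty Γ} {B' : R.Ty (C.ext (R.incl A'))} {t t' : C.Term (R.incl (U.sig A' B'))}
    (h₁ : (U.fst _ _ t).1 = (U.fst _ _ t').1) (h₂ : (U.snd _ _ t).1 = (U.snd _ _ t').1) :
    t = t' := by
  rw [← U.pair_fst_snd _ _ t, ← U.pair_fst_snd _ _ t']
  have key : ∀ (a a' : C.Term (R.incl A')) (b : C.Term (R.incl (R.sub (inst a) B')))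
      (b' : C.Term (R.incl (R.sub (inst a') B'))), a.1 = a'.1 → b.1 = b'.1 →
      U.pair A' B' a b = U.pair A' B' a' b' := by
    intro a a' b b' ha hb
    obtain rfl := Subtype.ext ha
    rw [Subtype.ext hb]
  exact key _ _ _ _ h₁ h₂

/-- A map into the source is a base and a term of a `Σ`-type. Composition with `unpair` remembers
the base and both projections of the term, and the `η`-rule recovers the term. -/
instance : Mono (U.unpair A B) where
  right_cancellation {Δ} σ τ h := by
    have hp : σ ≫ C.p _ = τ ≫ C.p _ := by
      rw [← U.unpair_p_p A B, reassoc_of% h]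
    refine hom_ext hp ?_
    let A' := R.sub (σ ≫ C.p _) A
    let B' : R.Ty (C.ext (R.incl A')) := R.sub (up (σ ≫ C.p _) (R.incl_sub _ A)) B
    have e : R.incl (U.sig A' B') = C.tySub (σ ≫ C.p _) (R.incl (U.sig A B)) := by
      rw [← R.incl_sub, U.sig_sub]
    let t : C.Term (R.incl (U.sig A' B')) := ⟨C.tmSub σ (C.q _), by rw [e, typ_sub_q]⟩
    let t' : C.Term (R.incl (U.sig A' B')) := ⟨C.tmSub τ (C.q _), by rw [e, typ_sub_q, hp]⟩
    have : t = t' := by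
      refine U.pair_eq ?_ ?_
      · rw [← U.fst_unpair σ rfl rfl rfl t rfl, ← U.fst_unpair τ hp.symm rfl rfl t' rfl,
          reassoc_of% h]
      · rw [← U.snd_unpair σ rfl rfl rfl t rfl, ← U.snd_unpair τ hp.symm rfl rfl t' rfl, h]
    exact congrArg Subtype.val this

/-- With the monomorphism property, this makes `Γ.(sig A B)` and `Γ.A.B` represent the same data.
The preimage is obtained by pairing the two components of `τ` over the types pulled back to `Δ`. -/
theorem exists_unpair_eq {Δ : C.Ctx} (τ : Δ ⟶ C.ext (R.incl B)) :
    ∃ σ : Δ ⟶ C.ext (R.incl (U.sig A B)), σ ≫ U.unpair A B = τ := by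
  let ρ := τ ≫ C.p _ ≫ C.p _
  let A' := R.sub ρ A
  let B' : R.Ty (C.ext (R.incl A')) := R.sub (up ρ (R.incl_sub _ A)) B
  let a : C.Term (R.incl A') := ⟨C.tmSub (τ ≫ C.p _) (C.q _), by
    rw [typ_sub_q, R.incl_sub, Category.assoc]⟩
  have ha : inst a ≫ up ρ (R.incl_sub _ A) = τ ≫ C.p _ := hom_ext (by simp [ρ]) (by
    rw [comp_up_q, inst_q])
  let b : C.Term (R.incl (R.sub (inst a) B')) := ⟨C.tmSub τ (C.q _), by
    rw [typ_sub_q, ← R.incl_sub, ← ha, R.sub_comp]⟩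
  let t := U.pair A' B' a b
  let σ : Δ ⟶ C.ext (R.incl (U.sig A B)) := C.pair ρ _ t.1 (by
    rw [t.2, ← R.incl_sub, U.sig_sub])
  have hp : σ ≫ C.p _ = ρ := C.pair_p _ _ _ _
  have hq : t.1 = C.tmSub σ (C.q _) := (C.pair_q _ _ _ _).symm
  refine ⟨σ, hom_ext (hom_ext ?_ ?_) ?_⟩
  · simp [hp, ρ]
  · rw [Category.assoc, U.fst_unpair σ hp rfl rfl t hq, U.fst_pair]
  · rw [U.snd_unpair σ hp rfl rfl t hq, U.snd_pair]

end SigmaStr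

/-! ### Transport of `Σ`-types, uniformly for morphisms and substitutions -/

namespace SigmaStr.Preserved

variable {φ : RestrictionHom F R S} {U : SigmaStr R} {V : SigmaStr S} (h : U.Preserved φ V)
  {Γ : C.Ctx} {A : R.Ty Γ} {B : R.Ty (C.ext (R.incl A))} {Γ' : D.Ctx} {ρ : F.F.obj Γ ⟶ Γ'}
  {A' : S.Ty Γ'} {B' : S.Ty (D.ext (S.incl A'))}

include h

theorem map_sig_eq (hA : φ.map A = S.sub ρ A')
    (hB : φ.map B = S.sub (F.upMap ρ (φ.map_incl hA)) B') :
    φ.map (U.sig A B) = S.sub ρ (V.sig A' B') := by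
  rw [h.map_sig]
  refine V.sig_congr hA ?_
  rw [hB, ← S.sub_comp, φ.extHom_upMap]

/-- Preservation of both projections is packaged as one commuting square of substitutions. The base
`ρ` is arbitrary, so the identity morphism gives stability under substitution (`up_unpair`), and `ρ
= 𝟙` gives preservation by `F`. -/
theorem map_unpair (hA : φ.map A = S.sub ρ A')
    (hB : φ.map B = S.sub (F.upMap ρ (φ.map_incl hA)) B') :
    F.upMap ρ (φ.map_incl (h.map_sig_eq hA hB)) ≫ V.unpair A' B' =
      F.F.map (U.unpair A B) ≫ F.upMap (F.upMap ρ (φ.map_incl hA)) (φ.map_incl hB) := by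
  set σ := F.upMap ρ (φ.map_incl (h.map_sig_eq hA hB))
  have hσ : σ ≫ D.p _ = F.F.map (C.p _) ≫ ρ := F.upMap_p _ _
  let t := U.genSig A B
  have hA₁ : φ.map (R.sub (C.p (R.incl (U.sig A B))) A) = S.sub (F.F.map (C.p _) ≫ ρ) A' := by
    rw [φ.map_sub, hA, S.sub_comp]
  have hB₁ : S.sub (φ.extHom _) (φ.map (R.sub (up (C.p (R.incl (U.sig A B))) (R.incl_sub _ A)) B)) =
      S.sub (up (F.F.map (C.p _) ≫ ρ) (incl_eq_sub hA₁)) B' := by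
    rw [φ.map_sub _ B, hB, ← S.sub_comp, ← S.sub_comp, Category.assoc, F.map_up_upMap,
      φ.extHom_upMap]
  have e := h.map_sig _ (R.sub (up (C.p (R.incl (U.sig A B))) (R.incl_sub _ A)) B)
  have ht : (t.map F (by rw [← e, φ.incl_map]) : D.Term (S.incl (V.sig _ _))).1 =
      D.tmSub σ (D.q _) := (F.upMap_q _ _).symm
  have h₁ := V.fst_unpair σ hσ hA₁ hB₁ _ ht
  have h₂ := V.snd_unpair σ hσ hA₁ hB₁ _ ht
  rw [h.map_fst] at h₁
  rw [h.map_snd] at h₂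
  refine hom_ext (hom_ext ?_ ?_) ?_
  · simp only [Category.assoc, V.unpair_p_p, hσ, Hom.upMap_p]
    rw [← F.F.map_comp_assoc, ← F.F.map_comp_assoc, Category.assoc, U.unpair_p_p]
  · rw [Category.assoc, h₁, Category.assoc, F.upMap_p, ← F.F.map_comp_assoc, Hom.comp_upMap_q,
      ← F.tm_sub, ← Category.id_comp (U.unpair A B ≫ _), U.fst_unpair (𝟙 _) (Category.id_comp _)
      rfl rfl t (C.tmSub_id _).symm]
  · rw [h₂, Hom.comp_upMap_q, ← F.tm_sub, ← Category.id_comp (U.unpair A B),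
      U.snd_unpair (𝟙 _) (Category.id_comp _) rfl rfl t (C.tmSub_id _).symm]

/-- Both sides are equalities of maps into an extended context, before and after composition with
`unpair`, which is a monomorphism. -/
theorem map_tm_iff (hA : φ.map A = S.sub ρ A')
    (hB : φ.map B = S.sub (F.upMap ρ (φ.map_incl hA)) B') (t : C.Term (R.incl (U.sig A B)))
    (t' : D.Term (S.incl (V.sig A' B'))) :
    F.tm t.1 = D.tmSub ρ t'.1 ↔ F.tm (U.fst A B t).1 = D.tmSub ρ (V.fst A' B' t').1 ∧
      F.tm (U.snd A B t).1 = D.tmSub ρ (V.snd A' B' t').1 := by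
  set σ := F.upMap ρ (φ.map_incl (h.map_sig_eq hA hB))
  have hσ : F.F.map (inst t) ≫ σ ≫ D.p _ = ρ := by
    rw [F.upMap_p, ← F.F.map_comp_assoc, inst_p, F.F.map_id, Category.id_comp]
  have h₁ : F.tm t.1 = D.tmSub (F.F.map (inst t) ≫ σ) (D.q _) := by
    rw [F.comp_upMap_q, ← F.tm_sub, inst_q]
  have h₂ : D.tmSub ρ t'.1 = D.tmSub (ρ ≫ inst t') (D.q _) := by
    rw [D.tmSub_comp, inst_q]
  have h₃ : F.tm (U.fst A B t).1 =
      D.tmSub ((F.F.map (inst t) ≫ σ) ≫ V.unpair A' B' ≫ D.p _) (D.q _) := by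
    rw [Category.assoc, ← Category.assoc σ, h.map_unpair hA hB, Category.assoc, F.upMap_p,
      ← F.F.map_comp_assoc, ← F.F.map_comp_assoc, F.comp_upMap_q, ← F.tm_sub, Category.assoc,
      U.fst_inst_unpair, inst_q]
  have h₄ : F.tm (U.snd A B t).1 =
      D.tmSub ((F.F.map (inst t) ≫ σ) ≫ V.unpair A' B') (D.q _) := by
    rw [Category.assoc, h.map_unpair hA hB, ← F.F.map_comp_assoc, F.comp_upMap_q, ← F.tm_sub,
      U.snd_inst_unpair]
  have h₅ : D.tmSub ρ (V.fst A' B' t').1 =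
      D.tmSub ((ρ ≫ inst t') ≫ V.unpair A' B' ≫ D.p _) (D.q _) := by
    rw [Category.assoc, V.fst_inst_unpair, D.tmSub_comp, inst_q]
  have h₆ : D.tmSub ρ (V.snd A' B' t').1 =
      D.tmSub ((ρ ≫ inst t') ≫ V.unpair A' B') (D.q _) := by
    rw [Category.assoc, D.tmSub_comp, V.snd_inst_unpair]
  constructor
  · intro e
    have : F.F.map (inst t) ≫ σ = ρ ≫ inst t' := by
      refine hom_ext (by simpa using hσ) ?_
      rw [← h₁, ← h₂, e]
    rw [h₃, h₄, h₅, h₆, this]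
    exact ⟨rfl, rfl⟩
  · rintro ⟨e₁, e₂⟩
    have : F.F.map (inst t) ≫ σ = ρ ≫ inst t' := by
      rw [← cancel_mono (V.unpair A' B')]
      refine hom_ext (hom_ext ?_ ?_) ?_
      · simp only [Category.assoc, V.unpair_p_p, hσ, inst_p, Category.comp_id]
      · rw [Category.assoc _ (V.unpair A' B'), ← h₃, Category.assoc _ (V.unpair A' B'), ← h₅, e₁]
      · rw [← h₄, ← h₆, e₂]
    rw [h₁, h₂, this]

end SigmaStr.Preserved

namespace SigmaStr

variable (U : SigmaStr R)

theorem up_unpair {Γ Δ : C.Ctx} {σ : Δ ⟶ Γ} {A : R.Ty Γ} {B : R.Ty (C.ext (R.incl A))}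
    {A' : R.Ty Δ} {B' : R.Ty (C.ext (R.incl A'))} (hA : A' = R.sub σ A)
    (hB : B' = R.sub (up σ (incl_eq_sub hA)) B) :
    up σ (incl_eq_sub (U.sig_congr hA hB)) ≫ U.unpair A B =
      U.unpair A' B' ≫ up (up σ (incl_eq_sub hA)) (incl_eq_sub hB) :=
  (Preserved.id U).map_unpair hA hB

end SigmaStr

end

end CwF

namespace CwF

variable {C D : CwF.{u}} {F : C.Hom D} {R : Restriction C} {S : Restriction D}

/-! ### Pi types -/

namespace PiStr

variable (U : PiStr R)

theorem pi_congr {Γ Δ : C.Ctx} {σ : Δ ⟶ Γ} {A : R.Ty Γ} {B : C.Ty (C.ext (R.incl A))}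
    {A' : R.Ty Δ} {B' : C.Ty (C.ext (R.incl A'))} (hA : A' = R.sub σ A)
    (hB : B' = C.tySub (up σ (incl_eq_sub hA)) B) : U.pi A' B' = C.tySub σ (U.pi A B) := by
  subst hA hB
  exact (U.pi_sub σ A B).symm

/-- The structure only asserts stability of abstraction. Writing `f` as an abstraction transfers
this to its inverse. -/
theorem lam_symm_eq {Γ Δ : C.Ctx} {σ : Δ ⟶ Γ} {A : R.Ty Γ} {B : C.Ty (C.ext (R.incl A))}
    {A' : R.Ty Δ} {B' : C.Ty (C.ext (R.incl A'))} (hA : A' = R.sub σ A)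
    (hB : B' = C.tySub (up σ (incl_eq_sub hA)) B) (f : C.Term (U.pi A B))
    (f' : C.Term (U.pi A' B')) (hf : f'.1 = C.tmSub σ f.1) :
    ((U.lam A' B').symm f').1 =
      C.tmSub (up σ (incl_eq_sub hA)) ((U.lam A B).symm f).1 := by
  subst hA hB
  let b := (U.lam A B).symm f
  have hb : f = U.lam A B b := ((U.lam A B).apply_symm_apply f).symm
  have : f' = U.lam _ _ (b.sub (up σ (R.incl_sub σ A)) rfl) := by
    apply Subtype.ext
    rw [U.lam_sub, hf, hb]
  rw [this, Equiv.symm_apply_apply]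
  rfl

variable {Γ : C.Ctx} (A : R.Ty Γ) (B : C.Ty (C.ext (R.incl A)))

/-- The generic term of a `Π`-type. -/
def genPi : C.Term (U.pi (R.sub (C.p (U.pi A B)) A)
    (C.tySub (up (C.p (U.pi A B)) (R.incl_sub _ A)) B)) :=
  ⟨C.q _, by rw [C.typ_q, U.pi_sub]⟩

/-- The evaluation map `Γ.(pi A B).A[p] ⟶ Γ.A.B`. -/
def ev : C.ext (R.incl (R.sub (C.p (U.pi A B)) A)) ⟶ C.ext B :=
  C.pair (up (C.p _) (R.incl_sub _ A)) B ((U.lam _ _).symm (U.genPi A B)).1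
    ((U.lam _ _).symm (U.genPi A B)).2

@[simp]
theorem ev_p : U.ev A B ≫ C.p B = up (C.p _) (R.incl_sub _ A) :=
  C.pair_p _ _ _ _

variable {A B}

/-- Evaluation is defined from the generic function, so pulling it back along `σ` yields the body of
the particular function that `σ` names. -/
theorem up_ev_q {Δ : C.Ctx} (σ : Δ ⟶ C.ext (U.pi A B)) {τ : Δ ⟶ Γ} (hσ : σ ≫ C.p _ = τ)
    {A' : R.Ty Δ} {B' : C.Ty (C.ext (R.incl A'))} (hA : A' = R.sub τ A)
    (hB : B' = C.tySub (up τ (incl_eq_sub hA)) B) (f : C.Term (U.pi A' B'))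
    (hf : f.1 = C.tmSub σ (C.q _))
    (h : R.incl A' = C.tySub σ (R.incl (R.sub (C.p (U.pi A B)) A))) :
    C.tmSub (up σ h ≫ U.ev A B) (C.q B) = ((U.lam A' B').symm f).1 := by
  subst hσ
  rw [ev, tmSub_comp_pair]
  refine (U.lam_symm_eq (σ := σ) (hA.trans (R.sub_comp _ _ _)) ?_ _ f hf).symm
  rw [hB, ← C.tySub_comp, up_comp]

theorem up_inst_ev_q (f : C.Term (U.pi A B))
    (h : R.incl A = C.tySub (inst f) (R.incl (R.sub (C.p (U.pi A B)) A))) :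
    C.tmSub (up (inst f) h ≫ U.ev A B) (C.q B) = ((U.lam A B).symm f).1 :=
  U.up_ev_q (inst f) (inst_p f) (R.sub_id A).symm (by rw [up_id, C.tySub_id]) f
    (inst_q f).symm h

theorem up_inst_ev (f : C.Term (U.pi A B))
    (h : R.incl A = C.tySub (inst f) (R.incl (R.sub (C.p (U.pi A B)) A))) :
    up (inst f) h ≫ U.ev A B = inst ((U.lam A B).symm f) := by
  refine hom_ext ?_ ?_
  · rw [Category.assoc, ev_p, up_comp]
    refine hom_ext ?_ ?_ <;> simp [C.tmSub_id]
  · rw [U.up_inst_ev_q, inst_q]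

/-- This is the `η`-rule as a cancellation property: a function over `Δ` is determined by its value
at the generic argument, since `lam` is a bijection. It plays the role that the monomorphism
`unpair` plays for `Σ`-types. -/
theorem eq_of_up_ev {Δ : C.Ctx} {σ τ : Δ ⟶ C.ext (U.pi A B)} (hp : σ ≫ C.p _ = τ ≫ C.p _)
    {A' : R.Ty Δ} (hA : A' = R.sub (σ ≫ C.p _) A)
    (hσ : R.incl A' = C.tySub σ (R.incl (R.sub (C.p (U.pi A B)) A)))
    (hτ : R.incl A' = C.tySub τ (R.incl (R.sub (C.p (U.pi A B)) A)))
    (h : C.tmSub (up σ hσ ≫ U.ev A B) (C.q B) = C.tmSub (up τ hτ ≫ U.ev A B) (C.q B)) :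
    σ = τ := by
  refine hom_ext hp ?_
  let B' : C.Ty (C.ext (R.incl A')) := C.tySub (up (σ ≫ C.p _) (incl_eq_sub hA)) B
  have e : U.pi A' B' = C.tySub (σ ≫ C.p _) (U.pi A B) := U.pi_congr hA rfl
  let f : C.Term (U.pi A' B') := ⟨C.tmSub σ (C.q _), by rw [e, typ_sub_q]⟩
  let g : C.Term (U.pi A' B') := ⟨C.tmSub τ (C.q _), by rw [e, typ_sub_q, hp]⟩
  rw [U.up_ev_q σ rfl hA rfl f rfl, U.up_ev_q τ hp.symm hA rfl g rfl] at h
  have := (U.lam A' B').symm.injective (Subtype.ext h)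
  exact congrArg Subtype.val this

end PiStr

/-! ### Transport of `Π`-types, uniformly for morphisms and substitutions -/

namespace PiStr.Preserved

variable {φ : RestrictionHom F R S} {U : PiStr R} {V : PiStr S} (h : U.Preserved φ V)
  {Γ : C.Ctx} {A : R.Ty Γ} {B : C.Ty (C.ext (R.incl A))} {Γ' : D.Ctx} {ρ : F.F.obj Γ ⟶ Γ'}
  {A' : S.Ty Γ'} {B' : D.Ty (D.ext (S.incl A'))}

include h

theorem map_pi_eq (hA : φ.map A = S.sub ρ A')
    (hB : F.ty B = D.tySub (F.upMap ρ (φ.map_incl hA)) B') :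
    F.ty (U.pi A B) = D.tySub ρ (V.pi A' B') := by
  rw [h.map_pi]
  refine V.pi_congr hA ?_
  rw [hB, ← D.tySub_comp, φ.extHom_upMap]

theorem map_lam_symm {f : C.Term (U.pi A B)} (hA : φ.map A = S.sub ρ A')
    (hB : F.ty B = D.tySub (F.upMap ρ (φ.map_incl hA)) B') (f' : D.Term (V.pi A' B'))
    (hf : F.tm f.1 = D.tmSub ρ f'.1) :
    F.tm ((U.lam A B).symm f).1 = D.tmSub (F.upMap ρ (φ.map_incl hA)) ((V.lam A' B').symm f').1 :=
        by
  let b := (U.lam A B).symm f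
  have hb : f = U.lam A B b := ((U.lam A B).apply_symm_apply f).symm
  have h₁ := h.map_lam A B b
  rw [← hb] at h₁
  have h₂ := V.lam_symm_eq (σ := ρ) hA (by rw [hB, ← D.tySub_comp, φ.extHom_upMap]) f'
    _ (h₁.trans hf)
  rw [Equiv.symm_apply_apply, ← φ.extHom_upMap A ρ (φ.map_incl hA), D.tmSub_comp] at h₂
  -- Substituting along the inverse identification of extended contexts cancels `extHom` on both
  -- sides.
  have h₃ := congrArg (D.tmSub (eqToHom (by rw [φ.incl_map, F.obj_ext]) :
    F.F.obj (C.ext (R.incl A)) ⟶ D.ext (S.incl (φ.map A)))) h₂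
  change D.tmSub _ (D.tmSub _ (F.tm b.1)) = _ at h₃
  simpa [RestrictionHom.extHom, ← D.tmSub_comp, D.tmSub_id] using h₃

theorem map_ev (hA : φ.map A = S.sub ρ A')
    (hB : F.ty B = D.tySub (F.upMap ρ (φ.map_incl hA)) B')
    (hAp : F.ty (R.incl (R.sub (C.p (U.pi A B)) A)) =
      D.tySub (F.upMap ρ (h.map_pi_eq hA hB)) (S.incl (S.sub (D.p (V.pi A' B')) A'))) :
    F.upMap (F.upMap ρ (h.map_pi_eq hA hB)) hAp ≫ V.ev A' B' =
      F.F.map (U.ev A B) ≫ F.upMap (F.upMap ρ (φ.map_incl hA)) hB := by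
  set σ := F.upMap ρ (h.map_pi_eq hA hB)
  have hσ : σ ≫ D.p _ = F.F.map (C.p _) ≫ ρ := F.upMap_p _ _
  have hA₁ : φ.map (R.sub (C.p (U.pi A B)) A) = S.sub σ (S.sub (D.p (V.pi A' B')) A') := by
    rw [φ.map_sub, hA, ← S.sub_comp, ← S.sub_comp, hσ]
  have e : F.upMap σ hAp ≫ up (D.p _) (S.incl_sub _ A') =
      F.F.map (up (C.p _) (R.incl_sub _ A)) ≫ F.upMap ρ (φ.map_incl hA) := by
    simp only [F.upMap_up, F.map_up_upMap, hσ]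
  refine hom_ext ?_ ?_
  · rw [Category.assoc, ev_p, Category.assoc, F.upMap_p, ← F.F.map_comp_assoc, ev_p, e]
  · rw [ev, tmSub_comp_pair, Hom.comp_upMap_q, ← F.tm_sub, ev, C.pair_q]
    refine (h.map_lam_symm (f := U.genPi A B) hA₁ ?_ (V.genPi A' B') ?_).symm
    · rw [F.ty_sub, hB, ← D.tySub_comp, ← D.tySub_comp, e]
    · exact (F.upMap_q _ _).symm

end PiStr.Preserved

namespace PiStr

variable (U : PiStr R)

theorem up_up_ev {Γ Δ : C.Ctx} {σ : Δ ⟶ Γ} {A : R.Ty Γ} {B : C.Ty (C.ext (R.incl A))}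
    {A' : R.Ty Δ} {B' : C.Ty (C.ext (R.incl A'))} (hA : A' = R.sub σ A)
    (hB : B' = C.tySub (up σ (incl_eq_sub hA)) B)
    (hAp : R.incl (R.sub (C.p (U.pi A' B')) A') =
      C.tySub (up σ (U.pi_congr hA hB)) (R.incl (R.sub (C.p (U.pi A B)) A))) :
    up (up σ (U.pi_congr hA hB)) hAp ≫ U.ev A B =
      U.ev A' B' ≫ up (up σ (incl_eq_sub hA)) hB :=
  (Preserved.id U).map_ev hA hB hAp

end PiStr

end CwF

namespace SigmaPiCwF

/-! ## Trivial fibrations -/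

/-- A morphism is a trivial fibration if it lifts types and representable types over a given
context, and is bijective on terms. -/
structure IsTrivialFibration {W V : SigmaPiCwF.{u}} (p : W ⟶ V) : Prop where
  ty_surjective : ∀ {Γ : W.Ctx} (A : V.Ty (p.F.obj Γ)), ∃ A' : W.Ty Γ, p.ty A' = A
  rep_surjective : ∀ {Γ : W.Ctx} (A : V.rep.Ty (p.F.obj Γ)), ∃ A' : W.rep.Ty Γ, p.rep.map A' = A
  bijective : BijectiveOnTerms p

namespace IsTrivialFibration

variable {W V : SigmaPiCwF.{u}} {p : W ⟶ V} (hp : IsTrivialFibration p)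

include hp

theorem tm_injective {Γ : W.Ctx} {t t' : W.Tm Γ} (h : W.typ t = W.typ t')
    (h' : p.tm t = p.tm t') : t = t' := by
  have := (hp.bijective (W.typ t')).1 (a₁ := ⟨t, h⟩) (a₂ := ⟨t', rfl⟩) (Subtype.ext h')
  exact congrArg Subtype.val this

/-- Type and representable cells lift by surjectivity, term cells by surjectivity on terms, and
equation cells by injectivity on terms, the two sides having the same type in `W`. -/
theorem exists_interp {X : SigmaPiCwF.{u}} {K : X.Cells} (I : K.Interp V) (f : X ⟶ W)
    (h : I.hom = f ≫ p) : ∃ I' : K.Interp W, I'.hom = f ∧ I'.comp p = I := by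
  obtain ⟨hom, ty, rep, tm, eq⟩ := I
  dsimp only at h
  subst h
  choose ty' hty using fun c => hp.ty_surjective (ty c)
  choose rep' hrep using fun c => hp.rep_surjective (rep c)
  choose tm' htm using fun c => (hp.bijective (f.ty (K.tmTy c))).2 (tm c)
  refine ⟨⟨f, ty', rep', tm', fun c => hp.tm_injective ?_ (eq c)⟩, rfl, ?_⟩
  · rw [f.typ_tm, f.typ_tm, (K.lhs c).2, (K.rhs c).2]
  -- Replacing the given interpretations by the images of the chosen lifts makes the two
  -- interpretations definitionally equal.
  · obtain rfl : ty = fun c => p.ty (ty' c) := funext fun c => (hty c).symm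
    obtain rfl : rep = fun c => p.rep.map (rep' c) := funext fun c => (hrep c).symm
    obtain rfl : tm = fun c => (tm' c).map p.toHom rfl := funext fun c => (htm c).symm
    rfl

/-- By genericity, a morphism out of `Y` is an interpretation of the cells, so a diagonal filler is
exactly a lift of an interpretation. -/
theorem hasLiftingProperty_of_attachment {X Y : SigmaPiCwF.{u}} {f : X ⟶ Y}
    (a : CellAttachment f) : HasLiftingProperty f p where
  sq_hasLift {g b} sq := by
    obtain ⟨K, I, rfl, hI⟩ := a
    obtain ⟨I', h₁, h₂⟩ := hp.exists_interp (I.comp b) g sq.w.symm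
    obtain ⟨l, hl⟩ := (hI W).2 I'
    dsimp only at hl
    refine ⟨⟨⟨l, ?_, (hI V).1 ?_⟩⟩⟩
    · rw [← h₁, ← hl]; rfl
    · change (I.comp l).comp p = _
      rw [hl, h₂]

/-- The lifting property against cell attachments passes to their transfinite composite. Over the
initial first stage the square commutes automatically. -/
theorem exists_lift {T : SigmaPiCwF.{u}} (P : SOGAT T) (f : T ⟶ V) : ∃ g : T ⟶ W, g ≫ p = f := by
  have h : HasLiftingProperty (P.comp.incl.app ⊥) p :=
    HasLiftingProperty.transfiniteComposition.hasLiftingProperty_ι_app_bot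
      (hc := P.comp.isColimit)
      (fun j hj => hp.hasLiftingProperty_of_attachment (P.attach j hj))
  let e : P.base ≅ P.comp.F.obj ⊥ := P.comp.isoBot.symm
  have hI : Limits.IsInitial (P.comp.F.obj ⊥) := P.baseIsInitial.ofIso e
  have sq : CommSq (hI.to W) (P.comp.incl.app ⊥) p f := ⟨hI.hom_ext _ _⟩
  exact ⟨sq.lift, sq.fac_right⟩

/-- First `i` is lifted to `g : T ⟶ W`. Since `p` is injective on terms of a fixed type, the
equations imposed by the extension already hold for `g`, which therefore factors through `V`. -/
theorem exists_section {T : SigmaPiCwF.{u}} (P : SOGAT T) {R : HomotopyRelations P}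
    {E : Set R.Homotopy} {i : T ⟶ V} (hi : HomotopyRelations.IsEquationalExtension E i) :
    ∃ s : V ⟶ W, s ≫ p = 𝟙 V := by
  obtain ⟨g, hg⟩ := hp.exists_lift P i
  have H : HomotopyRelations.HoldsIn E g := by
    intro e he
    obtain ⟨h₁, h₂⟩ := hi.1 e he
    subst hg
    have hxy : g.tm e.x.1 = g.tm e.y.1 := by
      refine hp.tm_injective ?_ h₁
      rw [g.typ_tm, g.typ_tm, e.x.2, e.y.2]
    refine ⟨hxy, hp.tm_injective ?_ h₂⟩
    -- Fibrewise injectivity needs the images of the homotopy and of `hrefl` to have the same type.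
    -- Once `x` and `y` are identified by `g`, the substitution `⟨σ, x, y⟩` becomes `⟨σ, x, x⟩`, and
    -- their types agree.
    have key : g.F.map (HomotopyRelations.cons₂ e.σ e.x e.y) =
        g.F.map (CwF.cons e.σ e.x) ≫ g.F.map (CwF.inst (CwF.gen e.S.sort)) := by
      have hj : Mono (eqToHom (g.obj_ext (T.tySub (T.p e.S.sort) e.S.sort))) := inferInstance
      rw [← cancel_mono (eqToHom (g.obj_ext (T.tySub (T.p e.S.sort) e.S.sort)))]
      refine CwF.hom_ext ?_ ?_
      · rw [Category.assoc, Category.assoc, Category.assoc, ← g.map_p, ← g.F.map_comp,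
          ← g.F.map_comp, ← g.F.map_comp, CwF.inst_p, Category.comp_id,
          HomotopyRelations.cons₂, T.pair_p]
      · rw [W.tmSub_comp, W.tmSub_comp, ← g.tm_q, ← g.tm_sub, HomotopyRelations.cons₂, T.pair_q,
          W.tmSub_comp, ← g.tm_sub, CwF.inst_q, ← g.tm_sub, CwF.gen, CwF.cons, T.pair_q, hxy]
    rw [g.typ_tm, g.typ_tm, e.p.2, HomotopyRelations.Homotopy.hreflLeft, T.typ_sub,
      (R.hrefl e.S).2, ← T.tySub_comp, g.ty_sub, g.ty_sub, key, g.F.map_comp]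
  obtain ⟨s, hs, -⟩ := hi.2 W g H
  refine ⟨s, ?_⟩
  -- Both `s ≫ p` and the identity extend `i` along itself, so uniqueness identifies them.
  obtain ⟨t, -, ht⟩ := hi.2 V i hi.1
  rw [ht (s ≫ p) (by dsimp only; rw [← Category.assoc, hs, hg]), ht (𝟙 V) (Category.comp_id i)]

end IsTrivialFibration

/-! ## Realizers -/

/-- Realizers over a context of `C`: formal tuples and abstractions of terms of `C`. -/
inductive Realizer (C : SigmaPiCwF.{u}) : C.Ctx → Type u
  | unit {Γ : C.Ctx} : Realizer C Γ
  | tm {Γ : C.Ctx} (t : C.Tm Γ) : Realizer C Γ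
  | pair {Γ : C.Ctx} (a b : Realizer C Γ) : Realizer C Γ
  | lam {Γ : C.Ctx} (A : C.rep.Ty Γ) (b : Realizer C (C.ext (C.rep.incl A))) : Realizer C Γ

namespace Realizer

variable {C : SigmaPiCwF.{u}}

/-- Substitution in realizers. -/
def sub {Γ : C.Ctx} (k : Realizer C Γ) : ∀ {Δ : C.Ctx}, (Δ ⟶ Γ) → Realizer C Δ :=
  match k with
  | unit => fun _ => unit
  | tm t => fun σ => tm (C.tmSub σ t)
  | pair a b => fun σ => pair (a.sub σ) (b.sub σ)
  | lam A b => fun σ => lam (C.rep.sub σ A) (b.sub (CwF.up σ (C.rep.incl_sub σ A)))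

variable {Γ Δ Θ : C.Ctx}

@[simp]
theorem unit_sub (σ : Δ ⟶ Γ) : (unit : Realizer C Γ).sub σ = unit := by rw [sub]

@[simp]
theorem tm_sub (σ : Δ ⟶ Γ) (t : C.Tm Γ) : (tm t).sub σ = tm (C.tmSub σ t) := by rw [sub]

@[simp]
theorem pair_sub (σ : Δ ⟶ Γ) (a b : Realizer C Γ) :
    (pair a b).sub σ = pair (a.sub σ) (b.sub σ) := by rw [sub]

theorem lam_sub (σ : Δ ⟶ Γ) (A : C.rep.Ty Γ) (b : Realizer C (C.ext (C.rep.incl A)))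
    {A' : C.rep.Ty Δ} (h : A' = C.rep.sub σ A) :
    (lam A b).sub σ = lam A' (b.sub (CwF.up σ (CwF.incl_eq_sub h))) := by
  subst h
  rw [sub]

@[simp]
theorem sub_id (k : Realizer C Γ) : k.sub (𝟙 Γ) = k := by
  induction k with
  | unit => simp
  | tm t => simp [C.tmSub_id]
  | pair a b ha hb => simp [ha, hb]
  | lam A b hb => rw [lam_sub _ _ _ (C.rep.sub_id A).symm, CwF.up_id, hb]

theorem sub_comp (k : Realizer C Γ) {Δ Θ : C.Ctx} (τ : Θ ⟶ Δ) (σ : Δ ⟶ Γ) :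
    k.sub (τ ≫ σ) = (k.sub σ).sub τ := by
  induction k generalizing Δ Θ with
  | unit => simp
  | tm t => simp [C.tmSub_comp]
  | pair a b ha hb => simp [ha, hb]
  | lam A b hb =>
    rw [lam_sub _ _ _ rfl, lam_sub _ _ _ rfl,
      lam_sub _ _ _ (C.rep.sub_comp τ σ A), ← hb, CwF.up_comp]

/-- The first component of a pair. -/
def fst : Realizer C Γ → Realizer C Γ
  | pair a _ => a
  -- The default value is never relevant: projections are applied to realizers of extended contexts
  -- and of `Σ`-types, which are pairs.
  | k => k

/-- The second component of a pair. -/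
def snd : Realizer C Γ → Realizer C Γ
  | pair _ b => b
  | k => k

@[simp]
theorem fst_pair (a b : Realizer C Γ) : (pair a b).fst = a := rfl

@[simp]
theorem snd_pair (a b : Realizer C Γ) : (pair a b).snd = b := rfl

theorem lam_injective {A : C.rep.Ty Γ} {b b' : Realizer C (C.ext (C.rep.incl A))}
    (h : lam A b = lam A b') : b = b' := by
  simpa using h

end Realizer

/-! ## Gluing along a morphism

The contexts of the gluing of `F : C ⟶ D` are contexts of `D` equipped with a presheaf of realized
generalized elements at the contexts of `C`. -/

namespace Gluing

variable {C D : SigmaPiCwF.{u}} (F : SigmaPiCwF.Hom C D)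

/-- A context of the gluing. -/
structure Obj where
  base : D.Ctx
  mem : ∀ {Δ : C.Ctx}, (F.F.obj Δ ⟶ base) → C.Realizer Δ → Prop
  mem_sub : ∀ {Δ Θ : C.Ctx} (f : Θ ⟶ Δ) {g : F.F.obj Δ ⟶ base} {k : C.Realizer Δ},
    mem g k → mem (F.F.map f ≫ g) (k.sub f)

variable {F}

theorem Obj.mem_congr (X : Obj F) {Δ : C.Ctx} {g g' : F.F.obj Δ ⟶ X.base} {k k' : C.Realizer Δ}
    (hg : g = g') (hk : k = k') (h : X.mem g k) : X.mem g' k' := by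
  subst hg hk
  exact h

/-- A substitution of the gluing. -/
@[ext]
structure Hom (X Y : Obj F) where
  base : X.base ⟶ Y.base
  real : ∀ {Δ : C.Ctx} (g : F.F.obj Δ ⟶ X.base) (k : C.Realizer Δ), X.mem g k → C.Realizer Δ
  mem : ∀ {Δ : C.Ctx} {g : F.F.obj Δ ⟶ X.base} {k : C.Realizer Δ} (h : X.mem g k),
    Y.mem (g ≫ base) (real g k h)
  nat : ∀ {Δ Θ : C.Ctx} (f : Θ ⟶ Δ) {g : F.F.obj Δ ⟶ X.base} {k : C.Realizer Δ} (h : X.mem g k),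
    real (F.F.map f ≫ g) (k.sub f) (X.mem_sub f h) = (real g k h).sub f

theorem Hom.real_congr {X Y : Obj F} (σ : Hom X Y) {Δ : C.Ctx} {g g' : F.F.obj Δ ⟶ X.base}
    {k k' : C.Realizer Δ} (hg : g = g') (hk : k = k') (h : X.mem g k) :
    σ.real g k h = σ.real g' k' (hg ▸ hk ▸ h) := by
  subst hg hk
  rfl

instance : Category.{u} (Obj F) where
  Hom := Hom
  id X :=
    { base := 𝟙 X.base
      real _ k _ := k
      mem h := by simpa using h
      nat _ _ _ _ := rfl }
  comp {X Y Z} σ τ :=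
    { base := σ.base ≫ τ.base
      real g k h := τ.real (g ≫ σ.base) (σ.real g k h) (σ.mem h)
      mem h := by simpa using τ.mem (σ.mem h)
      nat f g k h := by
        rw [← τ.nat f (σ.mem h)]
        exact τ.real_congr (Category.assoc _ _ _) (σ.nat f h) _ }
  id_comp σ := Hom.ext (Category.id_comp _) (by
    funext Δ g k h
    exact σ.real_congr (Category.comp_id _) rfl _)
  comp_id σ := Hom.ext (Category.comp_id _) rfl
  assoc σ τ υ := Hom.ext (Category.assoc _ _ _) (by
    funext Δ g k h
    exact υ.real_congr (Category.assoc _ _ _).symm rfl _)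

@[simp]
theorem comp_base {X Y Z : Obj F} (σ : X ⟶ Y) (τ : Y ⟶ Z) :
    Hom.base (σ ≫ τ) = Hom.base σ ≫ Hom.base τ := rfl

/-- A type of the gluing. -/
@[ext]
structure Ty (X : Obj F) where
  base : D.Ty X.base
  mem : ∀ {Δ : C.Ctx}, (F.F.obj Δ ⟶ X.base) → C.Realizer Δ → D.Tm (F.F.obj Δ) → C.Realizer Δ → Prop
  supp : ∀ {Δ : C.Ctx} {g : F.F.obj Δ ⟶ X.base} {k : C.Realizer Δ} {a : D.Tm (F.F.obj Δ)}
    {r : C.Realizer Δ}, mem g k a r → X.mem g k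
  typ : ∀ {Δ : C.Ctx} {g : F.F.obj Δ ⟶ X.base} {k : C.Realizer Δ} {a : D.Tm (F.F.obj Δ)}
    {r : C.Realizer Δ}, mem g k a r → D.typ a = D.tySub g base
  mem_sub : ∀ {Δ Θ : C.Ctx} (f : Θ ⟶ Δ) {g : F.F.obj Δ ⟶ X.base} {k : C.Realizer Δ}
    {a : D.Tm (F.F.obj Δ)} {r : C.Realizer Δ}, mem g k a r →
      mem (F.F.map f ≫ g) (k.sub f) (D.tmSub (F.F.map f) a) (r.sub f)

theorem Ty.ext' {X : Obj F} {A B : Ty X} (h : A.base = B.base)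
    (h' : ∀ {Δ : C.Ctx} (g : F.F.obj Δ ⟶ X.base) (k : C.Realizer Δ) (a : D.Tm (F.F.obj Δ))
      (r : C.Realizer Δ), A.mem g k a r ↔ B.mem g k a r) : A = B :=
  Ty.ext h (by funext Δ g k a r; exact propext (h' g k a r))

theorem Ty.mem_congr {X : Obj F} (A : Ty X) {Δ : C.Ctx} {g g' : F.F.obj Δ ⟶ X.base}
    {k k' : C.Realizer Δ} {a a' : D.Tm (F.F.obj Δ)} {r r' : C.Realizer Δ} (hg : g = g')
    (hk : k = k') (ha : a = a') (hr : r = r') (h : A.mem g k a r) : A.mem g' k' a' r' := by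
  subst hg hk ha hr
  exact h

/-- Substitution in types. -/
@[reducible] def Ty.sub {X Y : Obj F} (σ : Y ⟶ X) (A : Ty X) : Ty Y where
  base := D.tySub (Hom.base σ) A.base
  mem g k a r := ∃ h : Y.mem g k, A.mem (g ≫ Hom.base σ) (Hom.real σ g k h) a r
  supp h := h.1
  typ := by
    rintro Δ g k a r ⟨h, h'⟩
    rw [A.typ h', D.tySub_comp]
  mem_sub := by
    rintro Δ Θ f g k a r ⟨h, h'⟩
    refine ⟨Y.mem_sub f h, ?_⟩
    rw [Hom.nat σ f h, Category.assoc]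
    exact A.mem_sub f h'

/-- A term of the gluing. -/
@[ext]
structure Tm (X : Obj F) where
  ty : Ty X
  base : D.Tm X.base
  typ_base : D.typ base = ty.base
  real : ∀ {Δ : C.Ctx} (g : F.F.obj Δ ⟶ X.base) (k : C.Realizer Δ), X.mem g k → C.Realizer Δ
  mem : ∀ {Δ : C.Ctx} {g : F.F.obj Δ ⟶ X.base} {k : C.Realizer Δ} (h : X.mem g k),
    ty.mem g k (D.tmSub g base) (real g k h)
  nat : ∀ {Δ Θ : C.Ctx} (f : Θ ⟶ Δ) {g : F.F.obj Δ ⟶ X.base} {k : C.Realizer Δ} (h : X.mem g k),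
    real (F.F.map f ≫ g) (k.sub f) (X.mem_sub f h) = (real g k h).sub f

theorem Tm.real_congr {X : Obj F} (t : Tm X) {Δ : C.Ctx} {g g' : F.F.obj Δ ⟶ X.base}
    {k k' : C.Realizer Δ} (hg : g = g') (hk : k = k') (h : X.mem g k) :
    t.real g k h = t.real g' k' (hg ▸ hk ▸ h) := by
  subst hg hk
  rfl

/-- Substitution in terms. -/
@[reducible] def Tm.sub {X Y : Obj F} (σ : Y ⟶ X) (t : Tm X) : Tm Y where
  ty := t.ty.sub σ
  base := D.tmSub (Hom.base σ) t.base
  typ_base := by rw [D.typ_sub, t.typ_base]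
  real g k h := t.real (g ≫ Hom.base σ) (Hom.real σ g k h) (Hom.mem σ h)
  mem {Δ g k} h := ⟨h, by rw [← D.tmSub_comp]; exact t.mem _⟩
  nat f g k h := by
    rw [← t.nat f (Hom.mem σ h)]
    exact t.real_congr (Category.assoc _ _ _) (Hom.nat σ f h) _

/-- The field `supp` makes this an equality: substitution adds a membership condition on the context
element, which the relation of `A` must already imply. -/
theorem Ty.sub_id {X : Obj F} (A : Ty X) : A.sub (𝟙 X) = A := by
  refine Ty.ext' (D.tySub_id _) fun {Δ} g k a r => ?_
  change (∃ h : X.mem g k, A.mem (g ≫ 𝟙 _) k a r) ↔ _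
  rw [Category.comp_id]
  exact ⟨fun h => h.2, fun h => ⟨A.supp h, h⟩⟩

theorem Ty.sub_comp {X Y Z : Obj F} (τ : Z ⟶ Y) (σ : Y ⟶ X) (A : Ty X) :
    A.sub (τ ≫ σ) = (A.sub σ).sub τ := by
  refine Ty.ext' (D.tySub_comp _ _ _) fun {Δ} g k a r => ?_
  change (∃ h : Z.mem g k, A.mem (g ≫ Hom.base τ ≫ Hom.base σ) _ a r) ↔
    ∃ h : Z.mem g k, ∃ h' : Y.mem _ _, A.mem ((g ≫ Hom.base τ) ≫ Hom.base σ) _ a r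
  rw [Category.assoc]
  exact ⟨fun ⟨h, h'⟩ => ⟨h, Hom.mem τ h, h'⟩, fun ⟨h, _, h'⟩ => ⟨h, h'⟩⟩

/-- Context extension. -/
@[reducible] def ext {X : Obj F} (A : Ty X) : Obj F where
  base := D.ext A.base
  mem g k := ∃ k₁ k₂, k = .pair k₁ k₂ ∧ A.mem (g ≫ D.p A.base) k₁ (D.tmSub g (D.q A.base)) k₂
  mem_sub := by
    rintro Δ Θ f g k ⟨k₁, k₂, rfl, h⟩
    refine ⟨k₁.sub f, k₂.sub f, by simp, ?_⟩
    rw [D.tmSub_comp, Category.assoc]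
    exact A.mem_sub f h

theorem mem_ext_pair {X : Obj F} {A : Ty X} {Δ : C.Ctx} {g : F.F.obj Δ ⟶ D.ext A.base}
    {k₁ k₂ : C.Realizer Δ} : (ext A).mem g (.pair k₁ k₂) ↔
      A.mem (g ≫ D.p A.base) k₁ (D.tmSub g (D.q A.base)) k₂ := by
  constructor
  · rintro ⟨_, _, h, h'⟩
    obtain ⟨rfl, rfl⟩ := Realizer.pair.inj h
    exact h'
  · exact fun h => ⟨_, _, rfl, h⟩

theorem fst_mem {X : Obj F} {A : Ty X} {Δ : C.Ctx} {g : F.F.obj Δ ⟶ (ext A).base}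
    {k : C.Realizer Δ} (h : (ext A).mem g k) : X.mem (g ≫ D.p A.base) k.fst := by
  obtain ⟨k₁, k₂, rfl, h⟩ := h
  exact A.supp h

/-- The projection from an extended context. -/
@[reducible] def proj {X : Obj F} (A : Ty X) : ext A ⟶ X where
  base := D.p A.base
  real _ k _ := k.fst
  mem h := fst_mem h
  nat := by
    rintro Δ Θ f g k ⟨k₁, k₂, rfl, h⟩
    simp

/-- The generic term. -/
@[reducible] def gen {X : Obj F} (A : Ty X) : Tm (ext A) where
  ty := A.sub (proj A)
  base := D.q A.base
  typ_base := D.typ_q _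
  real _ k _ := k.snd
  mem := by
    rintro Δ g k ⟨k₁, k₂, rfl, h⟩
    exact ⟨⟨_, _, rfl, h⟩, h⟩
  nat := by
    rintro Δ Θ f g k ⟨k₁, k₂, rfl, h⟩
    simp

theorem Tm.mem_of_ty_eq {X : Obj F} {A : Ty X} {t : Tm X} (ht : t.ty = A) {Δ : C.Ctx}
    {g : F.F.obj Δ ⟶ X.base} {k : C.Realizer Δ} (h : X.mem g k) :
    A.mem g k (D.tmSub g t.base) (t.real g k h) :=
  ht ▸ t.mem h

theorem typ_base_eq {X Y : Obj F} {σ : Y ⟶ X} {A : Ty X} {a : Tm Y} (h : a.ty = A.sub σ) :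
    D.typ a.base = D.tySub (Hom.base σ) A.base :=
  a.typ_base.trans (congrArg Ty.base h)

/-- The pairing of a substitution and a term. -/
@[reducible] def pair {X Y : Obj F} (σ : Y ⟶ X) (A : Ty X) (a : Tm Y) (h : a.ty = A.sub σ) :
    Y ⟶ ext A where
  base := D.pair (Hom.base σ) A.base a.base (typ_base_eq h)
  real g k hk := .pair (Hom.real σ g k hk) (a.real g k hk)
  mem {Δ g k} hk := by
    refine ⟨_, _, rfl, ?_⟩
    refine A.mem_congr ?_ rfl ?_ rfl (Tm.mem_of_ty_eq h hk).2
    · rw [Category.assoc, D.pair_p]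
    · rw [D.tmSub_comp, D.pair_q]
  nat f g k hk := by
    rw [Hom.nat σ f hk, Tm.nat a f hk, Realizer.pair_sub]

variable (F)

/-- The empty context. -/
@[reducible] def nil : Obj F where
  base := D.nil
  mem _ k := k = .unit
  mem_sub := by
    rintro Δ Θ f g k rfl
    simp

/-- The category with families of the gluing. -/
@[reducible] def cwf : CwF.{u} where
  Ctx := Obj F
  nil := nil F
  nilIsTerminal := Limits.IsTerminal.ofUniqueHom
    (fun X => Hom.mk (D.nilIsTerminal.from X.base) (fun _ _ _ => .unit) (fun _ => rfl)
      (fun _ _ _ _ => by simp))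
    (fun X m => Hom.ext (D.nilIsTerminal.hom_ext _ _) (by
      funext Δ g k h
      exact Hom.mem m h))
  Ty := Ty
  tySub σ A := A.sub σ
  tySub_id := Ty.sub_id
  tySub_comp := Ty.sub_comp
  Tm := Tm
  tmSub σ t := t.sub σ
  tmSub_id t := Tm.ext (Ty.sub_id _) (D.tmSub_id _) (by
    funext Δ g k h
    exact t.real_congr (Category.comp_id _) rfl _)
  tmSub_comp τ σ t := Tm.ext (Ty.sub_comp _ _ _) (D.tmSub_comp _ _ _) (by
    funext Δ g k h
    exact t.real_congr (Category.assoc _ _ _).symm rfl _)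
  typ t := t.ty
  typ_sub _ _ := rfl
  ext := ext
  p := proj
  q := gen
  typ_q _ := rfl
  pair := pair
  pair_p σ A a h := Hom.ext (D.pair_p _ _ _ _) rfl
  pair_q σ A a h := Tm.ext (by
      change (A.sub (proj A)).sub (pair σ A a h) = _
      rw [h, ← Ty.sub_comp]
      congr 1
      exact Hom.ext (D.pair_p _ _ _ _) rfl) (D.pair_q _ _ _ _) rfl
  pair_uniq := by
    rintro X Y σ A a h τ rfl rfl
    refine Hom.ext (D.pair_uniq _ _ _ _ _ rfl rfl) ?_
    funext Δ g k hk
    -- Every realizer of an extended context is literally a pair, so the `η`-rule for context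
    -- extension holds strictly on realizers.
    obtain ⟨k₁, k₂, e, -⟩ := Hom.mem τ hk
    change Hom.real τ g k hk = .pair (Hom.real τ g k hk).fst (Hom.real τ g k hk).snd
    rw [e]
    rfl

variable {F}

/-- The underlying term in `D` of a term of the gluing. -/
def baseTerm {X : Obj F} {A : Ty X} (t : CwF.Term (cwf F) (Γ := X) A) : D.Term A.base :=
  ⟨t.1.base, t.1.typ_base.trans (congrArg Ty.base t.2)⟩

theorem term_mem {X : Obj F} {A : Ty X} (t : CwF.Term (cwf F) (Γ := X) A) {Δ : C.Ctx}
    {g : F.F.obj Δ ⟶ X.base} {k : C.Realizer Δ} (h : X.mem g k) :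
    A.mem g k (D.tmSub g (baseTerm t).1) (t.1.real g k h) :=
  Tm.mem_of_ty_eq t.2 h

/-- Construction of terms of a given type. -/
def mkTerm {X : Obj F} {A : Ty X} (b : D.Term A.base)
    (real : ∀ {Δ : C.Ctx} (g : F.F.obj Δ ⟶ X.base) (k : C.Realizer Δ), X.mem g k → C.Realizer Δ)
    (mem : ∀ {Δ : C.Ctx} {g : F.F.obj Δ ⟶ X.base} {k : C.Realizer Δ} (h : X.mem g k),
      A.mem g k (D.tmSub g b.1) (real g k h))
    (nat : ∀ {Δ Θ : C.Ctx} (f : Θ ⟶ Δ) {g : F.F.obj Δ ⟶ X.base} {k : C.Realizer Δ}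
      (h : X.mem g k),
      real (F.F.map f ≫ g) (k.sub f) (X.mem_sub f h) = (real g k h).sub f) :
    CwF.Term (cwf F) (Γ := X) A :=
  ⟨⟨A, b.1, b.2, real, mem, nat⟩, rfl⟩

theorem term_ext {X : Obj F} {A : Ty X} {t t' : CwF.Term (cwf F) (Γ := X) A}
    (h : baseTerm t = baseTerm t')
    (h' : ∀ {Δ : C.Ctx} (g : F.F.obj Δ ⟶ X.base) (k : C.Realizer Δ) (hk : X.mem g k),
      t.1.real g k hk = t'.1.real g k hk) : t = t' :=
  Subtype.ext (Tm.ext (t.2.trans t'.2.symm) (congrArg Subtype.val h) (by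
    funext Δ g k hk
    exact h' g k hk))

end Gluing

namespace Gluing

variable {C D : SigmaPiCwF.{u}} {F : SigmaPiCwF.Hom C D}

/-! ### Unit types -/

/-- The unit type. -/
@[reducible] def one (X : Obj F) : Ty X where
  base := D.unit.one X.base
  mem g k a r := X.mem g k ∧ D.typ a = D.unit.one _ ∧ r = .unit
  supp h := h.1
  typ h := h.2.1.trans (D.unit.one_sub _).symm
  mem_sub := by
    rintro Δ Θ f g k a r ⟨h, h', rfl⟩
    exact ⟨X.mem_sub f h, by rw [D.typ_sub, h']; exact D.unit.one_sub _, by simp⟩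

variable (F) in
/-- Unit types in the gluing. -/
@[reducible] def unit : CwF.UnitStr (cwf F).all where
  one X := one X
  one_sub {X Y} σ := Ty.ext' (D.unit.one_sub _) fun g k a r =>
    ⟨fun h => ⟨h.1, h.2.2⟩, fun h => ⟨h.1, Hom.mem σ h.1, h.2⟩⟩
  star X := mkTerm (A := one X) (D.unit.star X.base) (fun _ _ _ => .unit)
    (fun {Δ g k} h => ⟨h, by
      rw [D.typ_sub, (D.unit.star X.base).2]
      exact D.unit.one_sub _, rfl⟩)
    (fun _ _ _ _ => by simp)
  star_uniq {X} t := term_ext (D.unit.star_uniq _) fun g k h => (term_mem (A := one X) t h).2.2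

/-! ### Sigma types -/

section

variable {X : Obj F} (A : Ty X) (B : Ty (ext A))

/-- `Σ`-types, realized by pairs. -/
@[reducible] def sig : Ty X where
  base := D.sigma.sig A.base B.base
  -- The map `ρ` is `⟨g, a⟩`. Quantifying over it encodes the typing of `a`, and lets the
  -- projections be taken by composing with `unpair` without transporting types.
  mem g k a r := ∃ ρ : F.F.obj _ ⟶ D.ext (D.sigma.sig A.base B.base),
    ρ ≫ D.p _ = g ∧ D.tmSub ρ (D.q _) = a ∧ ∃ r₁ r₂, r = .pair r₁ r₂ ∧
      B.mem (ρ ≫ D.sigma.unpair A.base B.base ≫ D.p _) (.pair k r₁)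
        (D.tmSub (ρ ≫ D.sigma.unpair A.base B.base) (D.q _)) r₂
  supp := by
    rintro Δ g k a r ⟨ρ, rfl, rfl, r₁, r₂, rfl, h⟩
    have := A.supp (mem_ext_pair.1 (B.supp h))
    rwa [Category.assoc, Category.assoc, CwF.SigmaStr.unpair_p_p] at this
  typ := by
    rintro Δ g k a r ⟨ρ, rfl, rfl, r₁, r₂, rfl, h⟩
    exact CwF.typ_sub_q ρ
  mem_sub := by
    rintro Δ Θ f g k a r ⟨ρ, rfl, rfl, r₁, r₂, rfl, h⟩
    refine ⟨F.F.map f ≫ ρ, by simp, by rw [D.tmSub_comp], r₁.sub f, r₂.sub f, by simp, ?_⟩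
    refine B.mem_congr ?_ ?_ ?_ rfl (B.mem_sub f h)
    · simp
    · simp
    · rw [← D.tmSub_comp, Category.assoc]

variable {A B}

/-- When the element comes from a term `t` over `X.base`, the map `ρ` in the definition can only be
`g ≫ CwF.inst t`, and `unpair` computes to the projections of `t`. -/
theorem sig_mem_iff {Δ : C.Ctx} {g : F.F.obj Δ ⟶ X.base} {k r : C.Realizer Δ}
    (t : D.Term (D.sigma.sig A.base B.base)) :
    (sig A B).mem g k (D.tmSub g t.1) r ↔ ∃ r₁ r₂, r = .pair r₁ r₂ ∧
      B.mem (g ≫ CwF.inst (D.sigma.fst A.base B.base t)) (.pair k r₁)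
        (D.tmSub g (D.sigma.snd A.base B.base t).1) r₂ := by
  have h₁ : (g ≫ CwF.inst t) ≫ D.sigma.unpair A.base B.base ≫ D.p _ =
      g ≫ CwF.inst (D.sigma.fst A.base B.base t) := by
    rw [Category.assoc]
    exact congrArg (g ≫ ·) (D.sigma.fst_inst_unpair t)
  have h₂ : D.tmSub ((g ≫ CwF.inst t) ≫ D.sigma.unpair A.base B.base) (D.q _) =
      D.tmSub g (D.sigma.snd A.base B.base t).1 := by
    rw [Category.assoc, D.tmSub_comp]
    exact congrArg (D.tmSub g) (D.sigma.snd_inst_unpair t)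
  constructor
  · rintro ⟨ρ, h, h', r₁, r₂, rfl, h''⟩
    obtain rfl : ρ = g ≫ CwF.inst t := by
      refine CwF.hom_ext (by simpa using h) ?_
      rw [h', D.tmSub_comp, CwF.inst_q]
    exact ⟨r₁, r₂, rfl, B.mem_congr h₁ rfl h₂ rfl h''⟩
  · rintro ⟨r₁, r₂, rfl, h⟩
    exact ⟨g ≫ CwF.inst t, by simp, by rw [D.tmSub_comp, CwF.inst_q], r₁, r₂, rfl,
      B.mem_congr h₁.symm rfl h₂.symm rfl h⟩

/-- The first projection. -/
@[reducible] def fst (t : CwF.Term (cwf F) (Γ := X) (sig A B)) : CwF.Term (cwf F) (Γ := X) A :=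
  mkTerm (D.sigma.fst A.base B.base (baseTerm t)) (fun g k h => (t.1.real g k h).fst)
    (fun {Δ g k} h => by
      obtain ⟨r₁, r₂, e, h'⟩ := (sig_mem_iff _).1 (term_mem t h)
      rw [e]
      refine A.mem_congr ?_ rfl ?_ rfl (mem_ext_pair.1 (B.supp h'))
      · rw [Category.assoc, CwF.inst_p, Category.comp_id]
      · rw [D.tmSub_comp, CwF.inst_q])
    (fun f g k h => by
      obtain ⟨r₁, r₂, e, h'⟩ := (sig_mem_iff _).1 (term_mem t h)
      rw [Tm.nat t.1 f h, e]
      simp)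

/-- The second projection. -/
@[reducible] def snd (t : CwF.Term (cwf F) (Γ := X) (sig A B)) :
    CwF.Term (cwf F) (Γ := X) (B.sub (CwF.inst (C := cwf F) (fst t))) :=
  mkTerm (A := B.sub (CwF.inst (C := cwf F) (fst t)))
    (D.sigma.snd A.base B.base (baseTerm t)) (fun g k h => (t.1.real g k h).snd)
    (fun {Δ g k} h => by
      obtain ⟨r₁, r₂, e, h'⟩ := (sig_mem_iff _).1 (term_mem t h)
      refine ⟨h, ?_⟩
      change B.mem _ (.pair k (t.1.real g k h).fst) _ _
      rw [e]
      exact h')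
    (fun f g k h => by
      obtain ⟨r₁, r₂, e, h'⟩ := (sig_mem_iff _).1 (term_mem t h)
      rw [Tm.nat t.1 f h, e]
      simp)

/-- Pairing. -/
@[reducible] def mkPair (a : CwF.Term (cwf F) (Γ := X) A)
    (b : CwF.Term (cwf F) (Γ := X) (B.sub (CwF.inst (C := cwf F) a))) :
    CwF.Term (cwf F) (Γ := X) (sig A B) :=
  mkTerm (A := sig A B) (D.sigma.pair A.base B.base (baseTerm a) (baseTerm b))
    (fun g k h => .pair (a.1.real g k h) (b.1.real g k h))
    (fun {Δ g k} h => by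
      refine (sig_mem_iff _).2 ⟨_, _, rfl, ?_⟩
      have h₁ : D.sigma.fst A.base B.base
        (D.sigma.pair A.base B.base (baseTerm a) (baseTerm b)) = baseTerm a :=
          D.sigma.fst_pair _ _ _ _
      have h₂ : (D.sigma.snd A.base B.base
        (D.sigma.pair A.base B.base (baseTerm a) (baseTerm b))).1 = (baseTerm b).1 :=
          D.sigma.snd_pair _ _ _ _
      refine B.mem_congr ?_ rfl ?_ rfl (term_mem b h).2
      · rw [h₁]; rfl
      · rw [h₂])
    (fun f g k h => by
      rw [Tm.nat a.1 f h, Tm.nat b.1 f h]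
      simp)

end

/-- Witnesses on the two sides correspond along `CwF.up (Hom.base σ) e`, a pullback map of extended
contexts, and `up_unpair` says that `unpair` respects it. -/
theorem sig_sub {X Y : Obj F} (σ : Y ⟶ X) (A : Ty X) (B : Ty (ext A)) :
    (sig A B).sub σ = sig (A.sub σ) (B.sub (CwF.up (C := cwf F) (A := A) (A' := A.sub σ) σ rfl)) :=
      by
  refine Ty.ext' (D.sigma.sig_sub _ _ _) fun {Δ} g k a r => ?_
  let B' := D.tySub (CwF.up (Hom.base σ) rfl) B.base
  have e : D.sigma.sig (D.tySub (Hom.base σ) A.base) B' =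
      D.tySub (Hom.base σ) (D.sigma.sig A.base B.base) := D.sigma.sig_congr rfl rfl
  have key : CwF.up (Hom.base σ) e ≫ D.sigma.unpair A.base B.base =
      D.sigma.unpair (D.tySub (Hom.base σ) A.base) B' ≫ CwF.up (CwF.up (Hom.base σ) rfl) rfl :=
    D.sigma.up_unpair rfl rfl
  have key₁ : ∀ ρ : F.F.obj Δ ⟶ D.ext (D.sigma.sig (D.tySub (Hom.base σ) A.base) B'),
      (ρ ≫ CwF.up (Hom.base σ) e) ≫ D.sigma.unpair A.base B.base ≫ D.p _ =
        (ρ ≫ D.sigma.unpair _ B' ≫ D.p _) ≫ CwF.up (Hom.base σ) rfl := by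
    intro ρ
    rw [Category.assoc, ← Category.assoc (CwF.up (Hom.base σ) e), key]
    simp
  have key₂ : ∀ ρ : F.F.obj Δ ⟶ D.ext (D.sigma.sig (D.tySub (Hom.base σ) A.base) B'),
      D.tmSub ((ρ ≫ CwF.up (Hom.base σ) e) ≫ D.sigma.unpair A.base B.base) (D.q _) =
        D.tmSub (ρ ≫ D.sigma.unpair _ B') (D.q _) := by
    intro ρ
    rw [Category.assoc, key, ← Category.assoc, CwF.comp_up_q]
  have key₃ : ∀ (ρ : F.F.obj Δ ⟶ D.ext (D.sigma.sig (D.tySub (Hom.base σ) A.base) B')),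
      ρ ≫ D.p _ = g → (ρ ≫ D.sigma.unpair _ B' ≫ D.p _) ≫ D.p _ = g := by
    rintro ρ rfl
    rw [Category.assoc, Category.assoc]
    exact congrArg (ρ ≫ ·) (D.sigma.unpair_p_p _ B')
  constructor
  · rintro ⟨h, ρ, hρ, rfl, r₁, r₂, rfl, h'⟩
    -- The factorization of `ρ` through the pullback, with base `g` and the same term.
    obtain ⟨ρ', hp, hq⟩ : ∃ ρ' : F.F.obj Δ ⟶ D.ext (D.sigma.sig (D.tySub (Hom.base σ) A.base) B'),
        ρ' ≫ D.p _ = g ∧ D.tmSub ρ' (D.q _) = D.tmSub ρ (D.q _) :=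
      ⟨D.pair g _ (D.tmSub ρ (D.q _)) (by rw [CwF.typ_sub_q, hρ, e, D.tySub_comp]),
        D.pair_p _ _ _ _, D.pair_q _ _ _ _⟩
    obtain rfl : ρ = ρ' ≫ CwF.up (Hom.base σ) e := by
      refine CwF.hom_ext ?_ ?_
      · rw [Category.assoc, CwF.up_p, ← Category.assoc, hp, hρ]
      · rw [CwF.comp_up_q, hq]
    have h₁ : (ext (A.sub σ)).mem (ρ' ≫ D.sigma.unpair _ B' ≫ D.p _) (.pair k r₁) := by
      refine mem_ext_pair.2 ⟨Y.mem_congr (key₃ _ hp).symm rfl h, ?_⟩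
      refine A.mem_congr ?_ ?_ ?_ rfl (mem_ext_pair.1 (B.supp h'))
      · rw [key₁]; simp
      · exact Hom.real_congr σ (key₃ _ hp).symm rfl _
      · exact (congrArg (D.tmSub · _) (key₁ ρ')).trans (CwF.comp_up_q _ _ _)
    refine ⟨ρ', hp, hq, r₁, r₂, rfl, h₁, ?_⟩
    refine B.mem_congr (key₁ _) ?_ (key₂ _) rfl h'
    change _ = Realizer.pair (Hom.real σ _ k _) r₁
    exact congrArg (Realizer.pair · r₁) (Hom.real_congr σ (key₃ _ hp).symm rfl h)
  · rintro ⟨ρ, hρ, rfl, r₁, r₂, rfl, h₁, h'⟩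
    have h : Y.mem g k := Y.mem_congr (key₃ _ hρ) rfl (mem_ext_pair.1 h₁).1
    refine ⟨h, ρ ≫ CwF.up (Hom.base σ) e, (Category.assoc _ _ _).trans
      ((congrArg (ρ ≫ ·) (CwF.up_p _ e)).trans ((Category.assoc _ _ _).symm.trans
        (congrArg (· ≫ Hom.base σ) hρ))),
      CwF.comp_up_q _ _ _, r₁, r₂, rfl, ?_⟩
    refine B.mem_congr (key₁ _).symm ?_ (key₂ _).symm rfl h'
    change Realizer.pair (Hom.real σ _ k _) r₁ = _
    exact congrArg (Realizer.pair · r₁) (Hom.real_congr σ (key₃ _ hρ).symm rfl h).symm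

variable (F) in
/-- `Σ`-types in the gluing. -/
@[reducible] def sigma : CwF.SigmaStr (cwf F).all where
  sig A B := sig A B
  sig_sub := sig_sub
  pair A B a b := mkPair a b
  fst A B t := fst t
  snd A B t := snd t
  fst_pair A B a b := term_ext (D.sigma.fst_pair _ _ _ _) fun _ _ _ => rfl
  snd_pair A B a b := Tm.ext (by
    refine Eq.trans ?_ b.2.symm
    change B.sub _ = B.sub _
    congr 2
    exact term_ext (D.sigma.fst_pair _ _ _ _) fun _ _ _ => rfl) (D.sigma.snd_pair _ _ _ _) rfl
  pair_fst_snd A B t := term_ext (D.sigma.pair_fst_snd _ _ _) fun g k h => by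
    obtain ⟨r₁, r₂, e, h'⟩ := (sig_mem_iff _).1 (term_mem t h)
    change Realizer.pair (t.1.real g k h).fst (t.1.real g k h).snd = _
    rw [e]
    rfl
  fst_sub σ A B t := Tm.ext rfl
    (D.sigma.fst_sub (Hom.base σ) A.base B.base (baseTerm t)) rfl
  snd_sub {X Y} σ A B t := Tm.ext (by
    change (B.sub _).sub _ = (B.sub _).sub _
    rw [← Ty.sub_comp, ← Ty.sub_comp]
    congr 1
    exact CwF.inst_up (C := cwf F) (fst t) _ σ rfl (Tm.ext rfl
      (D.sigma.fst_sub (Hom.base σ) A.base B.base (baseTerm t)) rfl))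
    (D.sigma.snd_sub (Hom.base σ) A.base B.base (baseTerm t)) rfl

end Gluing

namespace Gluing

variable {C D : SigmaPiCwF.{u}} {F : SigmaPiCwF.Hom C D}

/-! ### Representable types -/

/-- A representable type of the gluing: a representable type of `D` with a compatible natural
family of representable types of `C`. -/
@[ext]
structure RepTy (X : Obj F) where
  base : D.rep.Ty X.base
  fam : ∀ {Δ : C.Ctx} (g : F.F.obj Δ ⟶ X.base) (k : C.Realizer Δ), X.mem g k → C.rep.Ty Δ
  map_fam : ∀ {Δ : C.Ctx} {g : F.F.obj Δ ⟶ X.base} {k : C.Realizer Δ} (h : X.mem g k),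
    F.rep.map (fam g k h) = D.rep.sub g base
  nat : ∀ {Δ Θ : C.Ctx} (f : Θ ⟶ Δ) {g : F.F.obj Δ ⟶ X.base} {k : C.Realizer Δ} (h : X.mem g k),
    fam (F.F.map f ≫ g) (k.sub f) (X.mem_sub f h) = C.rep.sub f (fam g k h)

theorem RepTy.fam_congr {X : Obj F} (A : RepTy X) {Δ : C.Ctx} {g g' : F.F.obj Δ ⟶ X.base}
    {k k' : C.Realizer Δ} (hg : g = g') (hk : k = k') (h : X.mem g k) (h' : X.mem g' k') :
    A.fam g k h = A.fam g' k' h' := by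
  subst hg hk
  rfl

/-- Substitution in representable types. -/
@[reducible] def RepTy.sub {X Y : Obj F} (σ : Y ⟶ X) (A : RepTy X) : RepTy Y where
  base := D.rep.sub (Hom.base σ) A.base
  fam g k h := A.fam (g ≫ Hom.base σ) (Hom.real σ g k h) (Hom.mem σ h)
  map_fam h := by rw [A.map_fam, D.rep.sub_comp]
  nat f g k h := by
    rw [← A.nat f (Hom.mem σ h)]
    exact A.fam_congr (Category.assoc _ _ _) (Hom.nat σ f h) _ _

/-- The type underlying a representable type, realized by terms of `C`. -/
@[reducible] def RepTy.incl {X : Obj F} (A : RepTy X) : Ty X where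
  base := D.rep.incl A.base
  mem g k a r := ∃ (h : X.mem g k) (t : C.Term (C.rep.incl (A.fam g k h))),
    F.tm t.1 = a ∧ r = .tm t.1
  supp h := h.1
  typ := by
    rintro Δ g k a r ⟨h, t, rfl, rfl⟩
    rw [F.typ_tm, t.2, F.rep.map_incl (A.map_fam h)]
  mem_sub := by
    rintro Δ Θ f g k a r ⟨h, t, rfl, rfl⟩
    refine ⟨X.mem_sub f h, t.sub f (CwF.incl_eq_sub (A.nat f h)), F.tm_sub _ _, ?_⟩
    rw [Realizer.tm_sub]
    rfl

variable (F) in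
/-- The restriction of the gluing to representable types. -/
@[reducible] def rep : CwF.Restriction (cwf F) where
  Ty := RepTy
  sub σ A := A.sub σ
  sub_id {X} A := RepTy.ext (D.rep.sub_id _) (by
    funext Δ g k h
    exact A.fam_congr (Category.comp_id _) rfl _ _)
  sub_comp τ σ A := RepTy.ext (D.rep.sub_comp _ _ _) (by
    funext Δ g k h
    exact A.fam_congr (Category.assoc _ _ _).symm rfl _ _)
  incl A := A.incl
  incl_sub σ A := Ty.ext' (D.rep.incl_sub _ _) fun g k a r =>
    ⟨fun ⟨h, t, e⟩ => ⟨h, Hom.mem σ h, t, e⟩, fun ⟨h, _, t, e⟩ => ⟨h, t, e⟩⟩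

section

variable {X : Obj F} {A : RepTy X}

/-- The value of a term of a representable type. -/
noncomputable def val (t : CwF.Term (cwf F) (Γ := X) A.incl) {Δ : C.Ctx}
    (g : F.F.obj Δ ⟶ X.base) (k : C.Realizer Δ) (h : X.mem g k) :
    C.Term (C.rep.incl (A.fam g k h)) :=
  (term_mem t h).2.choose

theorem map_val (t : CwF.Term (cwf F) (Γ := X) A.incl) {Δ : C.Ctx}
    {g : F.F.obj Δ ⟶ X.base} {k : C.Realizer Δ} (h : X.mem g k) :
    F.tm (val t g k h).1 = D.tmSub g (baseTerm t).1 :=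
  (term_mem t h).2.choose_spec.1

theorem real_eq_val (t : CwF.Term (cwf F) (Γ := X) A.incl) {Δ : C.Ctx}
    {g : F.F.obj Δ ⟶ X.base} {k : C.Realizer Δ} (h : X.mem g k) :
    t.1.real g k h = .tm (val t g k h).1 :=
  (term_mem t h).2.choose_spec.2

/-- The term `val` is obtained by choice, but the realizer `.tm` determines it, so naturality of
realizers gives naturality of values. -/
theorem val_nat (t : CwF.Term (cwf F) (Γ := X) A.incl) {Δ Θ : C.Ctx} (f : Θ ⟶ Δ)
    {g : F.F.obj Δ ⟶ X.base} {k : C.Realizer Δ} (h : X.mem g k) :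
    (val t (F.F.map f ≫ g) (k.sub f) (X.mem_sub f h)).1 = C.tmSub f (val t g k h).1 := by
  have := Tm.nat t.1 f h
  rw [real_eq_val, real_eq_val, Realizer.tm_sub] at this
  exact Realizer.tm.inj this

/-- Construction of terms of a representable type. -/
@[reducible] def mkRepTerm (b : D.Term (D.rep.incl A.base))
    (v : ∀ {Δ : C.Ctx} (g : F.F.obj Δ ⟶ X.base) (k : C.Realizer Δ) (h : X.mem g k),
      C.Term (C.rep.incl (A.fam g k h)))
    (hv : ∀ {Δ : C.Ctx} {g : F.F.obj Δ ⟶ X.base} {k : C.Realizer Δ} (h : X.mem g k),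
      F.tm (v g k h).1 = D.tmSub g b.1)
    (nat : ∀ {Δ Θ : C.Ctx} (f : Θ ⟶ Δ) {g : F.F.obj Δ ⟶ X.base} {k : C.Realizer Δ}
      (h : X.mem g k),
      (v (F.F.map f ≫ g) (k.sub f) (X.mem_sub f h)).1 = C.tmSub f (v g k h).1) :
    CwF.Term (cwf F) (Γ := X) A.incl :=
  mkTerm (A := A.incl) b (fun g k h => .tm (v g k h).1)
    (fun h => ⟨h, v _ _ h, hv h, rfl⟩)
    (fun f g k h => by rw [nat, Realizer.tm_sub])

theorem val_eq {t : CwF.Term (cwf F) (Γ := X) A.incl} {Δ : C.Ctx}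
    {g : F.F.obj Δ ⟶ X.base} {k : C.Realizer Δ} {h : X.mem g k}
    {v : C.Term (C.rep.incl (A.fam g k h))} (e : t.1.real g k h = .tm v.1) :
    val t g k h = v := by
  rw [real_eq_val] at e
  exact Subtype.ext (Realizer.tm.inj e)

theorem repTerm_ext {t t' : CwF.Term (cwf F) (Γ := X) A.incl} (h : baseTerm t = baseTerm t')
    (h' : ∀ {Δ : C.Ctx} (g : F.F.obj Δ ⟶ X.base) (k : C.Realizer Δ) (hk : X.mem g k),
      val t g k hk = val t' g k hk) : t = t' :=
  term_ext h fun g k hk => by rw [real_eq_val, real_eq_val, h']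

variable (A) in
/-- The generic element of a representable type. -/
@[reducible] def genMap {Δ : C.Ctx} (g : F.F.obj Δ ⟶ X.base) (k : C.Realizer Δ) (h : X.mem g k) :
    F.F.obj (C.ext (C.rep.incl (A.fam g k h))) ⟶ D.ext (D.rep.incl A.base) :=
  F.upMap g (F.rep.map_incl (A.map_fam h))

variable (A) in
/-- The realizer of the generic element of a representable type. -/
@[reducible] def genReal {Δ : C.Ctx} (g : F.F.obj Δ ⟶ X.base) (k : C.Realizer Δ) (h : X.mem g k) :
    C.Realizer (C.ext (C.rep.incl (A.fam g k h))) :=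
  .pair (k.sub (C.p _)) (.tm (C.q _))

/-- A representable glued type carries types of `C`, so it has a generic element over an actual
context of `C`. This allows `Σ`- and `Π`-types over it to be computed at a single stage. -/
theorem gen_mem {Δ : C.Ctx} {g : F.F.obj Δ ⟶ X.base} {k : C.Realizer Δ} (h : X.mem g k) :
    (ext A.incl).mem (genMap A g k h) (genReal A g k h) := by
  have h' : X.mem (F.F.map (C.p (C.rep.incl (A.fam g k h))) ≫ g) (k.sub (C.p _)) := X.mem_sub _ h
  refine mem_ext_pair.2 (A.incl.mem_congr (F.upMap_p _ _).symm rfl (F.upMap_q _ _).symm rfl ?_)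
  exact ⟨h', ⟨C.q _, by rw [C.typ_q, A.nat, C.rep.incl_sub]⟩, rfl, rfl⟩

theorem map_up_genMap {Δ Θ : C.Ctx} (f : Θ ⟶ Δ) {g : F.F.obj Δ ⟶ X.base} {k : C.Realizer Δ}
    (h : X.mem g k) :
    F.F.map (CwF.up f (CwF.incl_eq_sub (A.nat f h))) ≫ genMap A g k h =
      genMap A (F.F.map f ≫ g) (k.sub f) (X.mem_sub f h) :=
  F.map_up_upMap _ _ _ _

theorem genReal_sub_up {Δ Θ : C.Ctx} (f : Θ ⟶ Δ) {g : F.F.obj Δ ⟶ X.base} {k : C.Realizer Δ}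
    (h : X.mem g k) :
    (genReal A g k h).sub (CwF.up f (CwF.incl_eq_sub (A.nat f h))) =
      genReal A (F.F.map f ≫ g) (k.sub f) (X.mem_sub f h) := by
  simp [← Realizer.sub_comp]

theorem map_inst_genMap {Δ : C.Ctx} {g : F.F.obj Δ ⟶ X.base} {k : C.Realizer Δ}
    (h : X.mem g k) (t : C.Term (C.rep.incl (A.fam g k h))) {a : D.Term (D.rep.incl A.base)}
    (ha : F.tm t.1 = D.tmSub g a.1) :
    F.F.map (CwF.inst t) ≫ genMap A g k h = g ≫ CwF.inst a := by
  refine CwF.hom_ext ?_ ?_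
  · rw [Category.assoc, F.upMap_p, ← F.F.map_comp_assoc, CwF.inst_p, Category.assoc, CwF.inst_p,
      F.F.map_id, Category.id_comp, Category.comp_id]
  · rw [F.comp_upMap_q, ← F.tm_sub, CwF.inst_q, D.tmSub_comp, CwF.inst_q, ha]

theorem genReal_sub_inst {Δ : C.Ctx} {g : F.F.obj Δ ⟶ X.base} {k : C.Realizer Δ}
    (h : X.mem g k) (t : C.Term (C.rep.incl (A.fam g k h))) :
    (genReal A g k h).sub (CwF.inst t) = .pair k (.tm t.1) := by
  simp [← Realizer.sub_comp]

end

/-- The generic element after substitution. -/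
theorem genMap_up {X Y : Obj F} (σ : Y ⟶ X) (A : RepTy X) {Δ : C.Ctx}
    {g : F.F.obj Δ ⟶ Y.base} {k : C.Realizer Δ} (h : Y.mem g k) :
    genMap (A.sub σ) g k h ≫ CwF.up (Hom.base σ) (D.rep.incl_sub _ _) =
      genMap A (g ≫ Hom.base σ) (Hom.real σ g k h) (Hom.mem σ h) :=
  F.upMap_up _ _ _ _

/-- The generic term is the second component of both pairs; the first components agree by naturality
of `σ` along the projection. -/
theorem up_genReal {X Y : Obj F} (σ : Y ⟶ X) (A : RepTy X) {Δ : C.Ctx}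
    {g : F.F.obj Δ ⟶ Y.base} {k : C.Realizer Δ} (h : Y.mem g k) :
    Hom.real (CwF.up (C := cwf F) σ ((rep F).incl_sub σ A)) (genMap (A.sub σ) g k h)
      (genReal (A.sub σ) g k h) (gen_mem h) =
      genReal A (g ≫ Hom.base σ) (Hom.real σ g k h) (Hom.mem σ h) := by
  refine congrArg (Realizer.pair · (.tm _)) ?_
  exact (Hom.real_congr σ (F.upMap_p _ _) rfl _).trans (Hom.nat σ _ h)

/-! ### Unit and sigma types on representable types -/

variable (F) in
/-- Representable unit types in the gluing. -/
@[reducible] noncomputable def repUnit : CwF.UnitStr (rep F) where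
  one X :=
    { base := D.repUnit.one X.base
      fam := fun _ _ _ => C.repUnit.one _
      map_fam := fun _ => by rw [D.repUnit.one_sub]; exact F.map_repUnit _
      nat := fun f _ _ _ => (C.repUnit.one_sub f).symm }
  one_sub σ := RepTy.ext (D.repUnit.one_sub _) rfl
  star X := mkRepTerm (D.repUnit.star X.base) (fun _ _ _ => C.repUnit.star _)
    (fun {Δ g k} h => by
      have h₁ : D.rep.incl (D.repUnit.one (F.F.obj Δ)) =
          D.tySub g (D.rep.incl (D.repUnit.one X.base)) := by
        rw [← D.rep.incl_sub, D.repUnit.one_sub]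
      have h₂ : D.rep.incl (D.repUnit.one (F.F.obj Δ)) = F.ty (C.rep.incl (C.repUnit.one Δ)) := by
        rw [← F.rep.incl_map]
        exact congrArg _ (F.map_repUnit Δ).symm
      exact congrArg Subtype.val ((D.repUnit.star_uniq ((C.repUnit.star Δ).map F.toHom h₂)).trans
        (D.repUnit.star_uniq ((D.repUnit.star X.base).sub g h₁)).symm))
    (fun {Δ Θ} f _ _ _ => by
      have h₁ : C.rep.incl (C.repUnit.one Θ) = C.tySub f (C.rep.incl (C.repUnit.one Δ)) := by
        rw [← C.rep.incl_sub, C.repUnit.one_sub]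
      exact congrArg Subtype.val (C.repUnit.star_uniq ((C.repUnit.star Δ).sub f h₁)).symm)
  star_uniq t := repTerm_ext (D.repUnit.star_uniq _) fun g k h =>
    (C.repUnit.star_uniq _).trans (C.repUnit.star_uniq _).symm

section

variable {X : Obj F} (A : RepTy X) (B : RepTy (ext A.incl))

/-- The family of representable types obtained from `B` at the generic element of `A`. -/
@[reducible] def genFam {Δ : C.Ctx} (g : F.F.obj Δ ⟶ X.base) (k : C.Realizer Δ) (h : X.mem g k) :
    C.rep.Ty (C.ext (C.rep.incl (A.fam g k h))) :=
  B.fam (genMap A g k h) (genReal A g k h) (gen_mem h)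

theorem map_genFam {Δ : C.Ctx} {g : F.F.obj Δ ⟶ X.base} {k : C.Realizer Δ} (h : X.mem g k) :
    F.rep.map (genFam A B g k h) = D.rep.sub (F.upMap g (F.rep.map_incl (A.map_fam h))) B.base :=
  B.map_fam _

theorem genFam_nat {Δ Θ : C.Ctx} (f : Θ ⟶ Δ) {g : F.F.obj Δ ⟶ X.base} {k : C.Realizer Δ}
    (h : X.mem g k) :
    genFam A B (F.F.map f ≫ g) (k.sub f) (X.mem_sub f h) =
      C.rep.sub (CwF.up f (CwF.incl_eq_sub (A.nat f h))) (genFam A B g k h) := by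
  rw [← B.nat]
  exact B.fam_congr (map_up_genMap f h).symm (genReal_sub_up f h).symm _ _

/-- The value of `a` presents `⟨g, a⟩` as an instance of the generic element, so naturality of the
family `B` computes it there. -/
theorem genFam_inst (a : CwF.Term (cwf F) (Γ := X) A.incl) {Δ : C.Ctx}
    {g : F.F.obj Δ ⟶ X.base} {k : C.Realizer Δ} (h : X.mem g k) :
    (B.sub (CwF.inst (C := cwf F) a)).fam g k h =
      C.rep.sub (CwF.inst (val a g k h)) (genFam A B g k h) := by
  rw [← B.nat]
  refine B.fam_congr (map_inst_genMap h (val a g k h) (a := baseTerm a) (map_val a h)).symm ?_ _ _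
  refine Eq.trans ?_ (genReal_sub_inst h (val a g k h)).symm
  rw [← real_eq_val]
  rfl

/-- `Σ`-types of representable types. -/
@[reducible] def repSig : RepTy X where
  base := D.repSigma.sig A.base B.base
  fam g k h := C.repSigma.sig (A.fam g k h) (genFam A B g k h)
  map_fam h := F.map_repSigma.map_sig_eq (A.map_fam h) (map_genFam A B h)
  nat f _ _ h := C.repSigma.sig_congr (A.nat f h) (genFam_nat A B f h)

variable {A B}

/-- This and `val_nat_iff` are two instances of `map_tm_iff`, along `F` with base `g` and along the
identity of `C` with base `f`. They reduce compatibility and naturality of values in a `Σ`-type to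
the projections. -/
theorem map_val_iff (v : ∀ {Δ : C.Ctx} (g : F.F.obj Δ ⟶ X.base) (k : C.Realizer Δ) (h : X.mem g k),
      C.Term (C.rep.incl ((repSig A B).fam g k h))) (b : D.Term (D.rep.incl (repSig A B).base))
    {Δ : C.Ctx} {g : F.F.obj Δ ⟶ X.base} {k : C.Realizer Δ} (h : X.mem g k) :
    F.tm (v g k h).1 = D.tmSub g b.1 ↔
      F.tm (C.repSigma.fst _ _ (v g k h)).1 = D.tmSub g (D.repSigma.fst _ _ b).1 ∧
      F.tm (C.repSigma.snd _ _ (v g k h)).1 = D.tmSub g (D.repSigma.snd _ _ b).1 :=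
  F.map_repSigma.map_tm_iff (A.map_fam h) (map_genFam A B h) _ _

theorem val_nat_iff (v : ∀ {Δ : C.Ctx} (g : F.F.obj Δ ⟶ X.base) (k : C.Realizer Δ) (h : X.mem g k),
      C.Term (C.rep.incl ((repSig A B).fam g k h)))
    {Δ Θ : C.Ctx} (f : Θ ⟶ Δ) {g : F.F.obj Δ ⟶ X.base} {k : C.Realizer Δ} (h : X.mem g k) :
    (v (F.F.map f ≫ g) (k.sub f) (X.mem_sub f h)).1 = C.tmSub f (v g k h).1 ↔
      (C.repSigma.fst _ _ (v (F.F.map f ≫ g) (k.sub f) (X.mem_sub f h))).1 =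
        C.tmSub f (C.repSigma.fst _ _ (v g k h)).1 ∧
      (C.repSigma.snd _ _ (v (F.F.map f ≫ g) (k.sub f) (X.mem_sub f h))).1 =
        C.tmSub f (C.repSigma.snd _ _ (v g k h)).1 :=
  (CwF.SigmaStr.Preserved.id C.repSigma).map_tm_iff (ρ := f) (A.nat f h) (genFam_nat A B f h) _ _

/-- The first projection. -/
@[reducible] noncomputable def repFst (t : CwF.Term (cwf F) (Γ := X) (repSig A B).incl) :
    CwF.Term (cwf F) (Γ := X) A.incl :=
  mkRepTerm (D.repSigma.fst A.base B.base (baseTerm t))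
    (fun g k h => C.repSigma.fst _ _ (val t g k h))
    (fun h => ((map_val_iff (val t) (baseTerm t) h).1 (map_val t h)).1)
    (fun f _ _ h => ((val_nat_iff (val t) f h).1 (val_nat t f h)).1)

theorem val_repFst (t : CwF.Term (cwf F) (Γ := X) (repSig A B).incl) {Δ : C.Ctx}
    {g : F.F.obj Δ ⟶ X.base} {k : C.Realizer Δ} (h : X.mem g k) :
    val (repFst t) g k h = C.repSigma.fst _ _ (val t g k h) :=
  val_eq rfl

/-- The second projection. -/
@[reducible] noncomputable def repSnd (t : CwF.Term (cwf F) (Γ := X) (repSig A B).incl) :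
    CwF.Term (cwf F) (Γ := X) (B.sub (CwF.inst (C := cwf F) (repFst t))).incl :=
  mkRepTerm (A := B.sub (CwF.inst (C := cwf F) (repFst t)))
    (D.repSigma.snd A.base B.base (baseTerm t))
    (fun g k h => ⟨(C.repSigma.snd _ _ (val t g k h)).1, by
      rw [genFam_inst A B (repFst t) h, val_repFst]
      exact (C.repSigma.snd _ _ (val t g k h)).2⟩)
    (fun h => ((map_val_iff (val t) (baseTerm t) h).1 (map_val t h)).2)
    (fun f _ _ h => ((val_nat_iff (val t) f h).1 (val_nat t f h)).2)

theorem val_repSnd (t : CwF.Term (cwf F) (Γ := X) (repSig A B).incl) {Δ : C.Ctx}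
    {g : F.F.obj Δ ⟶ X.base} {k : C.Realizer Δ} (h : X.mem g k) :
    (val (A := B.sub (CwF.inst (C := cwf F) (repFst t))) (repSnd t) g k h).1 =
      (C.repSigma.snd _ _ (val t g k h)).1 :=
  Realizer.tm.inj (real_eq_val (A := B.sub (CwF.inst (C := cwf F) (repFst t))) (repSnd t) h).symm

/-- The components of a pair of terms of representable types. -/
noncomputable def pairVal (a : CwF.Term (cwf F) (Γ := X) A.incl)
    (b : CwF.Term (cwf F) (Γ := X) (B.sub (CwF.inst (C := cwf F) a)).incl) {Δ : C.Ctx}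
    (g : F.F.obj Δ ⟶ X.base) (k : C.Realizer Δ) (h : X.mem g k) :
    C.Term (C.rep.incl ((repSig A B).fam g k h)) :=
  C.repSigma.pair _ _ (val a g k h)
    ⟨(val (A := B.sub (CwF.inst (C := cwf F) a)) b g k h).1, by
      rw [← genFam_inst A B a h]
      exact (val (A := B.sub (CwF.inst (C := cwf F) a)) b g k h).2⟩

theorem fst_pairVal (a : CwF.Term (cwf F) (Γ := X) A.incl)
    (b : CwF.Term (cwf F) (Γ := X) (B.sub (CwF.inst (C := cwf F) a)).incl) {Δ : C.Ctx}
    (g : F.F.obj Δ ⟶ X.base) (k : C.Realizer Δ) (h : X.mem g k) :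
    C.repSigma.fst _ _ (pairVal a b g k h) = val a g k h :=
  C.repSigma.fst_pair _ _ _ _

theorem snd_pairVal (a : CwF.Term (cwf F) (Γ := X) A.incl)
    (b : CwF.Term (cwf F) (Γ := X) (B.sub (CwF.inst (C := cwf F) a)).incl) {Δ : C.Ctx}
    (g : F.F.obj Δ ⟶ X.base) (k : C.Realizer Δ) (h : X.mem g k) :
    (C.repSigma.snd _ _ (pairVal a b g k h)).1 =
      (val (A := B.sub (CwF.inst (C := cwf F) a)) b g k h).1 :=
  C.repSigma.snd_pair _ _ _ _

/-- Pairing. -/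
@[reducible] noncomputable def repPair (a : CwF.Term (cwf F) (Γ := X) A.incl)
    (b : CwF.Term (cwf F) (Γ := X) (B.sub (CwF.inst (C := cwf F) a)).incl) :
    CwF.Term (cwf F) (Γ := X) (repSig A B).incl :=
  mkRepTerm (A := repSig A B) (D.repSigma.pair A.base B.base (baseTerm a) (baseTerm b))
    (pairVal a b)
    (fun h => (map_val_iff (pairVal a b) _ h).2 (by
      refine ⟨(congrArg (fun t => F.tm t.1) (fst_pairVal a b _ _ h)).trans ((map_val a h).trans ?_),
        (congrArg F.tm (snd_pairVal a b _ _ h)).trans ((map_val (A := B.sub (CwF.inst (C :=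
          cwf F) a)) b h).trans ?_)⟩
      · exact congrArg (fun t : D.Term (D.rep.incl A.base) => D.tmSub _ t.1)
          (D.repSigma.fst_pair A.base B.base (baseTerm a) (baseTerm b)).symm
      · exact congrArg (D.tmSub _)
          (D.repSigma.snd_pair A.base B.base (baseTerm a) (baseTerm b)).symm))
    (fun f _ _ h => (val_nat_iff (pairVal a b) f h).2 (by
      refine ⟨(congrArg Subtype.val (fst_pairVal a b _ _ _)).trans ((val_nat a f h).trans
        (congrArg (fun t => C.tmSub f t.1) (fst_pairVal a b _ _ h)).symm), ?_⟩
      exact (snd_pairVal a b _ _ _).trans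
        ((val_nat (A := B.sub (CwF.inst (C := cwf F) a)) b f h).trans
          (congrArg (C.tmSub f) (snd_pairVal a b _ _ h)).symm)))

theorem val_repPair (a : CwF.Term (cwf F) (Γ := X) A.incl)
    (b : CwF.Term (cwf F) (Γ := X) (B.sub (CwF.inst (C := cwf F) a)).incl) {Δ : C.Ctx}
    {g : F.F.obj Δ ⟶ X.base} {k : C.Realizer Δ} (h : X.mem g k) :
    val (A := repSig A B) (repPair a b) g k h = pairVal a b g k h :=
  val_eq rfl

theorem repFst_repPair (a : CwF.Term (cwf F) (Γ := X) A.incl)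
    (b : CwF.Term (cwf F) (Γ := X) (B.sub (CwF.inst (C := cwf F) a)).incl) :
    repFst (repPair a b) = a :=
  repTerm_ext (D.repSigma.fst_pair _ _ _ _) fun g k h => by
    rw [val_repFst, val_repPair, fst_pairVal]

end

theorem genFam_up {X Y : Obj F} (σ : Y ⟶ X) (A : RepTy X) (B : RepTy (ext A.incl)) {Δ : C.Ctx}
    {g : F.F.obj Δ ⟶ Y.base} {k : C.Realizer Δ} (h : Y.mem g k) :
    genFam (A.sub σ) (B.sub (CwF.up (C := cwf F) σ ((rep F).incl_sub σ A))) g k h =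
      genFam A B (g ≫ Hom.base σ) (Hom.real σ g k h) (Hom.mem σ h) :=
  B.fam_congr (genMap_up σ A h) (up_genReal σ A h) _ _

theorem repSig_sub {X Y : Obj F} (σ : Y ⟶ X) (A : RepTy X) (B : RepTy (ext A.incl)) :
    (repSig A B).sub σ =
      repSig (A.sub σ) (B.sub (CwF.up (C := cwf F) σ ((rep F).incl_sub σ A))) :=
  RepTy.ext (D.repSigma.sig_sub _ _ _) (by
    funext Δ g k h
    exact congrArg (C.repSigma.sig _) (genFam_up σ A B h).symm)

theorem val_sub {X Y : Obj F} (σ : Y ⟶ X) {A : RepTy X} (t : CwF.Term (cwf F) (Γ := X) A.incl)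
    {A' : RepTy Y} (e : A' = A.sub σ) {Δ : C.Ctx} {g : F.F.obj Δ ⟶ Y.base} {k : C.Realizer Δ}
    (h : Y.mem g k) :
    (val (A := A') (CwF.Term.sub (C := cwf F) t σ (A' := A'.incl)
      (CwF.incl_eq_sub (R := rep F) e)) g k h).1 =
      (val t (g ≫ Hom.base σ) (Hom.real σ g k h) (Hom.mem σ h)).1 :=
  Realizer.tm.inj ((real_eq_val (A := A') _ h).symm.trans (real_eq_val t (Hom.mem σ h)))

variable (F) in
/-- `Σ`-types of representable types in the gluing. -/
@[reducible] noncomputable def repSigma : CwF.SigmaStr (rep F) where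
  sig A B := repSig A B
  sig_sub σ A B := repSig_sub σ A B
  pair A B a b := repPair a b
  fst A B t := repFst t
  snd A B t := repSnd t
  fst_pair A B a b := repFst_repPair a b
  snd_pair A B a b := Tm.ext (by
    refine Eq.trans ?_ b.2.symm
    change (B.sub _).incl = (B.sub _).incl
    rw [repFst_repPair]) (D.repSigma.snd_pair _ _ _ _) (by
      funext Δ g k h
      rw [real_eq_val (A := B.sub (CwF.inst (C := cwf F) a)) b]
      change Realizer.tm (C.repSigma.snd _ _ (val (A := repSig A B) (repPair a b) g k h)).1 = _
      rw [val_repPair]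
      exact congrArg Realizer.tm (snd_pairVal a b g k h))
  pair_fst_snd A B t := repTerm_ext (D.repSigma.pair_fst_snd _ _ _) fun g k h => by
    rw [val_repPair]
    refine C.repSigma.pair_eq ?_ ?_
    · exact congrArg Subtype.val ((fst_pairVal _ _ g k h).trans (val_repFst t h))
    · exact (snd_pairVal _ _ g k h).trans (val_repSnd t h)
  fst_sub σ A B t := Tm.ext ((rep F).incl_sub σ A)
    (D.repSigma.fst_sub (Hom.base σ) A.base B.base (baseTerm t)) (by
      funext Δ g k h
      exact congrArg Realizer.tm (C.repSigma.fst_congr (genFam_up σ A B h) _ _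
        (val_sub σ t (repSig_sub σ A B).symm h)))
  snd_sub σ A B t := Tm.ext (by
      refine Eq.trans ?_ ((rep F).incl_sub σ (B.sub _))
      refine congrArg RepTy.incl ?_
      refine ((rep F).sub_comp _ _ B).symm.trans (Eq.trans ?_ ((rep F).sub_comp _ _ B))
      refine congrArg (RepTy.sub · B) (CwF.inst_up (C := cwf F) (repFst t) _ σ _ ?_)
      refine Tm.ext ((rep F).incl_sub σ A)
        (D.repSigma.fst_sub (Hom.base σ) A.base B.base (baseTerm t)) ?_
      funext Δ g k h
      exact congrArg Realizer.tm (C.repSigma.fst_congr (genFam_up σ A B h) _ _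
        (val_sub σ t (repSig_sub σ A B).symm h)))
    (D.repSigma.snd_sub (Hom.base σ) A.base B.base (baseTerm t)) (by
      funext Δ g k h
      exact congrArg Realizer.tm (C.repSigma.snd_congr (genFam_up σ A B h) _ _
        (val_sub σ t (repSig_sub σ A B).symm h)))

end Gluing

namespace Gluing

variable {C D : SigmaPiCwF.{u}} {F : SigmaPiCwF.Hom C D}

/-! ### Pi types -/

section

variable {X : Obj F} (A : RepTy X) (B : Ty (ext A.incl))

theorem map_incl_fam {A : RepTy X} {P : D.Ty X.base} {Δ : C.Ctx} {g : F.F.obj Δ ⟶ X.base}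
    {k : C.Realizer Δ} (h : X.mem g k) {ρ : F.F.obj Δ ⟶ D.ext P} (hρ : ρ ≫ D.p P = g) :
    F.ty (C.rep.incl (A.fam g k h)) = D.tySub ρ (D.rep.incl (D.rep.sub (D.p P) A.base)) := by
  rw [F.rep.map_incl (A.map_fam h), D.rep.incl_sub, ← D.tySub_comp, hρ]

/-- `Π`-types, realized by abstractions. -/
@[reducible] def pi : Ty X where
  base := D.pi.pi A.base B.base
  mem {Δ} g k a r := ∃ (h : X.mem g k) (ρ : F.F.obj Δ ⟶ D.ext (D.pi.pi A.base B.base))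
    (hρ : ρ ≫ D.p _ = g), D.tmSub ρ (D.q _) = a ∧ ∃ r', r = .lam (A.fam g k h) r' ∧
      B.mem (genMap A g k h) (genReal A g k h)
        (D.tmSub (F.upMap ρ (map_incl_fam h hρ) ≫ D.pi.ev A.base B.base) (D.q _)) r'
  supp h := h.1
  typ := by
    rintro Δ g k a r ⟨h, ρ, rfl, rfl, r', rfl, h'⟩
    exact CwF.typ_sub_q ρ
  mem_sub := by
    rintro Δ Θ f g k a r ⟨h, ρ, hρ, rfl, r', rfl, h'⟩
    refine ⟨X.mem_sub f h, F.F.map f ≫ ρ, by rw [Category.assoc, hρ], by rw [D.tmSub_comp],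
      r'.sub (CwF.up f (CwF.incl_eq_sub (A.nat f h))), Realizer.lam_sub _ _ _ (A.nat f h), ?_⟩
    refine B.mem_congr (map_up_genMap f h) (genReal_sub_up f h) ?_ rfl (B.mem_sub _ h')
    rw [← D.tmSub_comp, ← Category.assoc, F.map_up_upMap]

variable {A B}

/-- As for `Σ`-types, a term over `X.base` forces `ρ = g ≫ CwF.inst t`; evaluation there gives the
body of `t` at the generic element. -/
theorem pi_mem_iff {Δ : C.Ctx} {g : F.F.obj Δ ⟶ X.base} {k r : C.Realizer Δ}
    (t : D.Term (D.pi.pi A.base B.base)) :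
    (pi A B).mem g k (D.tmSub g t.1) r ↔ ∃ (h : X.mem g k) (r' : _),
      r = .lam (A.fam g k h) r' ∧ B.mem (genMap A g k h) (genReal A g k h)
        (D.tmSub (genMap A g k h) ((D.pi.lam A.base B.base).symm t).1) r' := by
  have e : D.rep.incl A.base = D.tySub (CwF.inst t) (D.rep.incl (D.rep.sub (D.p _) A.base)) := by
    rw [D.rep.incl_sub, ← D.tySub_comp, CwF.inst_p, D.tySub_id]
  have key : ∀ (h : X.mem g k) (ρ : F.F.obj Δ ⟶ D.ext (D.pi.pi A.base B.base))
      (hρ : ρ ≫ D.p _ = g), ρ = g ≫ CwF.inst t →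
      D.tmSub (F.upMap ρ (map_incl_fam h hρ) ≫ D.pi.ev A.base B.base) (D.q _) =
        D.tmSub (genMap A g k h) ((D.pi.lam A.base B.base).symm t).1 := by
    rintro h _ hρ rfl
    rw [← D.pi.up_inst_ev_q t e, ← D.tmSub_comp, ← Category.assoc, F.upMap_up]
  constructor
  · rintro ⟨h, ρ, hρ, h', r', rfl, h''⟩
    have : ρ = g ≫ CwF.inst t := by
      refine CwF.hom_ext (by simpa using hρ) ?_
      rw [h', D.tmSub_comp, CwF.inst_q]
    exact ⟨h, r', rfl, B.mem_congr rfl rfl (key h ρ hρ this) rfl h''⟩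
  · rintro ⟨h, r', rfl, h'⟩
    exact ⟨h, g ≫ CwF.inst t, by simp, by rw [D.tmSub_comp, CwF.inst_q], r', rfl,
      B.mem_congr rfl rfl (key h _ (by simp) rfl).symm rfl h'⟩

/-- Elements of a representable type are realized by terms of `C`, and instantiating the generic
element at such a term gives back the element. This is the Yoneda-type fact behind the bijectivity
of abstraction. -/
theorem exists_of_mem_ext_incl {Δ : C.Ctx} {y : F.F.obj Δ ⟶ (ext A.incl).base}
    {κ : C.Realizer Δ} (hy : (ext A.incl).mem y κ) :
    ∃ (g : F.F.obj Δ ⟶ X.base) (k : C.Realizer Δ) (h : X.mem g k)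
      (t : C.Term (C.rep.incl (A.fam g k h))),
      F.F.map (CwF.inst t) ≫ genMap A g k h = y ∧ (genReal A g k h).sub (CwF.inst t) = κ := by
  obtain ⟨k, r, rfl, h, t, ht, rfl⟩ := hy
  refine ⟨_, k, h, t, ?_, genReal_sub_inst h t⟩
  refine CwF.hom_ext ?_ ?_
  · rw [Category.assoc, F.upMap_p, ← F.F.map_comp_assoc, CwF.inst_p, F.F.map_id, Category.id_comp]
  · rw [F.comp_upMap_q, ← F.tm_sub, CwF.inst_q, ht]

/-- The base element and the term of `C` can be read off from an instance of the generic element, so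
a value defined through such a presentation is independent of it. -/
theorem sub_inst_congr (r : ∀ (Δ : C.Ctx) (g : F.F.obj Δ ⟶ X.base) (k : C.Realizer Δ)
      (h : X.mem g k), C.Realizer (C.ext (C.rep.incl (A.fam g k h))))
    {Δ : C.Ctx} {g g' : F.F.obj Δ ⟶ X.base} {k k' : C.Realizer Δ} {h : X.mem g k}
    {h' : X.mem g' k'} {t : C.Term (C.rep.incl (A.fam g k h))}
    {t' : C.Term (C.rep.incl (A.fam g' k' h'))}
    (e₁ : F.F.map (CwF.inst t) ≫ genMap A g k h = F.F.map (CwF.inst t') ≫ genMap A g' k' h')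
    (e₂ : (genReal A g k h).sub (CwF.inst t) = (genReal A g' k' h').sub (CwF.inst t')) :
    (r Δ g k h).sub (CwF.inst t) = (r Δ g' k' h').sub (CwF.inst t') := by
  have hp := congrArg (· ≫ D.p _) e₁
  simp only [Category.assoc, F.upMap_p, ← F.F.map_comp_assoc, CwF.inst_p, F.F.map_id,
    Category.id_comp] at hp
  subst hp
  rw [genReal_sub_inst, genReal_sub_inst] at e₂
  obtain ⟨rfl, e⟩ := Realizer.pair.inj e₂
  obtain rfl := Subtype.ext (Realizer.tm.inj e)
  rfl

/-- Abstraction. -/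
@[reducible] def lam (b : CwF.Term (cwf F) (Γ := ext A.incl) B) :
    CwF.Term (cwf F) (Γ := X) (pi A B) :=
  mkTerm (A := pi A B) (D.pi.lam A.base B.base (baseTerm b))
    (fun g k h => .lam (A.fam g k h) (b.1.real (genMap A g k h) (genReal A g k h) (gen_mem h)))
    (fun h => (pi_mem_iff _).2 ⟨h, _, rfl, by
      rw [Equiv.symm_apply_apply]
      exact term_mem b (gen_mem h)⟩)
    (fun f g k h => by
      rw [Realizer.lam_sub _ _ _ (A.nat f h), ← Tm.nat b.1 _ (gen_mem h)]
      refine congrArg (Realizer.lam _) ?_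
      exact b.1.real_congr (map_up_genMap f h).symm (genReal_sub_up f h).symm _)

theorem lam_injective : Function.Injective (lam (A := A) (B := B)) := by
  intro b b' e
  refine term_ext ?_ ?_
  · exact (D.pi.lam A.base B.base).injective (congrArg baseTerm e)
  · intro Δ y κ hy
    obtain ⟨g, k, h, t, rfl, rfl⟩ := exists_of_mem_ext_incl hy
    have : b.1.real _ _ (gen_mem h) = b'.1.real _ _ (gen_mem h) :=
      Realizer.lam_injective
        (congrArg (fun s : CwF.Term (cwf F) (Γ := X) (pi A B) => Tm.real s.1 g k h) e)
    exact (Tm.nat b.1 (CwF.inst t) (gen_mem h)).trans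
      ((congrArg (Realizer.sub · _) this).trans (Tm.nat b'.1 (CwF.inst t) (gen_mem h)).symm)

/-- Membership in the `Π`-type supplies a body `r` at each generic element. The action on an
arbitrary element is defined by presenting the element as an instance of a generic one and
substituting in `r`. -/
theorem lam_surjective : Function.Surjective (lam (A := A) (B := B)) := by
  intro f
  have H₁ : ∀ (Δ : C.Ctx) (g : F.F.obj Δ ⟶ X.base) (k : C.Realizer Δ) (h : X.mem g k),
      ∃ r, f.1.real g k h = .lam (A.fam g k h) r ∧ B.mem (genMap A g k h) (genReal A g k h)
        (D.tmSub (genMap A g k h) ((D.pi.lam A.base B.base).symm (baseTerm f)).1) r :=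
    fun Δ g k h => ((pi_mem_iff (baseTerm f)).1 (term_mem f h)).2
  choose r hr hm using H₁
  have hr_nat : ∀ {Δ Θ : C.Ctx} (σ : Θ ⟶ Δ) (g : F.F.obj Δ ⟶ X.base) (k : C.Realizer Δ)
      (h : X.mem g k), r Θ (F.F.map σ ≫ g) (k.sub σ) (X.mem_sub σ h) =
        (r Δ g k h).sub (CwF.up σ (CwF.incl_eq_sub (A.nat σ h))) := by
    intro Δ Θ σ g k h
    have := Tm.nat f.1 σ h
    rw [hr, hr, Realizer.lam_sub _ _ _ (A.nat σ h)] at this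
    exact Realizer.lam_injective this
  -- The value `s` is specified against all presentations of the element at once, so that later
  -- steps may use whichever presentation is convenient.
  have H₂ : ∀ (Δ : C.Ctx) (y : F.F.obj Δ ⟶ (ext A.incl).base) (κ : C.Realizer Δ)
      (_ : (ext A.incl).mem y κ), ∃ s, ∀ (g : F.F.obj Δ ⟶ X.base) (k : C.Realizer Δ)
        (h : X.mem g k) (t : C.Term (C.rep.incl (A.fam g k h))),
        F.F.map (CwF.inst t) ≫ genMap A g k h = y → (genReal A g k h).sub (CwF.inst t) = κ →
          s = (r Δ g k h).sub (CwF.inst t) := by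
    intro Δ y κ hy
    obtain ⟨g, k, h, t, rfl, rfl⟩ := exists_of_mem_ext_incl hy
    exact ⟨_, fun g' k' h' t' e₁ e₂ => sub_inst_congr r e₁.symm e₂.symm⟩
  choose s hs using H₂
  let b : CwF.Term (cwf F) (Γ := ext A.incl) B :=
    mkTerm ((D.pi.lam A.base B.base).symm (baseTerm f)) (fun {Δ} g k h => s Δ g k h)
      (fun {Δ y κ} hy => by
        obtain ⟨g, k, h, t, rfl, rfl⟩ := exists_of_mem_ext_incl hy
        rw [hs _ _ _ _ g k h t rfl rfl, D.tmSub_comp]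
        exact B.mem_sub _ (hm _ g k h))
      (fun {Δ Θ} σ y κ hy => by
        obtain ⟨g, k, h, t, rfl, rfl⟩ := exists_of_mem_ext_incl hy
        let t' : C.Term (C.rep.incl (A.fam _ _ (X.mem_sub σ h))) :=
          t.sub σ (CwF.incl_eq_sub (A.nat σ h))
        have e := CwF.inst_up t t' σ (CwF.incl_eq_sub (A.nat σ h)) rfl
        rw [hs _ _ _ _ g k h t rfl rfl, hs _ _ _ _ _ _ (X.mem_sub σ h) t' ?_ ?_, hr_nat,
          ← Realizer.sub_comp, ← Realizer.sub_comp, e]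
        · rw [← map_up_genMap, ← F.F.map_comp_assoc, e, F.F.map_comp_assoc]
        · rw [← genReal_sub_up, ← Realizer.sub_comp, e, Realizer.sub_comp])
  refine ⟨b, term_ext ((D.pi.lam A.base B.base).apply_symm_apply (baseTerm f)) ?_⟩
  intro Δ g k h
  rw [hr]
  refine congrArg (Realizer.lam _) ?_
  let P := C.rep.incl (A.fam g k h)
  let t : C.Term (C.rep.incl (A.fam _ _ (X.mem_sub (C.p P) h))) :=
    ⟨C.q P, by rw [C.typ_q, A.nat, C.rep.incl_sub]⟩
  -- The generic element is itself an instance, at the last variable, of the generic element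
  -- weakened to the extended context; hence the action there gives back the original body.
  have e : CwF.inst t ≫ CwF.up (C.p P) (CwF.incl_eq_sub (A.nat _ h)) = 𝟙 _ := by
    refine CwF.hom_ext ?_ ?_
    · rw [Category.assoc, CwF.up_p, CwF.inst_p_assoc, Category.id_comp]
    · rw [CwF.comp_up_q, CwF.inst_q, C.tmSub_id]
  refine (hs _ _ _ _ _ _ (X.mem_sub (C.p P) h) t ?_ ?_).trans ?_
  · rw [← map_up_genMap, ← F.F.map_comp_assoc, e, F.F.map_id, Category.id_comp]
  · rw [← genReal_sub_up, ← Realizer.sub_comp, e, Realizer.sub_id]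
  · rw [hr_nat, ← Realizer.sub_comp, e, Realizer.sub_id]

end

/-- Functions over the two bases correspond along a pullback map; `up_up_ev` matches their
evaluations, and `genMap_up` and `up_genReal` match the generic arguments. -/
theorem pi_sub {X Y : Obj F} (σ : Y ⟶ X) (A : RepTy X) (B : Ty (ext A.incl)) :
    (pi A B).sub σ = pi (A.sub σ) (B.sub (CwF.up (C := cwf F) σ ((rep F).incl_sub σ A))) := by
  refine Ty.ext' (D.pi.pi_sub _ _ _) fun {Δ} g k a r => ?_
  let u := CwF.up (C := D.toCwF) (Hom.base σ) (D.rep.incl_sub _ A.base)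
  let B' := D.tySub u B.base
  have e : D.pi.pi (D.rep.sub (Hom.base σ) A.base) B' =
      D.tySub (Hom.base σ) (D.pi.pi A.base B.base) := D.pi.pi_congr rfl rfl
  have e' : D.rep.incl (D.rep.sub (D.p (D.pi.pi (D.rep.sub (Hom.base σ) A.base) B'))
      (D.rep.sub (Hom.base σ) A.base)) =
      D.tySub (CwF.up (Hom.base σ) e) (D.rep.incl (D.rep.sub (D.p _) A.base)) := by
    rw [← D.rep.incl_sub, ← D.rep.sub_comp, ← D.rep.sub_comp, CwF.up_p]
  have key : CwF.up (CwF.up (Hom.base σ) e) e' ≫ D.pi.ev A.base B.base =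
      D.pi.ev (D.rep.sub (Hom.base σ) A.base) B' ≫ CwF.up u rfl :=
    D.pi.up_up_ev rfl rfl e'
  have key₁ : ∀ (h : Y.mem g k)
      (ρ : F.F.obj Δ ⟶ D.ext (D.pi.pi (D.rep.sub (Hom.base σ) A.base) B'))
      (hρ : ρ ≫ D.p _ = g) (ρ' : F.F.obj Δ ⟶ D.ext (D.pi.pi A.base B.base))
      (hρ' : ρ' ≫ D.p _ = g ≫ Hom.base σ), ρ' = ρ ≫ CwF.up (Hom.base σ) e →
      D.tmSub (F.upMap ρ' (map_incl_fam (Hom.mem σ h) hρ') ≫ D.pi.ev A.base B.base) (D.q _) =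
        D.tmSub (F.upMap ρ (map_incl_fam (A := A.sub σ) h hρ) ≫
          D.pi.ev (D.rep.sub (Hom.base σ) A.base) B') (D.q _) := by
    rintro h ρ hρ ρ' hρ' rfl
    rw [← F.upMap_up ρ _ (map_incl_fam (A := A.sub σ) h hρ) e', Category.assoc, key,
      ← Category.assoc, CwF.comp_up_q]
  constructor
  · rintro ⟨h, h₀, ρ, hρ, rfl, r', rfl, h'⟩
    obtain ⟨ρ', hp, hq⟩ : ∃ ρ' : F.F.obj Δ ⟶ D.ext (D.pi.pi (D.rep.sub (Hom.base σ) A.base) B'),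
        ρ' ≫ D.p _ = g ∧ D.tmSub ρ' (D.q _) = D.tmSub ρ (D.q _) :=
      ⟨D.pair g _ (D.tmSub ρ (D.q _)) (by rw [CwF.typ_sub_q, hρ, e, D.tySub_comp]),
        D.pair_p _ _ _ _, D.pair_q _ _ _ _⟩
    refine ⟨h, ρ', hp, hq, r', rfl, gen_mem h, ?_⟩
    refine B.mem_congr (genMap_up σ A h).symm (up_genReal σ A h).symm ?_ rfl h'
    refine key₁ h ρ' hp ρ hρ (CwF.hom_ext ?_ ?_)
    · rw [Category.assoc, CwF.up_p, ← Category.assoc, hp, hρ]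
    · rw [CwF.comp_up_q, hq]
  · rintro ⟨h, ρ, hρ, rfl, r', rfl, h₁, h'⟩
    have hρ' : (ρ ≫ CwF.up (Hom.base σ) e) ≫ D.p _ = g ≫ Hom.base σ :=
      (Category.assoc _ _ _).trans
        ((congrArg (ρ ≫ ·) (CwF.up_p _ e)).trans ((Category.assoc _ _ _).symm.trans
          (congrArg (· ≫ Hom.base σ) hρ)))
    exact ⟨h, Hom.mem σ h, _, hρ', CwF.comp_up_q _ _ _, r', rfl,
      B.mem_congr (genMap_up σ A h) (up_genReal σ A h) (key₁ h ρ hρ _ hρ' rfl).symm rfl h'⟩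

variable (F) in
/-- `Π`-types in the gluing. -/
@[reducible] noncomputable def piStr : CwF.PiStr (rep F) where
  pi A B := pi A B
  pi_sub := pi_sub
  lam A B := Equiv.ofBijective lam ⟨lam_injective, lam_surjective⟩
  lam_sub σ A B b := Tm.ext (pi_sub σ A B).symm
    (D.pi.lam_sub (Hom.base σ) A.base B.base (baseTerm b)) (by
      funext Δ g k h
      exact congrArg (Realizer.lam _) (b.1.real_congr (genMap_up σ A h) (up_genReal σ A h) _))

variable (F) in
/-- The gluing as a `(Σ, Π_rep)`-CwF. -/
@[reducible] noncomputable def sigmaPiCwF : SigmaPiCwF.{u} where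
  toCwF := cwf F
  rep := rep F
  unit := unit F
  sigma := sigma F
  repUnit := repUnit F
  repSigma := repSigma F
  pi := piStr F

end Gluing

namespace Gluing

/-! ### Equality types -/

section

variable {C : SigmaPiCwF.{u}} {D : SigmaPiEqCwF.{u}} {F : SigmaPiCwF.Hom C D.toSigmaPiCwF}

/-- Equality types. -/
@[reducible] def eqTy {X : Obj F} (A : Ty X) (x y : CwF.Term (cwf F) (Γ := X) A) : Ty X where
  base := D.eqStr.eq A.base (baseTerm x) (baseTerm y)
  mem g k a r := ∃ h : X.mem g k,
    D.typ a = D.tySub g (D.eqStr.eq A.base (baseTerm x) (baseTerm y)) ∧ r = .unit ∧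
      x.1.real g k h = y.1.real g k h
  supp h := h.1
  typ h := h.2.1
  mem_sub := by
    rintro Δ Θ f g k a r ⟨h, h', rfl, e⟩
    refine ⟨X.mem_sub f h, ?_, Realizer.unit_sub f, ?_⟩
    · rw [D.typ_sub, h', D.tySub_comp]
    · rw [Tm.nat x.1 f h, Tm.nat y.1 f h, e]

variable (F) in
/-- Equality types in the gluing. -/
@[reducible] def eqStr : CwF.EqStr (cwf F) where
  eq A x y := eqTy A x y
  eq_sub {X Y} σ A x y := by
    refine Ty.ext' (D.eqStr.eq_sub _ _ _ _) fun {Δ} g k a r => ?_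
    have e : D.tySub (g ≫ Hom.base σ) (D.eqStr.eq A.base (baseTerm x) (baseTerm y)) =
        D.tySub g (D.eqStr.eq (D.tySub (Hom.base σ) A.base)
          ((baseTerm x).sub (Hom.base σ) rfl) ((baseTerm y).sub (Hom.base σ) rfl)) := by
      rw [D.tySub_comp, D.eqStr.eq_sub]
    exact ⟨fun ⟨h, _, h₁, h₂⟩ => ⟨h, h₁.trans e, h₂⟩,
      fun ⟨h, h₁, h₂⟩ => ⟨h, Hom.mem σ h, h₁.trans e.symm, h₂⟩⟩
  refl {X} A x := mkTerm (A := eqTy A x x) (D.eqStr.refl _ _) (fun _ _ _ => .unit)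
    (fun h => ⟨h, by rw [D.typ_sub, (D.eqStr.refl _ _).2], rfl, rfl⟩)
    (fun f _ _ _ => (Realizer.unit_sub f).symm)
  -- Reflection in `D` identifies the underlying terms, and the relation of `eqTy` records that the
  -- realizers coincide. These two components determine a glued term of a given type.
  reflection A x y e := term_ext (D.eqStr.reflection _ _ _ (baseTerm (A := eqTy A x y) e))
    fun g k h => (term_mem (A := eqTy A x y) e h).2.2.2
  uniq A x e := term_ext (D.eqStr.uniq _ _ (baseTerm (A := eqTy A x x) e))
    fun g k h => (term_mem (A := eqTy A x x) e h).2.2.1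

variable (F) in
/-- The gluing as a `(Σ, Π_rep, Eq)`-CwF. -/
@[reducible] noncomputable def sigmaPiEqCwF : SigmaPiEqCwF.{u} where
  toSigmaPiCwF := sigmaPiCwF F
  eqStr := eqStr F

end

/-! ### The projection to the base -/

section

variable {C D : SigmaPiCwF.{u}} (F : SigmaPiCwF.Hom C D)

/-- The projection from the gluing, as a morphism of categories with families. -/
@[reducible] def baseCwFHom : CwF.Hom (cwf F) D.toCwF where
  F := { obj := Obj.base, map := Hom.base }
  ty := Ty.base
  ty_sub _ _ := rfl
  tm := Tm.base
  tm_sub _ _ := rfl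
  typ_tm t := t.typ_base
  obj_nil := rfl
  obj_ext _ := rfl
  map_p _ := (Category.id_comp _).symm
  tm_q _ := (D.tmSub_id _).symm

/-- The projection on representable types. -/
@[reducible] def baseRep : CwF.RestrictionHom (baseCwFHom F) (rep F) D.rep where
  map := RepTy.base
  map_sub _ _ := rfl
  incl_map _ := rfl

/-- The projection from the gluing. -/
@[reducible] noncomputable def baseHom : SigmaPiCwF.Hom (sigmaPiCwF F) D where
  toHom := baseCwFHom F
  rep := baseRep F
  map_unit _ := rfl
  map_sigma :=
    { map_sig := fun A B => congrArg (D.sigma.sig A.base) (D.tySub_id B.base).symm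
      map_fst := fun _ B _ => D.sigma.fst_congr (D.tySub_id B.base) _ _ rfl
      map_snd := fun _ B _ => D.sigma.snd_congr (D.tySub_id B.base) _ _ rfl }
  map_repUnit _ := rfl
  map_repSigma :=
    { map_sig := fun A B => congrArg (D.repSigma.sig A.base) (D.rep.sub_id B.base).symm
      map_fst := fun _ B _ => D.repSigma.fst_congr (D.rep.sub_id B.base) _ _ rfl
      map_snd := fun _ B _ => D.repSigma.snd_congr (D.rep.sub_id B.base) _ _ rfl }
  map_pi :=
    { map_pi := fun A B => congrArg (D.pi.pi A.base) (D.tySub_id B.base).symm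
      map_lam := fun _ B _ => D.pi.lam_congr (D.tySub_id B.base) _ _ (D.tmSub_id _) }

end

/-- The projection from the gluing preserves equality types. -/
noncomputable def baseEqHom {C : SigmaPiCwF.{u}} {D : SigmaPiEqCwF.{u}}
    (F : SigmaPiCwF.Hom C D.toSigmaPiCwF) : SigmaPiEqCwF.Hom (sigmaPiEqCwF F) D where
  hom := baseHom F
  map_eq := ⟨fun _ _ _ => rfl⟩

end Gluing

/-! ## Realized contexts and types -/

namespace Realized

variable (C : SigmaPiCwF.{u})

/-- A context of `C` with a faithful realization of its generalized elements. -/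
structure Ctx where
  ctx : C.Ctx
  real : C.Realizer ctx
  inj : ∀ {Δ : C.Ctx} {σ τ : Δ ⟶ ctx}, real.sub σ = real.sub τ → σ = τ

variable {C}

instance : Category.{u} (Ctx C) where
  Hom X Y := X.ctx ⟶ Y.ctx
  id X := 𝟙 X.ctx
  comp f g := CategoryStruct.comp (obj := C.Ctx) f g
  id_comp f := Category.id_comp (obj := C.Ctx) f
  comp_id f := Category.comp_id (obj := C.Ctx) f
  assoc f g h := Category.assoc (obj := C.Ctx) f g h

/-- A type of `C` with a faithful realization of its elements. -/
structure Ty (X : Ctx C) where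
  ty : C.Ty X.ctx
  real : C.Realizer (C.ext ty)
  inj : ∀ {Δ : C.Ctx} {σ τ : Δ ⟶ C.ext ty}, σ ≫ C.p ty = τ ≫ C.p ty →
    real.sub σ = real.sub τ → σ = τ

/-- Substitution in realized types. -/
@[reducible] def Ty.sub {X Y : Ctx C} (σ : Y.ctx ⟶ X.ctx) (A : Ty X) : Ty Y where
  ty := C.tySub σ A.ty
  real := A.real.sub (CwF.up σ rfl)
  inj {Δ ρ τ} h h' := by
    rw [← Realizer.sub_comp, ← Realizer.sub_comp] at h'
    have e := A.inj (by simp [reassoc_of% h]) h'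
    refine CwF.hom_ext h ?_
    rw [← CwF.comp_up_q σ rfl ρ, e, CwF.comp_up_q]

theorem Ty.eq_sub {X Y : Ctx C} {σ : Y.ctx ⟶ X.ctx} {A : Ty X} {B : Ty Y}
    (h : B.ty = C.tySub σ A.ty) (h' : B.real = A.real.sub (CwF.up σ h)) : B = A.sub σ := by
  obtain ⟨B, r, hr⟩ := B
  dsimp only at h
  subst h
  dsimp only at h'
  subst h'
  rfl

/-- A term of a realized type. -/
@[ext]
structure Tm (X : Ctx C) where
  ty : Ty X
  tm : C.Tm X.ctx
  typ_tm : C.typ tm = ty.ty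

theorem Ty.sub_id {X : Ctx C} (A : Ty X) : A.sub (𝟙 X.ctx) = A :=
  (Ty.eq_sub (C.tySub_id _).symm (by rw [CwF.up_id, Realizer.sub_id])).symm

theorem Ty.sub_comp {X Y Z : Ctx C} (τ : Z.ctx ⟶ Y.ctx) (σ : Y.ctx ⟶ X.ctx) (A : Ty X) :
    A.sub (τ ≫ σ) = (A.sub σ).sub τ :=
  (Ty.eq_sub (C.tySub_comp _ _ _).symm (by
    change (A.real.sub _).sub _ = _
    rw [← Realizer.sub_comp, CwF.up_comp])).symm

/-- Substitution in terms. -/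
@[reducible] def Tm.sub {X Y : Ctx C} (σ : Y.ctx ⟶ X.ctx) (t : Tm X) : Tm Y where
  ty := t.ty.sub σ
  tm := C.tmSub σ t.tm
  typ_tm := by rw [C.typ_sub, t.typ_tm]

/-- Context extension. -/
@[reducible] def ext {X : Ctx C} (A : Ty X) : Ctx C where
  ctx := C.ext A.ty
  real := .pair (X.real.sub (C.p A.ty)) A.real
  inj {Δ σ τ} h := by
    simp only [Realizer.pair_sub, ← Realizer.sub_comp] at h
    obtain ⟨h₁, h₂⟩ := Realizer.pair.inj h
    exact A.inj (X.inj h₁) h₂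

variable (C) in
/-- The empty context. -/
@[reducible] def nil : Ctx C where
  ctx := C.nil
  real := .unit
  inj _ := C.nilIsTerminal.hom_ext _ _

variable (C) in
/-- The category with families of realized contexts and types. -/
@[reducible] def cwf : CwF.{u} where
  Ctx := Ctx C
  nil := nil C
  nilIsTerminal := Limits.IsTerminal.ofUniqueHom
    (fun X => (C.nilIsTerminal.from X.ctx : X.ctx ⟶ C.nil))
    (fun X m => Limits.IsTerminal.hom_ext (X := C.nil) (Y := X.ctx) C.nilIsTerminal _ _)
  Ty := Ty
  tySub σ A := A.sub σ
  tySub_id := Ty.sub_id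
  tySub_comp := Ty.sub_comp
  Tm := Tm
  tmSub σ t := t.sub σ
  tmSub_id t := Tm.ext (Ty.sub_id _) (C.tmSub_id _)
  tmSub_comp τ σ t := Tm.ext (Ty.sub_comp _ _ _) (C.tmSub_comp _ _ _)
  typ t := t.ty
  typ_sub _ _ := rfl
  ext := ext
  p A := C.p A.ty
  q A := ⟨A.sub (Y := ext A) (C.p A.ty), C.q A.ty, C.typ_q _⟩
  typ_q _ := rfl
  pair σ A a h := C.pair σ A.ty a.tm (a.typ_tm.trans (congrArg Ty.ty h))
  pair_p σ A a h := C.pair_p _ _ _ _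
  pair_q {X Y} σ A a h := Tm.ext (by
    refine Eq.trans ?_ h.symm
    refine (Ty.sub_comp (X := X) (Y := ext A) (Z := Y) _ _ A).symm.trans ?_
    exact congrArg (fun τ : Y.ctx ⟶ X.ctx => A.sub τ) (C.pair_p _ _ _ _)) (C.pair_q _ _ _ _)
  pair_uniq σ A a h τ h₁ h₂ := C.pair_uniq _ _ _ _ _ h₁ (congrArg Tm.tm h₂)

/-- The underlying term of `C`. -/
@[reducible] def toTerm {X : Ctx C} {A : Ty X} (t : CwF.Term (cwf C) (Γ := X) A) : C.Term A.ty :=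
  ⟨t.1.tm, t.1.typ_tm.trans (congrArg Ty.ty t.2)⟩

/-- A term of `C`, as a term of a realized type. -/
@[reducible] def ofTerm {X : Ctx C} {A : Ty X} (t : C.Term A.ty) : CwF.Term (cwf C) (Γ := X) A :=
  ⟨⟨A, t.1, t.2⟩, rfl⟩

theorem term_ext {X : Ctx C} {A : Ty X} {t t' : CwF.Term (cwf C) (Γ := X) A}
    (h : toTerm t = toTerm t') : t = t' :=
  Subtype.ext (Tm.ext (t.2.trans t'.2.symm) (congrArg Subtype.val h))

/-- The realization of a type by terms. -/
@[reducible] def ofTy {X : Ctx C} (A : C.Ty X.ctx) : Ty X where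
  ty := A
  real := .tm (C.q A)
  inj h h' := by
    rw [Realizer.tm_sub, Realizer.tm_sub] at h'
    exact CwF.hom_ext h (Realizer.tm.inj h')

theorem ofTy_sub {X Y : Ctx C} (σ : Y.ctx ⟶ X.ctx) {A : C.Ty X.ctx} {A' : C.Ty Y.ctx}
    (h : A' = C.tySub σ A) : ofTy A' = (ofTy A).sub σ :=
  Ty.eq_sub h (by rw [Realizer.tm_sub, CwF.up_q])

variable (C) in
/-- Unit types. -/
@[reducible] def unit : CwF.UnitStr (cwf C).all where
  one X :=
    { ty := C.unit.one X.ctx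
      real := .unit
      -- The realizer carries no information; faithfulness comes from uniqueness of the term of the
      -- `1`-type.
      inj := fun {Δ σ τ} h _ => by
        have e : C.unit.one Δ = C.tySub (τ ≫ C.p _) (C.unit.one X.ctx) := (C.unit.one_sub _).symm
        let t : C.Term (C.unit.one Δ) := ⟨C.tmSub σ (C.q _), by rw [CwF.typ_sub_q, h, e]⟩
        let t' : C.Term (C.unit.one Δ) := ⟨C.tmSub τ (C.q _), by rw [CwF.typ_sub_q, e]⟩
        have : t = t' := (C.unit.star_uniq t).trans (C.unit.star_uniq t').symm
        exact CwF.hom_ext h (congrArg Subtype.val this) }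
  one_sub σ := (Ty.eq_sub (C.unit.one_sub _).symm (Realizer.unit_sub _).symm).symm
  star X := ofTerm (C.unit.star X.ctx)
  star_uniq t := term_ext (C.unit.star_uniq _)

/-- Realized `Σ`-types. -/
@[reducible] def sig {X : Ctx C} (A : Ty X) (B : Ty (ext A)) : Ty X where
  ty := C.sigma.sig A.ty B.ty
  real := .pair (A.real.sub (C.sigma.unpair A.ty B.ty ≫ C.p B.ty))
    (B.real.sub (C.sigma.unpair A.ty B.ty))
  -- Faithfulness of `A` identifies the first projections, which puts the second ones over the same
  -- base for faithfulness of `B`; `unpair` being a monomorphism concludes.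
  inj {Δ σ τ} h h' := by
    simp only [Realizer.pair_sub, ← Realizer.sub_comp] at h'
    obtain ⟨h₁, h₂⟩ := Realizer.pair.inj h'
    have key : C.sigma.unpair A.ty B.ty ≫ C.p B.ty ≫ C.p A.ty = C.p _ :=
      C.sigma.unpair_p_p A.ty B.ty
    have e₁ := A.inj (by rw [Category.assoc, Category.assoc, Category.assoc,
        Category.assoc, key, h])
      h₁
    have e₂ := B.inj (by rw [Category.assoc, Category.assoc, e₁]) h₂
    exact (cancel_mono (C.sigma.unpair A.ty B.ty)).1 e₂

theorem sig_sub {X Y : Ctx C} (σ : Y.ctx ⟶ X.ctx) (A : Ty X) (B : Ty (ext A)) :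
    (sig A B).sub σ = sig (A.sub σ) (B.sub (Y := ext (A.sub σ)) (CwF.up σ rfl)) := by
  refine (Ty.eq_sub (C.sigma.sig_congr rfl rfl) ?_).symm
  have key : CwF.up σ (C.sigma.sig_congr (A := A.ty) (B := B.ty) rfl rfl) ≫
      C.sigma.unpair A.ty B.ty =
      C.sigma.unpair (C.tySub σ A.ty) (C.tySub (CwF.up σ rfl) B.ty) ≫
        CwF.up (CwF.up σ rfl) rfl := C.sigma.up_unpair rfl rfl
  change Realizer.pair ((A.real.sub _).sub _) ((B.real.sub _).sub _) = _
  rw [Realizer.pair_sub, ← Realizer.sub_comp, ← Realizer.sub_comp, ← Realizer.sub_comp,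
    ← Realizer.sub_comp, ← Category.assoc (CwF.up σ _), key, Category.assoc, Category.assoc,
    CwF.up_p]

variable (C) in
/-- `Σ`-types. -/
@[reducible] def sigma : CwF.SigmaStr (cwf C).all where
  sig A B := sig A B
  sig_sub σ A B := sig_sub σ A B
  pair A B a b := ofTerm (A := sig A B) (C.sigma.pair A.ty B.ty (toTerm a) (toTerm b))
  fst A B t := ofTerm (C.sigma.fst A.ty B.ty (toTerm t))
  snd A B t := ofTerm (A := Ty.sub (Y := _) _ B) (C.sigma.snd A.ty B.ty (toTerm t))
  fst_pair A B a b := term_ext (C.sigma.fst_pair _ _ _ _)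
  snd_pair {X} A B a b := Tm.ext (by
    refine Eq.trans ?_ b.2.symm
    refine congrArg (fun a => B.sub (CwF.inst (C := cwf C) (Γ := X) (A := A) a)) ?_
    exact term_ext (C.sigma.fst_pair A.ty B.ty (toTerm a) (toTerm b)))
        (C.sigma.snd_pair A.ty B.ty (toTerm a) (toTerm b))
  pair_fst_snd A B t := term_ext (C.sigma.pair_fst_snd _ _ _)
  fst_sub σ A B t := Tm.ext rfl (C.sigma.fst_sub σ A.ty B.ty (toTerm t))
  snd_sub σ A B t := Tm.ext (by
    refine ((cwf C).tySub_comp _ _ B).symm.trans (Eq.trans ?_ ((cwf C).tySub_comp _ _ B))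
    refine congrArg (fun τ => (cwf C).tySub τ B) (CwF.inst_up (C := cwf C) _ _ σ rfl ?_)
    exact Tm.ext rfl (C.sigma.fst_sub σ A.ty B.ty (toTerm t)))
    (C.sigma.snd_sub σ A.ty B.ty (toTerm t))

variable (C) in
/-- Representable types, realized by terms. -/
@[reducible] def rep : CwF.Restriction (cwf C) where
  Ty X := C.rep.Ty X.ctx
  sub σ A := C.rep.sub σ A
  sub_id A := C.rep.sub_id A
  sub_comp τ σ A := C.rep.sub_comp τ σ A
  incl A := ofTy (C.rep.incl A)
  incl_sub σ A := ofTy_sub σ (C.rep.incl_sub σ A)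

variable (C) in
/-- Representable unit types. -/
@[reducible] def repUnit : CwF.UnitStr (rep C) where
  one X := C.repUnit.one X.ctx
  one_sub σ := C.repUnit.one_sub σ
  star X := ofTerm (C.repUnit.star X.ctx)
  star_uniq _ := term_ext (C.repUnit.star_uniq _)

variable (C) in
/-- Representable `Σ`-types. -/
@[reducible] def repSigma : CwF.SigmaStr (rep C) where
  sig A B := C.repSigma.sig A B
  sig_sub σ A B := C.repSigma.sig_sub σ A B
  pair {X} A B a b := ofTerm (A := ofTy (X := X) _) (C.repSigma.pair A B (toTerm a) (toTerm b))
  fst A B t := ofTerm (C.repSigma.fst A B (toTerm t))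
  snd {X} A B t := ofTerm (A := ofTy (X := X) _) (C.repSigma.snd A B (toTerm t))
  fst_pair A B a b := term_ext (C.repSigma.fst_pair _ _ _ _)
  snd_pair {X} A B a b := Tm.ext (by
    refine Eq.trans ?_ b.2.symm
    exact congrArg (fun a : C.Term (C.rep.incl A) =>
      ofTy (X := X) (C.rep.incl (C.rep.sub (CwF.inst (C := C.toCwF) a) B)))
      (C.repSigma.fst_pair A B (toTerm a) (toTerm b)))
    (C.repSigma.snd_pair A B (toTerm a) (toTerm b))
  pair_fst_snd A B t := term_ext (C.repSigma.pair_fst_snd _ _ _)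
  fst_sub {X Y} σ A B t := Tm.ext (ofTy_sub (X := X) (Y := Y) σ (C.rep.incl_sub σ A))
    (C.repSigma.fst_sub σ A B (toTerm t))
  snd_sub {X Y} σ A B t := Tm.ext (by
    refine Eq.trans ?_ (ofTy_sub (X := X) (Y := Y) σ (C.rep.incl_sub σ _))
    refine congrArg (fun P => ofTy (X := Y) (C.rep.incl P)) ?_
    refine (C.rep.sub_comp _ _ B).symm.trans (Eq.trans ?_ (C.rep.sub_comp _ _ B))
    exact congrArg (fun τ => C.rep.sub τ B) (CwF.inst_up (C := C.toCwF) _ _ σ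
      (C.rep.incl_sub σ A) (C.repSigma.fst_sub σ A B (toTerm t))))
    (C.repSigma.snd_sub σ A B (toTerm t))

/-- Realized `Π`-types. -/
@[reducible] def pi {X : Ctx C} (A : C.rep.Ty X.ctx) (B : Ty (ext (X := X) (ofTy (C.rep.incl A)))) :
    Ty X where
  ty := C.pi.pi A B.ty
  real := .lam (C.rep.sub (C.p _) A) (B.real.sub (C.pi.ev A B.ty))
  inj {Δ σ τ} h h' := by
    have e₁ : C.rep.sub (σ ≫ C.p _) A = C.rep.sub σ (C.rep.sub (C.p (C.pi.pi A B.ty)) A) :=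
      C.rep.sub_comp _ _ _
    have e₂ : C.rep.sub (σ ≫ C.p _) A = C.rep.sub τ (C.rep.sub (C.p (C.pi.pi A B.ty)) A) := by
      rw [h, C.rep.sub_comp]
    rw [Realizer.lam_sub _ _ _ e₁, Realizer.lam_sub _ _ _ e₂] at h'
    have h₁ := Realizer.lam_injective h'
    rw [← Realizer.sub_comp, ← Realizer.sub_comp] at h₁
    -- Faithfulness of `B` identifies the evaluations at the generic argument, and the `η`-rule
    -- turns this into equality of functions.
    refine C.pi.eq_of_up_ev h rfl (CwF.incl_eq_sub e₁) (CwF.incl_eq_sub e₂) ?_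
    rw [B.inj ?_ h₁]
    rw [Category.assoc, Category.assoc]
    refine (congrArg (CwF.up σ _ ≫ ·) (C.pi.ev_p A B.ty)).trans
      (Eq.trans ?_ (congrArg (CwF.up τ _ ≫ ·) (C.pi.ev_p A B.ty)).symm)
    exact CwF.hom_ext (by simp [h]) (by simp)

theorem pi_sub {X Y : Ctx C} (σ : Y.ctx ⟶ X.ctx) (A : C.rep.Ty X.ctx)
    (B : Ty (ext (X := X) (ofTy (C.rep.incl A)))) :
    (pi A B).sub σ = pi (X := Y) (C.rep.sub σ A)
      (B.sub (Y := ext (X := Y) (ofTy (C.rep.incl (C.rep.sub σ A))))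
        (CwF.up σ (C.rep.incl_sub σ A))) := by
  refine (Ty.eq_sub (C.pi.pi_congr rfl rfl) ?_).symm
  let B' := C.tySub (CwF.up σ (C.rep.incl_sub σ A)) B.ty
  have e : C.pi.pi (C.rep.sub σ A) B' = C.tySub σ (C.pi.pi A B.ty) := C.pi.pi_congr rfl rfl
  have e' : C.rep.sub (C.p (C.pi.pi (C.rep.sub σ A) B')) (C.rep.sub σ A) =
      C.rep.sub (CwF.up σ e) (C.rep.sub (C.p _) A) := by
    rw [← C.rep.sub_comp, ← C.rep.sub_comp, CwF.up_p]
  have key : CwF.up (CwF.up σ e) (CwF.incl_eq_sub e') ≫ C.pi.ev A B.ty =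
      C.pi.ev (C.rep.sub σ A) B' ≫ CwF.up (CwF.up σ (C.rep.incl_sub σ A)) rfl :=
    C.pi.up_up_ev rfl rfl _
  refine Eq.trans ?_ (Realizer.lam_sub _ _ _ e').symm
  change Realizer.lam _ ((B.real.sub _).sub _) = _
  rw [← Realizer.sub_comp, ← Realizer.sub_comp, key]

variable (C) in
/-- `Π`-types. -/
@[reducible] def piStr : CwF.PiStr (rep C) where
  pi A B := pi A B
  pi_sub σ A B := pi_sub σ A B
  lam A B :=
    { toFun := fun b => ofTerm (A := pi A B) (C.pi.lam A B.ty (toTerm b))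
      invFun := fun f => ofTerm ((C.pi.lam A B.ty).symm (toTerm f))
      left_inv := fun b => term_ext ((C.pi.lam A B.ty).symm_apply_apply (toTerm b))
      right_inv := fun f => term_ext ((C.pi.lam A B.ty).apply_symm_apply (toTerm f)) }
  lam_sub σ A B b := Tm.ext (pi_sub σ A B).symm (C.pi.lam_sub σ A B.ty (toTerm b))

variable (C) in
/-- The `(Σ, Π_rep)`-CwF of realized contexts and types. -/
@[reducible] def sigmaPiCwF : SigmaPiCwF.{u} where
  toCwF := cwf C
  rep := rep C
  unit := unit C
  sigma := sigma C
  repUnit := repUnit C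
  repSigma := repSigma C
  pi := piStr C

variable (C) in
/-- The morphism forgetting realizations, as a morphism of categories with families. -/
@[reducible] def forgetCwFHom : CwF.Hom (cwf C) C.toCwF where
  F := { obj := Ctx.ctx, map := fun f => f }
  ty := Ty.ty
  ty_sub _ _ := rfl
  tm := Tm.tm
  tm_sub _ _ := rfl
  typ_tm t := t.typ_tm
  obj_nil := rfl
  obj_ext _ := rfl
  map_p _ := (Category.id_comp _).symm
  tm_q _ := (C.tmSub_id _).symm

variable (C) in
/-- The morphism forgetting realizations. -/
@[reducible] def forget : SigmaPiCwF.Hom (sigmaPiCwF C) C where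
  toHom := forgetCwFHom C
  rep := { map := fun A => A, map_sub := fun _ _ => rfl, incl_map := fun _ => rfl }
  map_unit _ := rfl
  map_sigma :=
    { map_sig := fun A B => congrArg (C.sigma.sig A.ty) (C.tySub_id B.ty).symm
      map_fst := fun _ B _ => C.sigma.fst_congr (C.tySub_id B.ty) _ _ rfl
      map_snd := fun _ B _ => C.sigma.snd_congr (C.tySub_id B.ty) _ _ rfl }
  map_repUnit _ := rfl
  map_repSigma :=
    { map_sig := fun A B => congrArg (C.repSigma.sig A) (C.rep.sub_id B).symm
      map_fst := fun _ B _ => C.repSigma.fst_congr (C.rep.sub_id B) _ _ rfl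
      map_snd := fun _ B _ => C.repSigma.snd_congr (C.rep.sub_id B) _ _ rfl }
  map_pi :=
    { map_pi := fun A B => congrArg (C.pi.pi A) (C.tySub_id B.ty).symm
      map_lam := fun _ B _ => C.pi.lam_congr (C.tySub_id B.ty) _ _ (C.tmSub_id _) }

variable (C) in
-- Any type can be realized by its own terms, using `ofTy`, and a term of a realized type carries no
-- data beyond the term of `C`.
theorem isTrivialFibration_forget :
    IsTrivialFibration (show sigmaPiCwF C ⟶ C from forget C) where
  ty_surjective {X} A := ⟨ofTy (X := X) A, rfl⟩
  rep_surjective A := ⟨A, rfl⟩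
  bijective _ := ⟨fun _ _ h => term_ext (Subtype.ext (congrArg Subtype.val h)),
    fun t => ⟨ofTerm t, rfl⟩⟩

end Realized

end SigmaPiCwF

theorem CwF.Hom.inst_eqToHom {C D : CwF.{u}} (F : C.Hom D) {Γ : C.Ctx} {A : C.Ty Γ}
    (a : C.Term A) {B : D.Ty (F.F.obj Γ)} (hB : B = F.ty A) (b : D.Term B) (h : b.1 = F.tm a.1)
    (e : D.ext B = F.F.obj (C.ext A)) : CwF.inst b ≫ eqToHom e = F.F.map (CwF.inst a) := by
  subst hB
  rw [← cancel_mono (eqToHom (F.obj_ext A))]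
  refine CwF.hom_ext ?_ ?_
  · simp [← F.map_p, ← F.F.map_comp]
  · rw [D.tmSub_comp (F.F.map _), ← F.tm_q, ← F.tm_sub, CwF.inst_q, Category.assoc, eqToHom_trans,
      eqToHom_refl, Category.comp_id, CwF.inst_q, h]

/-- The type of a second projection depends only on the first projection. With the first projections
already compared, it remains to compare underlying terms and realizers of the second ones. -/
theorem CwF.SigmaStr.typ_map_snd {C D : CwF.{u}} {F : C.Hom D} {R : CwF.Restriction C}
    {S : CwF.Restriction D} (φ : CwF.RestrictionHom F R S) {U : CwF.SigmaStr R}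
    {V : CwF.SigmaStr S} {Γ : C.Ctx} {A : R.Ty Γ} {B : R.Ty (C.ext (R.incl A))}
    (t : C.Term (R.incl (U.sig A B)))
    (t' : D.Term (S.incl (V.sig (φ.map A) (S.sub (φ.extHom A) (φ.map B)))))
    (h : (V.fst _ _ t').1 = F.tm (U.fst A B t).1) :
    D.typ (V.snd _ _ t').1 = D.typ (F.tm (U.snd A B t).1) := by
  rw [(V.snd _ _ t').2, F.typ_tm, (U.snd A B t).2, ← φ.incl_map, φ.map_sub, ← S.sub_comp]
  congr 2
  exact F.inst_eqToHom _ (φ.incl_map A) _ h _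

namespace SigmaPiCwF

namespace Gluing

variable {C D : SigmaPiCwF.{u}} {F : SigmaPiCwF.Hom C D}

theorem Obj.ext' {X Y : Obj F} (h : X.base = Y.base)
    (h' : ∀ {Δ : C.Ctx} (g : F.F.obj Δ ⟶ X.base) (k : C.Realizer Δ),
      X.mem g k ↔ Y.mem (g ≫ eqToHom h) k) : X = Y := by
  obtain ⟨X, m, hm⟩ := X
  obtain ⟨Y, n, hn⟩ := Y
  dsimp only at h
  subst h
  have : @m = @n := by
    funext Δ g k
    simpa using h' g k
  subst this
  rfl

theorem eqToHom_base {X Y : Obj F} (h : X = Y) :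
    Hom.base (eqToHom h) = eqToHom (congrArg Obj.base h) := by
  subst h
  rfl

theorem eqToHom_real {X Y : Obj F} (h : X = Y) {Δ : C.Ctx} (g : F.F.obj Δ ⟶ X.base)
    (k : C.Realizer Δ) (hk : X.mem g k) : Hom.real (eqToHom h) g k hk = k := by
  subst h
  rfl

theorem Ty.sub_eqToHom_mem {X Y : Obj F} (h : Y = X) (A : Ty X) {Δ : C.Ctx}
    {g : F.F.obj Δ ⟶ Y.base} {k : C.Realizer Δ} {a : D.Tm (F.F.obj Δ)} {r : C.Realizer Δ} :
    (A.sub (eqToHom h)).mem g k a r ↔ A.mem (g ≫ eqToHom (congrArg Obj.base h)) k a r := by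
  subst h
  exact ⟨fun h => h.2, fun h => ⟨Y.mem_congr (Category.comp_id _) rfl (A.supp h), h⟩⟩

end Gluing

namespace Realized

variable {C D : SigmaPiCwF.{u}} (F : SigmaPiCwF.Hom C D)

/-! ### The morphism from realized contexts and types to the gluing -/

/-- The context of the gluing associated with a realized context. -/
@[reducible] def toObj (X : Ctx C) : Gluing.Obj F where
  base := F.F.obj X.ctx
  mem {Δ} g k := ∃ σ : Δ ⟶ X.ctx, F.F.map σ = g ∧ X.real.sub σ = k
  mem_sub := by
    rintro Δ Θ f g k ⟨σ, rfl, rfl⟩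
    exact ⟨f ≫ σ, F.F.map_comp _ _, Realizer.sub_comp _ _ _⟩

variable {F}

/-- The substitution named by an element of a realized context. -/
noncomputable def lift {X : Ctx C} {Δ : C.Ctx} {g : F.F.obj Δ ⟶ F.F.obj X.ctx}
    {k : C.Realizer Δ} (h : (toObj F X).mem g k) : Δ ⟶ X.ctx :=
  h.choose

section

variable {X Y : Ctx C} {Δ : C.Ctx} {g : F.F.obj Δ ⟶ F.F.obj X.ctx} {k : C.Realizer Δ}
  (h : (toObj F X).mem g k)

theorem map_lift : F.F.map (lift h) = g := h.choose_spec.1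

theorem real_lift : X.real.sub (lift h) = k := h.choose_spec.2

/-- Faithfulness of the realization makes the chosen substitution the unique one with the given
realizer, whatever its image under `F`. -/
theorem lift_eq {σ : Δ ⟶ X.ctx} (hσ : X.real.sub σ = k) : lift h = σ :=
  X.inj ((real_lift h).trans hσ.symm)

theorem lift_sub {Θ : C.Ctx} (f : Θ ⟶ Δ) : lift ((toObj F X).mem_sub f h) = f ≫ lift h :=
  lift_eq _ (by rw [Realizer.sub_comp, real_lift])

end

variable (F) in
/-- The substitution of the gluing associated with a substitution. -/
@[reducible] noncomputable def toHom {X Y : Ctx C} (τ : X.ctx ⟶ Y.ctx) : toObj F X ⟶ toObj F Y where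
  base := F.F.map τ
  real _ _ h := Y.real.sub (lift h ≫ τ)
  mem h := ⟨lift h ≫ τ, by rw [F.F.map_comp, map_lift], rfl⟩
  nat f g k h := by rw [lift_sub h, Category.assoc, Realizer.sub_comp _ f]

variable (F) in
/-- The type of the gluing associated with a realized type. -/
@[reducible] def toTy {X : Ctx C} (A : Ty X) : Gluing.Ty (toObj F X) where
  base := F.ty A.ty
  mem {Δ} g k a r := ∃ ρ : Δ ⟶ C.ext A.ty, F.F.map (ρ ≫ C.p _) = g ∧ X.real.sub (ρ ≫ C.p _) = k ∧
    F.tm (C.tmSub ρ (C.q _)) = a ∧ A.real.sub ρ = r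
  supp := by
    rintro Δ g k a r ⟨ρ, h, h', -⟩
    exact ⟨_, h, h'⟩
  typ := by
    rintro Δ g k a r ⟨ρ, rfl, rfl, rfl, rfl⟩
    rw [F.typ_tm, CwF.typ_sub_q, F.ty_sub]
  mem_sub := by
    rintro Δ Θ f g k a r ⟨ρ, rfl, rfl, rfl, rfl⟩
    refine ⟨f ≫ ρ, ?_, ?_, ?_, Realizer.sub_comp _ _ _⟩
    · rw [Category.assoc, F.F.map_comp]
    · rw [Category.assoc, Realizer.sub_comp]
    · rw [C.tmSub_comp, F.tm_sub]

/-- A term, as a term of its type. -/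
def Tm.term {X : Ctx C} (t : Tm X) : C.Term t.ty.ty := ⟨t.tm, t.typ_tm⟩

variable (F) in
/-- The term of the gluing associated with a term. -/
@[reducible] noncomputable def toTm {X : Ctx C} (t : Tm X) : Gluing.Tm (toObj F X) where
  ty := toTy F t.ty
  base := F.tm t.tm
  typ_base := by rw [F.typ_tm, t.typ_tm]
  real _ _ h := t.ty.real.sub (lift h ≫ CwF.inst t.term)
  mem {Δ g k} h := by
    refine ⟨lift h ≫ CwF.inst t.term, ?_, ?_, ?_, rfl⟩
    · rw [Category.assoc, CwF.inst_p, Category.comp_id, map_lift]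
    · rw [Category.assoc, CwF.inst_p, Category.comp_id, real_lift]
    · rw [C.tmSub_comp, CwF.inst_q, F.tm_sub, map_lift, Tm.term]
  nat f g k h := by rw [lift_sub h, Category.assoc, Realizer.sub_comp _ f]

/-- Elements of the substituted type are elements of `A` lying over a composite with `σ`.
Faithfulness of `X` recovers this factorization from realizers, and the pullback property gives the
element of the substituted type. -/
theorem toTy_sub {X Y : Ctx C} (σ : Y.ctx ⟶ X.ctx) (A : Ty X) :
    toTy F (A.sub σ) = (toTy F A).sub (toHom F σ) := by
  refine Gluing.Ty.ext' (F.ty_sub _ _) fun {Δ} g k a r => ?_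
  constructor
  · rintro ⟨ρ, rfl, rfl, rfl, rfl⟩
    have h : (toObj F Y).mem (F.F.map (ρ ≫ C.p _)) (Y.real.sub (ρ ≫ C.p _)) := ⟨_, rfl, rfl⟩
    have e : (ρ ≫ CwF.up σ rfl) ≫ C.p A.ty = (ρ ≫ C.p _) ≫ σ := by
      rw [Category.assoc, CwF.up_p, Category.assoc]
    refine ⟨h, ρ ≫ CwF.up σ rfl, ?_, ?_, ?_, Realizer.sub_comp _ _ _⟩
    · exact (congrArg F.F.map e).trans (F.F.map_comp _ _)
    · change _ = X.real.sub (lift h ≫ σ)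
      rw [lift_eq h rfl]
      exact congrArg _ e
    · rw [CwF.comp_up_q]
  · rintro ⟨h, ρ, -, h₂, rfl, rfl⟩
    have e : ρ ≫ C.p A.ty = lift h ≫ σ := X.inj h₂
    obtain ⟨ρ', hp, hq⟩ : ∃ ρ' : Δ ⟶ C.ext (C.tySub σ A.ty),
        ρ' ≫ C.p _ = lift h ∧ C.tmSub ρ' (C.q _) = C.tmSub ρ (C.q _) :=
      ⟨C.pair (lift h) _ (C.tmSub ρ (C.q _)) (by rw [CwF.typ_sub_q, e, C.tySub_comp]),
        C.pair_p _ _ _ _, C.pair_q _ _ _ _⟩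
    have e' : ρ' ≫ CwF.up σ rfl = ρ := by
      refine CwF.hom_ext ?_ ?_
      · rw [Category.assoc, CwF.up_p, ← Category.assoc, hp, e]
      · rw [CwF.comp_up_q, hq]
    refine ⟨ρ', (congrArg F.F.map hp).trans (map_lift h), (congrArg _ hp).trans (real_lift h),
      congrArg F.tm hq, ?_⟩
    exact (Realizer.sub_comp _ _ _).symm.trans (congrArg A.real.sub e')

theorem toTm_sub {X Y : Ctx C} (σ : Y.ctx ⟶ X.ctx) (t : Tm X) :
    toTm F (t.sub σ) = (toTm F t).sub (toHom F σ) :=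
  Gluing.Tm.ext (toTy_sub _ _) (F.tm_sub _ _) (by
    funext Δ g k h
    change (t.ty.real.sub (CwF.up σ rfl)).sub _ = t.ty.real.sub (lift _ ≫ _)
    rw [← Realizer.sub_comp, lift_eq (Gluing.Hom.mem (toHom F σ) h) rfl, Category.assoc,
      Category.assoc, CwF.inst_up (C := C.toCwF) t.term (t.sub σ).term σ rfl rfl])

/-- A realized extension is realized by pairs, and the glued extension asks for exactly such pairs.
Realizers thus make context extension preserved as an equality of objects. -/
theorem toObj_ext {X : Ctx C} (A : Ty X) : toObj F (ext A) = Gluing.ext (toTy F A) := by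
  refine Gluing.Obj.ext' (F.obj_ext A.ty) fun {Δ} g k => ?_
  have hp : (g ≫ eqToHom (F.obj_ext A.ty)) ≫ D.p (F.ty A.ty) = g ≫ F.F.map (C.p A.ty) := by
    rw [F.map_p, Category.assoc]
  have hq : D.tmSub (g ≫ eqToHom (F.obj_ext A.ty)) (D.q _) = D.tmSub g (F.tm (C.q A.ty)) := by
    rw [F.tm_q, D.tmSub_comp]
  constructor
  · rintro ⟨σ, rfl, rfl⟩
    refine ⟨_, _, Realizer.pair_sub _ _ _, σ, ?_, Realizer.sub_comp _ _ _, ?_, rfl⟩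
    · exact (F.F.map_comp _ _).trans hp.symm
    · exact (F.tm_sub _ _).trans hq.symm
  · rintro ⟨_, _, rfl, σ, h₁, rfl, h₃, rfl⟩
    refine ⟨σ, ?_, ?_⟩
    · rw [← cancel_mono (eqToHom (F.obj_ext A.ty))]
      refine CwF.hom_ext ?_ ?_
      · refine Eq.trans ?_ h₁
        rw [Category.assoc, ← F.map_p, F.F.map_comp]
      · refine Eq.trans ?_ h₃
        rw [D.tmSub_comp, ← F.tm_q, F.tm_sub]
    · rw [Realizer.pair_sub, ← Realizer.sub_comp]

theorem toObj_nil : toObj F (nil C) = Gluing.nil F := by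
  refine Gluing.Obj.ext' F.obj_nil fun {Δ} g k => ?_
  constructor
  · rintro ⟨σ, -, rfl⟩
    exact Realizer.unit_sub σ
  · rintro rfl
    refine ⟨C.nilIsTerminal.from Δ, ?_, Realizer.unit_sub _⟩
    rw [← cancel_mono (eqToHom F.obj_nil)]
    exact D.nilIsTerminal.hom_ext _ _

theorem toHom_p {X : Ctx C} (A : Ty X) :
    toHom F (X := ext A) (C.p A.ty) = eqToHom (toObj_ext A) ≫ Gluing.proj (toTy F A) :=
  Gluing.Hom.ext (by
    rw [Gluing.comp_base, Gluing.eqToHom_base]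
    exact F.map_p A.ty) (by
    funext Δ g k h
    have e := real_lift h
    rw [Realizer.pair_sub, ← Realizer.sub_comp] at e
    refine (congrArg Realizer.fst e).trans ?_
    exact congrArg Realizer.fst (Gluing.eqToHom_real (toObj_ext A) g k h).symm)

variable (F) in
/-- The morphism to the gluing, as a morphism of categories with families. -/
@[reducible] noncomputable def toCwFHom : CwF.Hom (cwf C) (Gluing.cwf F) where
  F :=
    { obj := toObj F
      map := fun τ => toHom F τ
      map_id := fun X => Gluing.Hom.ext (F.F.map_id _) (by
        funext Δ g k h
        exact (congrArg X.real.sub (Category.comp_id _)).trans (real_lift h))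
      map_comp := fun {X Y Z} τ υ => Gluing.Hom.ext (F.F.map_comp _ _) (by
        funext Δ g k h
        change Z.real.sub (lift h ≫ _ ≫ _) = Z.real.sub (lift (Gluing.Hom.mem (toHom F τ) h) ≫ _)
        rw [lift_eq (Gluing.Hom.mem (toHom F τ) h) rfl, Category.assoc]) }
  ty A := toTy F A
  ty_sub σ A := toTy_sub σ A
  tm t := toTm F t
  tm_sub σ t := toTm_sub σ t
  typ_tm _ := rfl
  obj_nil := toObj_nil
  obj_ext := toObj_ext
  map_p A := toHom_p A
  tm_q {X} A := Gluing.Tm.ext ((toTy_sub _ _).trans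
      ((congrArg (Gluing.Ty.sub · (toTy F A)) (toHom_p A)).trans (Gluing.Ty.sub_comp _ _ _)))
    ((F.tm_q A.ty).trans (congrArg (D.tmSub · _) (Gluing.eqToHom_base (toObj_ext A)).symm)) (by
      funext Δ g k h
      have e := real_lift h
      rw [Realizer.pair_sub] at e
      refine Eq.trans ?_ ((congrArg Realizer.snd e).trans
        (congrArg Realizer.snd (Gluing.eqToHom_real (toObj_ext A) g k h).symm))
      refine (Realizer.sub_comp _ _ _).symm.trans (congrArg A.real.sub ?_)
      refine CwF.hom_ext ?_ ?_
      · rw [Category.assoc, CwF.up_p, Category.assoc, CwF.inst_p_assoc]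
      · rw [CwF.comp_up_q, C.tmSub_comp, CwF.inst_q]
        rfl)

end Realized

/-! ### Strict preservation of `1`- and `Σ`-types by the morphism to the gluing -/

namespace Realized

variable {C D : SigmaPiCwF.{u}} {F : SigmaPiCwF.Hom C D}

/-- Every term of the `1`-type of `D` over `F(Δ)` is the image of the unique term of `C`, by
uniqueness in `D`. -/
theorem map_unit (X : Ctx C) : toTy F ((unit C).one X) = Gluing.one (toObj F X) := by
  refine Gluing.Ty.ext' (F.map_unit X.ctx) fun {Δ} g k a r => ?_
  have hF : F.ty (C.unit.one Δ) = D.unit.one (F.F.obj Δ) := F.map_unit Δ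
  constructor
  · rintro ⟨ρ, rfl, rfl, rfl, rfl⟩
    refine ⟨⟨_, rfl, rfl⟩, ?_, Realizer.unit_sub _⟩
    rw [F.typ_tm, CwF.typ_sub_q]
    exact (congrArg F.ty (C.unit.one_sub _)).trans hF
  · rintro ⟨⟨σ, rfl, rfl⟩, ha, rfl⟩
    let s : C.Term (C.unit.one Δ) := C.unit.star Δ
    obtain ⟨ρ, hp, hq⟩ : ∃ ρ : Δ ⟶ C.ext (C.unit.one X.ctx),
        ρ ≫ C.p _ = σ ∧ C.tmSub ρ (C.q _) = s.1 :=
      ⟨C.pair σ _ s.1 (s.2.trans (C.unit.one_sub σ).symm), C.pair_p _ _ _ _, C.pair_q _ _ _ _⟩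
    refine ⟨ρ, congrArg F.F.map hp, congrArg _ hp, ?_, Realizer.unit_sub _⟩
    refine (congrArg F.tm hq).trans ?_
    let a₁ : D.Term (D.unit.one (F.F.obj Δ)) := s.map F.toHom hF.symm
    let a₂ : D.Term (D.unit.one (F.F.obj Δ)) := ⟨a, ha⟩
    exact congrArg Subtype.val ((D.unit.star_uniq a₁).trans (D.unit.star_uniq a₂).symm)

section

variable {X : Ctx C} (A : Ty X) (B : Ty (ext A))

theorem extHom_base : Gluing.Hom.base ((toCwFHom F).all.extHom A) =
    F.toHom.all.extHom A.ty :=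
  Gluing.eqToHom_base (toObj_ext A).symm

/-- Elements on the left are maps of `C` into `Γ.(sig A B)`; on the right they are maps of `D` whose
image under `unpair` comes from a map of `C` into `Γ.A.B`. The two match because `unpair` is
invertible on elements in `C`, monic in `D` and preserved by `F`. -/
theorem map_sig : toTy F (sig A B) =
    Gluing.sig (toTy F A) ((toTy F B).sub ((toCwFHom F).all.extHom A)) := by
  refine Gluing.Ty.ext' ((F.map_sigma.map_sig A.ty B.ty).trans
    (congrArg (fun f => D.sigma.sig (F.ty A.ty) (D.tySub f (F.ty B.ty))) (extHom_base A).symm))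
    fun {Δ} g k a r => ?_
  have hbase := extHom_base (F := F) A
  set e : D.ext (F.ty A.ty) ⟶ F.F.obj (C.ext A.ty) :=
    Gluing.Hom.base ((toCwFHom F).all.extHom A) with he
  let B' : D.Ty (D.ext (F.ty A.ty)) := D.tySub e (F.ty B.ty)
  have hA : F.ty A.ty = D.tySub (𝟙 _) (F.ty A.ty) := (D.tySub_id _).symm
  -- The inverse of the identification `e`, in a form to which the universal property of context
  -- extension applies.
  let w : F.F.obj (C.ext A.ty) ⟶ D.ext (F.ty A.ty) := F.upMap (𝟙 _) hA
  have hw : w = eqToHom (F.obj_ext A.ty) := F.upMap_id hA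
  have hwe : w ≫ e = 𝟙 _ := by
    rw [hw, hbase, CwF.RestrictionHom.extHom, eqToHom_trans, eqToHom_refl]
  have hew : e ≫ w = 𝟙 _ := by
    rw [hw, hbase, CwF.RestrictionHom.extHom, eqToHom_trans, eqToHom_refl]
  have hB : F.ty B.ty = D.tySub w B' := by
    rw [← D.tySub_comp, hwe, D.tySub_id]
  have hS : F.ty (C.sigma.sig A.ty B.ty) = D.tySub (𝟙 _) (D.sigma.sig (F.ty A.ty) B') :=
    F.map_sigma.map_sig_eq (ρ := 𝟙 _) hA hB
  have key : F.upMap (𝟙 _) hS ≫ D.sigma.unpair (F.ty A.ty) B' =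
      F.F.map (C.sigma.unpair A.ty B.ty) ≫ F.upMap w hB :=
    F.map_sigma.map_unpair (ρ := 𝟙 _) hA hB
  have memB : ∀ {g k a r}, ((toTy F B).sub ((toCwFHom F).all.extHom A)).mem (Δ := Δ) g k a r ↔
      (toTy F B).mem (g ≫ e) k a r := by
    intro g k a r
    rw [he]
    have := Gluing.Ty.sub_eqToHom_mem (toObj_ext (F := F) A).symm (toTy F B) (Δ := Δ)
      (g := g) (k := k) (a := a) (r := r)
    rw [← Gluing.eqToHom_base] at this
    exact this
  have keyB : F.upMap w hB ≫ D.p B' ≫ e = F.F.map (C.p B.ty) := by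
    rw [F.upMap_p_assoc, hwe, Category.comp_id]
  constructor
  · rintro ⟨ρ, rfl, rfl, rfl, rfl⟩
    have keyρ : (F.F.map ρ ≫ F.upMap (𝟙 _) hS) ≫ D.sigma.unpair (F.ty A.ty) B' =
        F.F.map (ρ ≫ C.sigma.unpair A.ty B.ty) ≫ F.upMap w hB := by
      rw [Category.assoc, key, F.F.map_comp, Category.assoc]
    refine ⟨F.F.map ρ ≫ F.upMap (𝟙 _) hS, ?_, ?_, _, _, Realizer.pair_sub _ _ _,
      memB.2 ⟨ρ ≫ C.sigma.unpair A.ty B.ty, ?_, ?_, ?_, Realizer.sub_comp _ _ _⟩⟩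
    · refine (Category.assoc _ _ _).trans ?_
      refine (congrArg (F.F.map ρ ≫ ·) (F.upMap_p _ hS)).trans ?_
      rw [Category.comp_id, F.F.map_comp]
    · exact (F.comp_upMap_q _ hS _).trans (F.tm_sub _ _).symm
    · have : F.F.map ((ρ ≫ C.sigma.unpair A.ty B.ty) ≫ C.p B.ty) =
          ((F.F.map ρ ≫ F.upMap (𝟙 _) hS) ≫ D.sigma.unpair (F.ty A.ty) B' ≫ D.p B') ≫ e := by
        rw [← Category.assoc (F.F.map ρ ≫ _), keyρ, F.F.map_comp _ (C.p _), Category.assoc,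
          Category.assoc, keyB]
      exact this
    · rw [Realizer.pair_sub, ← Realizer.sub_comp, ← Realizer.sub_comp]
      refine congrArg₂ Realizer.pair (congrArg X.real.sub ?_) (congrArg A.real.sub ?_)
      · rw [Category.assoc, Category.assoc]
        exact congrArg (ρ ≫ ·) (C.sigma.unpair_p_p A.ty B.ty)
      · exact Category.assoc _ _ _
    · have : F.tm (C.tmSub (ρ ≫ C.sigma.unpair A.ty B.ty) (C.q B.ty)) = D.tmSub
          ((F.F.map ρ ≫ F.upMap (𝟙 _) hS) ≫ D.sigma.unpair (F.ty A.ty) B') (D.q B') := by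
        rw [keyρ, F.comp_upMap_q, F.tm_sub]
      exact this
  · rintro ⟨ρ, hp, hq, r₁, r₂, rfl, h⟩
    obtain ⟨ρ₂, h₁, h₂, h₃, rfl⟩ := memB.1 h
    rw [Realizer.pair_sub, ← Realizer.sub_comp] at h₂
    obtain ⟨rfl, rfl⟩ := Realizer.pair.inj h₂
    -- The pair of components found in `C` is assembled into an element of the `Σ`-type of `C`; `e₀`
    -- then checks that its image is the given element of `D`.
    obtain ⟨ρ₀, rfl⟩ := C.sigma.exists_unpair_eq (A := A.ty) (B := B.ty) ρ₂
    have keyρ : (F.F.map ρ₀ ≫ F.upMap (𝟙 _) hS) ≫ D.sigma.unpair (F.ty A.ty) B' =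
        F.F.map (ρ₀ ≫ C.sigma.unpair A.ty B.ty) ≫ F.upMap w hB := by
      rw [Category.assoc, key, F.F.map_comp, Category.assoc]
    have h₁' : F.F.map ((ρ₀ ≫ C.sigma.unpair A.ty B.ty) ≫ C.p B.ty) =
      (ρ ≫ D.sigma.unpair (F.ty A.ty) B' ≫ D.p B') ≫ e := h₁
    have h₃' : F.tm (C.tmSub (ρ₀ ≫ C.sigma.unpair A.ty B.ty) (C.q B.ty)) =
      D.tmSub (ρ ≫ D.sigma.unpair (F.ty A.ty) B') (D.q B') := h₃
    have e₀ : F.F.map ρ₀ ≫ F.upMap (𝟙 _) hS = ρ := by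
      refine (cancel_mono (D.sigma.unpair (F.ty A.ty) B')).1 ?_
      rw [keyρ]
      refine CwF.hom_ext ?_ ?_
      · have := congrArg (· ≫ w) h₁'
        simp only [Category.assoc, hew, Category.comp_id, F.F.map_comp] at this
        rw [Category.assoc, F.upMap_p, Category.assoc, F.F.map_comp, Category.assoc]
        exact this
      · rw [F.comp_upMap_q, ← F.tm_sub]
        exact h₃'
    have hpp : (ρ₀ ≫ C.sigma.unpair A.ty B.ty) ≫ C.p B.ty ≫ C.p A.ty = ρ₀ ≫ C.p _ := by
      rw [Category.assoc]
      exact congrArg (ρ₀ ≫ ·) (C.sigma.unpair_p_p A.ty B.ty)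
    refine ⟨ρ₀, ?_, ?_, ?_, ?_⟩
    · refine Eq.trans ?_ hp
      rw [← e₀, F.F.map_comp]
      refine Eq.trans ?_ (Category.assoc _ _ _).symm
      refine congrArg (F.F.map ρ₀ ≫ ·) ?_
      exact ((F.upMap_p _ hS).trans (Category.comp_id _)).symm
    · exact congrArg X.real.sub (hpp.symm.trans (Category.assoc _ _ _).symm)
    · refine Eq.trans ?_ hq
      rw [← e₀]
      exact (F.tm_sub _ _).trans (F.comp_upMap_q _ hS _).symm
    · rw [Realizer.pair_sub, ← Realizer.sub_comp, ← Realizer.sub_comp, ← Category.assoc]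

/-- The term `t'` is kept as a variable equal to the image of `t`, so that its proof of typing,
which involves the comparison of `Σ`-types, never has to be unfolded. -/
theorem map_fst (t : CwF.Term (cwf C) (Γ := X) (sig A B))
    (t' : CwF.Term (Gluing.cwf F) (Γ := toObj F X)
      (Gluing.sig (toTy F A) ((toTy F B).sub ((toCwFHom F).all.extHom A))))
    (ht : t'.1 = toTm F t.1) :
    (Gluing.fst t').1 = toTm F ((sigma C).fst A B t).1 := by
  refine Gluing.Tm.ext rfl ?_ ?_
  · refine Eq.trans ?_ (F.map_sigma.map_fst A.ty B.ty (toTerm t))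
    exact D.sigma.fst_congr (congrArg (fun f => D.tySub f (F.ty B.ty)) (extHom_base A)) _ _
      (congrArg Gluing.Tm.base ht)
  · funext Δ g k h
    obtain ⟨⟨ty, t, htm⟩, hty⟩ := t
    obtain ⟨t', ht'⟩ := t'
    have hty' : ty = sig A B := hty
    subst hty'
    have ht'' : t' = toTm F ⟨_, t, htm⟩ := ht
    subst ht''
    change Realizer.fst (Gluing.Tm.real (toTm F ⟨sig A B, t, htm⟩) g k h) = _
    change Realizer.fst (Realizer.sub (sig A B).real
      (lift h ≫ CwF.inst (Tm.term ⟨sig A B, t, htm⟩))) = _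
    change Realizer.fst (Realizer.sub (Realizer.pair _ _)
      (lift h ≫ CwF.inst (Tm.term ⟨sig A B, t, htm⟩))) = _
    rw [Realizer.pair_sub, Realizer.fst_pair]
    refine (Realizer.sub_comp _ _ _).symm.trans (congrArg A.real.sub ?_)
    refine (Category.assoc _ _ _).trans (congrArg (lift h ≫ ·) ?_)
    exact C.sigma.fst_inst_unpair (A := A.ty) (B := B.ty) (Tm.term ⟨sig A B, t, htm⟩)

theorem map_snd (t : CwF.Term (cwf C) (Γ := X) (sig A B))
    (t' : CwF.Term (Gluing.cwf F) (Γ := toObj F X)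
      (Gluing.sig (toTy F A) ((toTy F B).sub ((toCwFHom F).all.extHom A))))
    (ht : t'.1 = toTm F t.1) :
    (Gluing.snd t').1 = toTm F ((sigma C).snd A B t).1 := by
  refine Gluing.Tm.ext ?_ ?_ ?_
  · exact CwF.SigmaStr.typ_map_snd (toCwFHom F).all (U := sigma C) (V := Gluing.sigma F)
      (A := A) (B := B) t t' (map_fst A B t t' ht)
  · refine Eq.trans ?_ (F.map_sigma.map_snd A.ty B.ty (toTerm t))
    exact D.sigma.snd_congr (congrArg (fun f => D.tySub f (F.ty B.ty)) (extHom_base A)) _ _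
      (congrArg Gluing.Tm.base ht)
  · funext Δ g k h
    obtain ⟨⟨ty, t, htm⟩, hty⟩ := t
    obtain ⟨t', ht'⟩ := t'
    have hty' : ty = sig A B := hty
    subst hty'
    have ht'' : t' = toTm F ⟨_, t, htm⟩ := ht
    subst ht''
    change Realizer.snd (Gluing.Tm.real (toTm F ⟨sig A B, t, htm⟩) g k h) = _
    change Realizer.snd (Realizer.sub (sig A B).real
      (lift h ≫ CwF.inst (Tm.term ⟨sig A B, t, htm⟩))) = _
    change Realizer.snd (Realizer.sub (Realizer.pair _ _)
      (lift h ≫ CwF.inst (Tm.term ⟨sig A B, t, htm⟩))) = _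
    rw [Realizer.pair_sub, Realizer.snd_pair]
    refine (Realizer.sub_comp _ _ _).symm.trans (Eq.trans ?_ (Realizer.sub_comp _ _ _))
    refine congrArg B.real.sub ?_
    refine (Category.assoc _ _ _).trans (Eq.trans (congrArg (lift h ≫ ·) ?_)
      (Category.assoc _ _ _).symm)
    let s : C.Term (C.sigma.sig A.ty B.ty) := Tm.term ⟨sig A B, t, htm⟩
    have h₁ : CwF.inst s ≫ C.sigma.unpair A.ty B.ty ≫ C.p _ =
      CwF.inst (C.sigma.fst A.ty B.ty s) := C.sigma.fst_inst_unpair s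
    have h₂ : C.tmSub (CwF.inst s ≫ C.sigma.unpair A.ty B.ty) (C.q _) =
      (C.sigma.snd A.ty B.ty s).1 := C.sigma.snd_inst_unpair s
    -- Instantiating at `s` and unpairing lands at the point `⟨fst s, snd s⟩` of `Γ.A.B`, where the
    -- realization of `B` is evaluated.
    have : CwF.inst s ≫ C.sigma.unpair A.ty B.ty = CwF.inst (C.sigma.snd A.ty B.ty s) ≫
        CwF.up (CwF.inst (C.sigma.fst A.ty B.ty s)) rfl := by
      refine CwF.hom_ext ?_ ?_
      · rw [Category.assoc, Category.assoc, CwF.up_p, CwF.inst_p_assoc]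
        exact h₁
      · rw [CwF.comp_up_q, CwF.inst_q]
        exact h₂
    exact this

theorem sigma_preserved : (sigma C).Preserved (toCwFHom F).all (Gluing.sigma F) where
  map_sig A B := map_sig A B
  map_fst A B t := map_fst A B t _ rfl
  map_snd A B t := map_snd A B t _ rfl

end

end Realized

end SigmaPiCwF

/-! ### Comparison of extended contexts along the identity base -/

namespace CwF

variable {C D : CwF.{u}} {F : C.Hom D} {R : Restriction C} {S : Restriction D}

theorem Hom.upMap_congr (F : C.Hom D) {Γ : C.Ctx} {Γ' : D.Ctx} {ρ ρ' : F.F.obj Γ ⟶ Γ'}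
    (e : ρ = ρ') {A : C.Ty Γ} {A' : D.Ty Γ'} (h : F.ty A = D.tySub ρ A')
    (h' : F.ty A = D.tySub ρ' A') : F.upMap ρ h = F.upMap ρ' h' := by
  subst e
  rfl

theorem RestrictionHom.extHom_upMap_id (φ : RestrictionHom F R S) {Γ : C.Ctx} (A : R.Ty Γ)
    (h : F.ty (R.incl A) = D.tySub (𝟙 _) (S.incl (φ.map A))) :
    φ.extHom A ≫ F.upMap (𝟙 _) h = 𝟙 _ := by
  rw [φ.extHom_upMap, up_id]

theorem RestrictionHom.upMap_id_extHom (φ : RestrictionHom F R S) {Γ : C.Ctx} (A : R.Ty Γ)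
    (h : F.ty (R.incl A) = D.tySub (𝟙 _) (S.incl (φ.map A))) :
    F.upMap (𝟙 _) h ≫ φ.extHom A = 𝟙 _ := by
  have : IsIso (φ.extHom A) := by
    unfold RestrictionHom.extHom
    infer_instance
  rw [← cancel_epi (φ.extHom A), ← Category.assoc, φ.extHom_upMap_id, Category.id_comp,
    Category.comp_id]

end CwF

namespace SigmaPiCwF

/-! ### Strict preservation of representable types and their `1`- and `Σ`-types -/

namespace Realized

variable {C D : SigmaPiCwF.{u}} {F : SigmaPiCwF.Hom C D}

variable (F) in
/-- The representable type of the gluing associated with a representable type. -/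
@[reducible] noncomputable def toRep {X : Ctx C} (A : C.rep.Ty X.ctx) :
    Gluing.RepTy (toObj F X) where
  base := F.rep.map A
  fam _ _ h := C.rep.sub (lift h) A
  map_fam h := by rw [F.rep.map_sub, map_lift]
  nat f g k h := by rw [lift_sub h, C.rep.sub_comp]

/-- Both relations say that the element is the image of a term of the substituted type, realized by
that term. The substitution is `lift h` on one side and part of the data on the other; they agree by
faithfulness. -/
theorem toRep_incl {X : Ctx C} (A : C.rep.Ty X.ctx) :
    (toRep F (X := X) A).incl = toTy F (ofTy (X := X) (C.rep.incl A)) := by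
  refine Gluing.Ty.ext' (F.rep.incl_map A) fun {Δ} g k a r => ?_
  constructor
  · rintro ⟨h, t, rfl, rfl⟩
    have e : C.typ t.1 = C.tySub (lift h) (C.rep.incl A) := t.2.trans (C.rep.incl_sub _ _)
    refine ⟨C.pair (lift h) _ t.1 e, ?_, ?_, ?_, ?_⟩
    · rw [C.pair_p, map_lift]
    · rw [C.pair_p, real_lift]
    · rw [C.pair_q]
    · rw [Realizer.tm_sub, C.pair_q]
  · rintro ⟨ρ, rfl, rfl, rfl, rfl⟩
    have h : (toObj F X).mem (F.F.map (ρ ≫ C.p _)) (X.real.sub (ρ ≫ C.p _)) := ⟨_, rfl, rfl⟩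
    refine ⟨h, ⟨C.tmSub ρ (C.q _), ?_⟩, rfl, Realizer.tm_sub _ _⟩
    rw [CwF.typ_sub_q, C.rep.incl_sub, lift_eq h rfl]

variable (F) in
/-- The action on representable types of the morphism to the gluing. -/
@[reducible] noncomputable def toRepHom : CwF.RestrictionHom (toCwFHom F) (rep C)
    (Gluing.rep F) where
  map {X} A := toRep F (X := X) A
  map_sub σ A := Gluing.RepTy.ext (F.rep.map_sub _ _) (by
    funext Δ g k h
    change C.rep.sub (lift h) (C.rep.sub σ A) = C.rep.sub (lift (Gluing.Hom.mem (toHom F σ) h)) A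
    rw [lift_eq (Gluing.Hom.mem (toHom F σ) h) rfl, C.rep.sub_comp])
  incl_map {X} A := toRep_incl (X := X) A

theorem repUnit_preserved : (repUnit C).Preserved (toRepHom F) (Gluing.repUnit F) := fun X =>
  Gluing.RepTy.ext (F.map_repUnit X.ctx) (by
    funext Δ g k h
    exact C.repUnit.one_sub _)

section

variable {X : Ctx C} (A : C.rep.Ty X.ctx)

theorem rep_ext_eq : Gluing.ext (toRep F (X := X) A).incl =
    toObj F (ext (X := X) (ofTy (C.rep.incl A))) := by
  rw [toObj_ext, toRep_incl]

theorem rep_extHom_base : Gluing.Hom.base ((toRepHom F).extHom (Γ := X) A) = F.rep.extHom A :=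
  Gluing.eqToHom_base (rep_ext_eq A)

/-- The generic element of the glued type is, after comparing contexts, the image of an actual
substitution of `C`; `ext_real_sub_up` gives the matching statement for realizers. Hence `lift`
computes at generic elements. -/
theorem genMap_extHom {Δ : C.Ctx} {g : F.F.obj Δ ⟶ F.F.obj X.ctx} {k : C.Realizer Δ}
    (h : (toObj F X).mem g k) :
    Gluing.genMap (toRep F (X := X) A) g k h ≫ F.rep.extHom A =
      F.F.map (CwF.up (lift h) (C.rep.incl_sub _ A)) := by
  have e : F.ty (C.rep.incl A) = D.tySub (𝟙 _) (D.rep.incl (F.rep.map A)) := by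
    rw [D.tySub_id, F.rep.incl_map]
  have h₁ : Gluing.genMap (toRep F (X := X) A) g k h =
      F.F.map (CwF.up (lift h) (C.rep.incl_sub _ A)) ≫ F.upMap (𝟙 _) e := by
    rw [F.map_up_upMap]
    exact F.upMap_congr ((map_lift h).symm.trans (Category.comp_id _).symm) _ _
  rw [h₁, Category.assoc, F.rep.upMap_id_extHom, Category.comp_id]

theorem ext_real_sub_up {Δ : C.Ctx} {g : F.F.obj Δ ⟶ F.F.obj X.ctx} {k : C.Realizer Δ}
    (h : (toObj F X).mem g k) :
    (ext (X := X) (ofTy (C.rep.incl A))).real.sub (CwF.up (lift h) (C.rep.incl_sub _ A)) =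
      Gluing.genReal (toRep F (X := X) A) g k h := by
  rw [Realizer.pair_sub, Realizer.tm_sub, ← Realizer.sub_comp, CwF.up_q, CwF.up_p,
    Realizer.sub_comp, real_lift]

variable (B : C.rep.Ty (C.ext (C.rep.incl A)))

theorem genFam_toRep {Δ : C.Ctx} {g : F.F.obj Δ ⟶ F.F.obj X.ctx} {k : C.Realizer Δ}
    (h : (toObj F X).mem g k) :
    Gluing.genFam (toRep F (X := X) A) (Gluing.RepTy.sub ((toRepHom F).extHom (Γ := X) A)
      (toRep F (X := ext (X := X) (ofTy (C.rep.incl A))) B)) g k h =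
      C.rep.sub (CwF.up (lift h) (C.rep.incl_sub _ A)) B := by
  refine congrArg (C.rep.sub · B) (lift_eq _ ((ext_real_sub_up A h).trans ?_))
  exact (Gluing.eqToHom_real (rep_ext_eq A) _ _ _).symm

theorem map_repSig : toRep F (X := X) (C.repSigma.sig A B) =
    Gluing.repSig (toRep F (X := X) A) (Gluing.RepTy.sub ((toRepHom F).extHom (Γ := X) A)
      (toRep F (X := ext (X := X) (ofTy (C.rep.incl A))) B)) := by
  refine Gluing.RepTy.ext ((F.map_repSigma.map_sig A B).trans
    (congrArg (fun f => D.repSigma.sig (F.rep.map A) (D.rep.sub f (F.rep.map B)))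
      (rep_extHom_base A).symm)) ?_
  funext Δ g k h
  exact (C.repSigma.sig_sub _ A B).trans
    (congrArg (C.repSigma.sig _) (genFam_toRep A B h).symm)

variable {A B} in
-- The realizer of the image is the substituted term itself, and `val` is determined by the
-- realizer.
theorem val_toTm (t : CwF.Term (cwf C) (Γ := X) (ofTy (C.rep.incl A))) {A' :
    Gluing.RepTy (toObj F X)}
    (t' : CwF.Term (Gluing.cwf F) (Γ := toObj F X) A'.incl)
    (ht : t'.1 = toTm F t.1) {Δ : C.Ctx} {g : F.F.obj Δ ⟶ F.F.obj X.ctx} {k : C.Realizer Δ}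
    (h : (toObj F X).mem g k) : (Gluing.val t' g k h).1 = C.tmSub (lift h) (toTerm t).1 := by
  obtain ⟨⟨ty, t, htm⟩, hty⟩ := t
  obtain ⟨t', ht'⟩ := t'
  have hty' : ty = ofTy (C.rep.incl A) := hty
  subst hty'
  have ht'' : t' = toTm F ⟨_, t, htm⟩ := ht
  subst ht''
  refine Realizer.tm.inj ((Gluing.real_eq_val _ h).symm.trans ((Realizer.tm_sub _ _).trans ?_))
  refine congrArg Realizer.tm ((C.tmSub_comp _ _ _).trans (congrArg (C.tmSub _) ?_))
  exact CwF.inst_q _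

theorem map_repFst (t : CwF.Term (cwf C) (Γ := X) (ofTy (C.rep.incl (C.repSigma.sig A B))))
    (t' : CwF.Term (Gluing.cwf F) (Γ := toObj F X)
      (Gluing.repSig (toRep F (X := X) A) (Gluing.RepTy.sub ((toRepHom F).extHom (Γ := X) A)
      (toRep F (X := ext (X := X) (ofTy (C.rep.incl A))) B))).incl)
    (ht : t'.1 = toTm F t.1) :
    (Gluing.repFst t').1 = toTm F ((repSigma C).fst (Γ := X) A B t).1 := by
  refine Gluing.Tm.ext (toRep_incl A) ?_ ?_
  · refine Eq.trans ?_ (F.map_repSigma.map_fst A B (toTerm t))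
    exact D.repSigma.fst_congr (congrArg (fun f => D.rep.sub f (F.rep.map B)) (rep_extHom_base A))
      _ _ (congrArg Gluing.Tm.base ht)
  · funext Δ g k h
    refine Eq.trans ?_ (Realizer.tm_sub _ _).symm
    refine congrArg Realizer.tm (Eq.trans ?_ ((C.tmSub_comp _ _ _).trans
      (congrArg (C.tmSub (lift h)) (CwF.inst_q _))).symm)
    refine Eq.trans ?_ (C.repSigma.fst_sub (lift h) A B (toTerm t))
    exact C.repSigma.fst_congr (genFam_toRep A B h) _ _ (val_toTm t t' ht h)

theorem map_repSnd (t : CwF.Term (cwf C) (Γ := X) (ofTy (C.rep.incl (C.repSigma.sig A B))))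
    (t' : CwF.Term (Gluing.cwf F) (Γ := toObj F X)
      (Gluing.repSig (toRep F (X := X) A) (Gluing.RepTy.sub ((toRepHom F).extHom (Γ := X) A)
      (toRep F (X := ext (X := X) (ofTy (C.rep.incl A))) B))).incl)
    (ht : t'.1 = toTm F t.1) :
    (Gluing.repSnd t').1 = toTm F ((repSigma C).snd (Γ := X) A B t).1 := by
  refine Gluing.Tm.ext ?_ ?_ ?_
  · exact CwF.SigmaStr.typ_map_snd (toRepHom F) (U := repSigma C) (V := Gluing.repSigma F) (Γ := X)
      (A := A) (B := B) t t' (map_repFst A B t t' ht)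
  · refine Eq.trans ?_ (F.map_repSigma.map_snd A B (toTerm t))
    exact D.repSigma.snd_congr (congrArg (fun f => D.rep.sub f (F.rep.map B)) (rep_extHom_base A))
      _ _ (congrArg Gluing.Tm.base ht)
  · funext Δ g k h
    refine Eq.trans ?_ (Realizer.tm_sub _ _).symm
    refine congrArg Realizer.tm (Eq.trans ?_ ((C.tmSub_comp _ _ _).trans
      (congrArg (C.tmSub (lift h)) (CwF.inst_q _))).symm)
    refine Eq.trans ?_ (C.repSigma.snd_sub (lift h) A B (toTerm t))
    exact C.repSigma.snd_congr (genFam_toRep A B h) _ _ (val_toTm t t' ht h)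

end

theorem repSigma_preserved : (repSigma C).Preserved (toRepHom F) (Gluing.repSigma F) where
  map_sig A B := map_repSig A B
  map_fst A B t := map_repFst A B t _ rfl
  map_snd A B t := map_repSnd A B t _ rfl

end Realized

/-! ### Strict preservation of `Π`-types -/

namespace Realized

variable {C D : SigmaPiCwF.{u}} {F : SigmaPiCwF.Hom C D}

section

variable {X : Ctx C} (A : C.rep.Ty X.ctx) (B : Ty (ext (X := X) (ofTy (C.rep.incl A))))

theorem sub_extHom_mem {Δ : C.Ctx} {g : F.F.obj Δ ⟶ D.ext (D.rep.incl (F.rep.map A))}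
    {k : C.Realizer Δ} {a : D.Tm (F.F.obj Δ)} {r : C.Realizer Δ} :
    (Gluing.Ty.sub ((toRepHom F).extHom (Γ := X) A) (toTy F B)).mem g k a r ↔
      (toTy F B).mem (g ≫ F.rep.extHom A) k a r := by
  have := Gluing.Ty.sub_eqToHom_mem (rep_ext_eq (F := F) A) (toTy F B) (Δ := Δ)
    (g := g) (k := k) (a := a) (r := r)
  rw [← Gluing.eqToHom_base] at this
  rw [← rep_extHom_base]
  exact this

/-- A function in `C` amounts to its body at the generic argument, and the glued `Π`-type asks that
the evaluation in `D` at the generic argument be the image of such a body. Abstraction in `C` and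
the `η`-rule in `D` give the converse passage. -/
theorem map_pi : toTy F (pi A B) =
    Gluing.pi (toRep F (X := X) A)
      (Gluing.Ty.sub ((toRepHom F).extHom (Γ := X) A) (toTy F B)) := by
  refine Gluing.Ty.ext' ((F.map_pi.map_pi A B.ty).trans
    (congrArg (fun f => D.pi.pi (F.rep.map A) (D.tySub f (F.ty B.ty))) (rep_extHom_base A).symm))
    fun {Δ} g k a r => ?_
  have hbase := rep_extHom_base (F := F) A
  set e : D.ext (D.rep.incl (F.rep.map A)) ⟶ F.F.obj (C.ext (C.rep.incl A)) :=
    Gluing.Hom.base ((toRepHom F).extHom (Γ := X) A) with he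
  let B' : D.Ty (D.ext (D.rep.incl (F.rep.map A))) := D.tySub e (F.ty B.ty)
  have hA : F.rep.map A = D.rep.sub (𝟙 _) (F.rep.map A) := (D.rep.sub_id _).symm
  let w : F.F.obj (C.ext (C.rep.incl A)) ⟶ D.ext (D.rep.incl (F.rep.map A)) :=
    F.upMap (𝟙 _) (F.rep.map_incl hA)
  have hwe : w ≫ e = 𝟙 _ := by
    rw [hbase]
    exact F.rep.upMap_id_extHom A _
  have hB : F.ty B.ty = D.tySub w B' := by
    rw [← D.tySub_comp, hwe, D.tySub_id]
  have hS : F.ty (C.pi.pi A B.ty) = D.tySub (𝟙 _) (D.pi.pi (F.rep.map A) B') :=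
    F.map_pi.map_pi_eq (ρ := 𝟙 _) hA hB
  let u := F.upMap (𝟙 _) hS
  have hu : ∀ ρ : Δ ⟶ C.ext (C.pi.pi A B.ty), (F.F.map ρ ≫ u) ≫ D.p _ = F.F.map (ρ ≫ C.p _) := by
    intro ρ
    rw [Category.assoc, F.upMap_p, Category.comp_id, F.F.map_comp]
  have hq : ∀ ρ : Δ ⟶ C.ext (C.pi.pi A B.ty), D.tmSub (F.F.map ρ ≫ u) (D.q _) =
      F.tm (C.tmSub ρ (C.q _)) := by
    intro ρ
    rw [F.comp_upMap_q, F.tm_sub]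
  have hAp : F.ty (C.rep.incl (C.rep.sub (C.p (C.pi.pi A B.ty)) A)) =
      D.tySub u (D.rep.incl (D.rep.sub (D.p (D.pi.pi (F.rep.map A) B')) (F.rep.map A))) := by
    refine F.rep.map_incl ?_
    rw [F.rep.map_sub, ← D.rep.sub_comp, F.upMap_p, Category.comp_id]
  have key : ∀ (ρ : Δ ⟶ C.ext (C.pi.pi A B.ty)) (A₁ : C.rep.Ty Δ)
      (h₁ : A₁ = C.rep.sub ρ (C.rep.sub (C.p _) A))
      (h₂ : F.ty (C.rep.incl A₁) = D.tySub (F.F.map ρ ≫ u)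
        (D.rep.incl (D.rep.sub (D.p (D.pi.pi (F.rep.map A) B')) (F.rep.map A)))),
      D.tmSub (F.upMap (F.F.map ρ ≫ u) h₂ ≫ D.pi.ev (F.rep.map A) B') (D.q _) =
        F.tm (C.tmSub (CwF.up ρ (CwF.incl_eq_sub h₁) ≫ C.pi.ev A B.ty) (C.q _)) := by
    intro ρ A₁ h₁ h₂
    rw [← F.map_up_upMap ρ u hAp (CwF.incl_eq_sub h₁), Category.assoc,
      F.map_pi.map_ev (ρ := 𝟙 _) hA hB hAp, ← F.F.map_comp_assoc, F.comp_upMap_q, F.tm_sub]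
  have hev : ∀ {σ : Δ ⟶ X.ctx} (ρ : Δ ⟶ C.ext (C.pi.pi A B.ty)) (_ : ρ ≫ C.p _ = σ)
      (h₁ : C.rep.sub σ A = C.rep.sub ρ (C.rep.sub (C.p _) A)),
      (CwF.up ρ (CwF.incl_eq_sub h₁) ≫ C.pi.ev A B.ty) ≫ C.p B.ty =
        CwF.up σ (C.rep.incl_sub σ A) := by
    rintro _ ρ rfl h₁
    rw [Category.assoc]
    refine (congrArg (CwF.up ρ _ ≫ ·) (C.pi.ev_p A B.ty)).trans ?_
    refine CwF.hom_ext ?_ ?_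
    · rw [Category.assoc, CwF.up_p, CwF.up_p_assoc, CwF.up_p]
    · rw [CwF.comp_up_q, CwF.up_q, CwF.up_q]
  constructor
  · rintro ⟨ρ, rfl, rfl, rfl, rfl⟩
    have h : (toObj F X).mem (F.F.map (ρ ≫ C.p _)) (X.real.sub (ρ ≫ C.p _)) := ⟨_, rfl, rfl⟩
    have hl : lift h = ρ ≫ C.p _ := lift_eq h rfl
    have h₁ : C.rep.sub (lift h) A = C.rep.sub ρ (C.rep.sub (C.p _) A) := by
      rw [hl, C.rep.sub_comp]
    refine ⟨h, F.F.map ρ ≫ u, hu ρ, hq ρ,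
        B.real.sub (CwF.up ρ (CwF.incl_eq_sub h₁) ≫ C.pi.ev A B.ty),
      ?_, (sub_extHom_mem A B).2 ⟨CwF.up ρ (CwF.incl_eq_sub h₁) ≫ C.pi.ev A B.ty, ?_, ?_, ?_, rfl⟩⟩
    · refine (Realizer.lam_sub _ _ _ h₁).trans ?_
      exact congrArg (Realizer.lam _) (Realizer.sub_comp _ _ _).symm
    · exact (congrArg F.F.map (hev ρ hl.symm h₁)).trans (genMap_extHom A h).symm
    · exact (congrArg _ (hev ρ hl.symm h₁)).trans (ext_real_sub_up A h)
    · exact (key ρ _ h₁ _).symm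
  · rintro ⟨h, ρ', hρ', rfl, r', rfl, h'⟩
    obtain ⟨ρ₂, -, h₂, h₃, rfl⟩ := (sub_extHom_mem A B).1 h'
    -- The realizer of the generic element pins down the base of `ρ₂`, by faithfulness of the
    -- extended context. So `ρ₂` is a body over `Δ.A₁` and can be abstracted to a function `f` of
    -- `C`.
    have hρ₂ : ρ₂ ≫ C.p B.ty = CwF.up (lift h) (C.rep.incl_sub _ A) :=
      (ext (X := X) (ofTy (C.rep.incl A))).inj (h₂.trans (ext_real_sub_up A h).symm)
    let A₁ := C.rep.sub (lift h) A
    let B₁ : C.Ty (C.ext (C.rep.incl A₁)) := C.tySub (CwF.up (lift h) (C.rep.incl_sub _ A)) B.ty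
    let b : C.Term B₁ := ⟨C.tmSub ρ₂ (C.q B.ty), by rw [CwF.typ_sub_q, hρ₂]⟩
    let f := C.pi.lam A₁ B₁ b
    obtain ⟨ρ, hp, hf⟩ : ∃ ρ : Δ ⟶ C.ext (C.pi.pi A B.ty),
        ρ ≫ C.p _ = lift h ∧ C.tmSub ρ (C.q _) = f.1 :=
      ⟨C.pair (lift h) _ f.1 (f.2.trans (C.pi.pi_sub _ _ _).symm), C.pair_p _ _ _ _,
        C.pair_q _ _ _ _⟩
    have h₁ : A₁ = C.rep.sub ρ (C.rep.sub (C.p _) A) := by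
      rw [← C.rep.sub_comp, hp]
    have hρ : CwF.up ρ (CwF.incl_eq_sub h₁) ≫ C.pi.ev A B.ty = ρ₂ := by
      refine CwF.hom_ext ((hev ρ hp h₁).trans hρ₂.symm) ?_
      rw [C.pi.up_ev_q ρ hp rfl rfl f hf.symm]
      exact congrArg Subtype.val ((C.pi.lam A₁ B₁).symm_apply_apply b)
    have hσ : F.ty (C.rep.incl A₁) = D.tySub (F.F.map ρ ≫ u)
        (D.rep.incl (D.rep.sub (D.p (D.pi.pi (F.rep.map A) B')) (F.rep.map A))) :=
      Gluing.map_incl_fam (A := toRep F (X := X) A) h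
        ((hu ρ).trans ((congrArg F.F.map hp).trans (map_lift h)))
    -- The image of the function built in `C` and the given element of `D` have equal evaluations at
    -- the generic argument, so they coincide.
    have e₀ : F.F.map ρ ≫ u = ρ' := by
      have hτ := Gluing.map_incl_fam (A := toRep F (X := X) A) h hρ'
      refine D.pi.eq_of_up_ev (A := F.rep.map A) (B := B') (A' := F.rep.map A₁) ?_ ?_
        ((F.rep.incl_map A₁).trans hσ) ((F.rep.incl_map A₁).trans hτ) ?_
      · exact (hu ρ).trans ((congrArg F.F.map hp).trans ((map_lift h).trans hρ'.symm))
      · rw [hu ρ, hp, F.rep.map_sub]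
      · rw [← F.rep.extHom_upMap A₁ _ hσ, ← F.rep.extHom_upMap A₁ _ hτ, Category.assoc,
          Category.assoc, D.tmSub_comp, D.tmSub_comp (F.rep.extHom A₁)]
        refine congrArg (D.tmSub (F.rep.extHom A₁)) ((key ρ A₁ h₁ hσ).trans ?_)
        exact (congrArg (fun τ => F.tm (C.tmSub τ (C.q B.ty))) hρ).trans h₃
    refine ⟨ρ, (congrArg F.F.map hp).trans (map_lift h), (congrArg _ hp).trans (real_lift h), ?_,
        ?_⟩
    · exact (hq ρ).symm.trans (congrArg (D.tmSub · _) e₀)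
    · refine (Realizer.lam_sub _ _ _ h₁).trans (congrArg (Realizer.lam _) ?_)
      exact (Realizer.sub_comp _ _ _).symm.trans (congrArg B.real.sub hρ)

/-- On realizers both sides are abstractions. Their bodies agree because evaluating the abstraction
of the term at the generic argument returns the term, by `up_inst_ev`. -/
theorem map_lam (b : CwF.Term (cwf C) (Γ := ext (X := X) (ofTy (C.rep.incl A))) B)
    (b' : CwF.Term (Gluing.cwf F) (Γ := Gluing.ext (toRep F (X := X) A).incl)
      (Gluing.Ty.sub ((toRepHom F).extHom (Γ := X) A) (toTy F B)))
    (hb : b'.1 = Gluing.Tm.sub ((toRepHom F).extHom (Γ := X) A) (toTm F b.1)) :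
    (Gluing.lam b').1 = toTm F ((piStr C).lam A B b).1 := by
  refine Gluing.Tm.ext (map_pi A B).symm ?_ ?_
  · refine Eq.trans ?_ (F.map_pi.map_lam A B.ty (toTerm b))
    refine D.pi.lam_congr (congrArg (fun f => D.tySub f (F.ty B.ty)) (rep_extHom_base A)) _ _ ?_
    exact (congrArg Gluing.Tm.base hb).trans
      (congrArg (fun f => D.tmSub f (F.tm b.1.tm)) (rep_extHom_base A))
  · funext Δ g k h
    obtain ⟨⟨ty, b, htm⟩, hty⟩ := b
    obtain ⟨b', hb'⟩ := b'
    have hty' : ty = B := hty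
    subst hty'
    have hb'' : b' = Gluing.Tm.sub ((toRepHom F).extHom (Γ := X) A) (toTm F ⟨_, b, htm⟩) := hb
    subst hb''
    let s : C.Term ty.ty := Tm.term ⟨ty, b, htm⟩
    let f : C.Term (C.pi.pi A ty.ty) := C.pi.lam A ty.ty s
    have h₁ : C.rep.sub (lift h) A = C.rep.sub (lift h ≫ CwF.inst f) (C.rep.sub (C.p _) A) := by
      rw [← C.rep.sub_comp, Category.assoc, CwF.inst_p, Category.comp_id]
    have h₂ : A = C.rep.sub (CwF.inst f) (C.rep.sub (C.p _) A) := by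
      rw [← C.rep.sub_comp, CwF.inst_p, C.rep.sub_id]
    refine Eq.trans ?_ (Realizer.lam_sub (lift h ≫ CwF.inst f) _
      (ty.real.sub (C.pi.ev A ty.ty)) h₁).symm
    refine congrArg (Realizer.lam _) ?_
    refine Eq.trans ?_ (Realizer.sub_comp _ _ _)
    change ty.real.sub (lift _ ≫ CwF.inst s) = _
    refine congrArg ty.real.sub ?_
    refine (congrArg (· ≫ CwF.inst s) (lift_eq _ ((ext_real_sub_up A h).trans
      (Gluing.eqToHom_real (rep_ext_eq A) _ _ _).symm))).trans ?_
    dsimp only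
    rw [← CwF.up_comp (lift h) (CwF.inst f) (CwF.incl_eq_sub h₂) (C.rep.incl_sub _ A),
      Category.assoc, C.pi.up_inst_ev f, Equiv.symm_apply_apply]

end

theorem pi_preserved : (piStr C).Preserved (toRepHom F) (Gluing.piStr F) where
  map_pi A B := map_pi A B
  map_lam A B b := map_lam A B b _ rfl

variable (F) in
/-- The morphism from realized contexts and types to the gluing. -/
@[reducible] noncomputable def toGluing : SigmaPiCwF.Hom (sigmaPiCwF C) (Gluing.sigmaPiCwF F) where
  toHom := toCwFHom F
  rep := toRepHom F
  map_unit X := map_unit X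
  map_sigma := sigma_preserved
  map_repUnit := repUnit_preserved
  map_repSigma := repSigma_preserved
  map_pi := pi_preserved

end Realized

/-! ### Reading off bijectivity from the gluing -/

theorem tm_injective_of_eq_id {C : SigmaPiCwF.{u}} {H : C ⟶ C} (h : H = 𝟙 C) {Γ : C.Ctx} :
    Function.Injective (H.tm (Γ := Γ)) := by
  subst h
  exact fun _ _ h => h

theorem exists_tm_eq_of_eq_id {C : SigmaPiCwF.{u}} {H : C ⟶ C} (h : H = 𝟙 C) {Γ : C.Ctx}
    (A : C.Ty Γ) (t : C.Term (H.ty A)) : ∃ t' : C.Term A, H.tm t'.1 = t.1 := by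
  subst h
  exact ⟨t, rfl⟩

namespace Realized

variable {C D : SigmaPiCwF.{u}} {F : SigmaPiCwF.Hom C D}

/-- Evaluating the realizer actions at the tautological element, the identity with the realizer of
`X`, gives the realizations of the two terms, and the type is faithfully realized. -/
theorem toTm_injective {X : Ctx C} {t t' : Tm X} (hty : t.ty = t'.ty)
    (h : toTm F t = toTm F t') : t = t' := by
  obtain ⟨A, t, ht⟩ := t
  obtain ⟨A', t', ht'⟩ := t'
  dsimp only at hty
  subst hty
  have hX : (toObj F X).mem (𝟙 _) X.real := ⟨𝟙 _, F.F.map_id _, Realizer.sub_id _⟩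
  have key : ∀ {u u' : Gluing.Tm (toObj F X)}, u = u' → u.real _ _ hX = u'.real _ _ hX := by
    rintro u _ rfl
    rfl
  have e := A.inj ?_ (key h)
  · have := congrArg (C.tmSub · (C.q A.ty)) e
    rw [lift_eq hX (Realizer.sub_id _), Category.id_comp, Category.id_comp, CwF.inst_q,
      CwF.inst_q] at this
    exact Tm.ext rfl this
  · rw [Category.assoc, Category.assoc, CwF.inst_p, CwF.inst_p]

/-- At the tautological element, membership exhibits the underlying term as the image of an element
of `A`. Faithfulness of `X` shows that this element lies over the identity, so it is a term over `X`
itself. -/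
theorem exists_tm_eq {X : Ctx C} {A : Ty X}
    (t : CwF.Term (Gluing.cwf F) (Γ := toObj F X) (toTy F A)) :
    ∃ t' : C.Term A.ty, F.tm t'.1 = t.1.base := by
  have hX : (toObj F X).mem (𝟙 _) X.real := ⟨𝟙 _, F.F.map_id _, Realizer.sub_id _⟩
  obtain ⟨ρ, -, h, h', -⟩ := Gluing.term_mem t hX
  have hρ : ρ ≫ C.p A.ty = 𝟙 _ := X.inj (h.trans (Realizer.sub_id _).symm)
  refine ⟨⟨C.tmSub ρ (C.q _), by rw [CwF.typ_sub_q, hρ, C.tySub_id]⟩, h'.trans ?_⟩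
  exact D.tmSub_id _

end Realized

/-- The section `s` gives coherent realizations on `C`, hence a lift `G` of `F` to the gluing.
Initiality yields `R` with `F ≫ R = G`, so injectivity of `G` passes to `F`; since `R` followed by
the projection is the identity, a term `u` is the base of `R u`, which is in the image of `F`. -/
theorem bijectiveOnTerms_of_isInitial {C : SigmaPiCwF.{u}}
    {s : C ⟶ Realized.sigmaPiCwF C}
    (hs : s ≫ (show Realized.sigmaPiCwF C ⟶ C from Realized.forget C) = 𝟙 C)
    (T : StructuredArrow C SigmaPiEqCwF.forget.{u}) (hT : Limits.IsInitial T) :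
    BijectiveOnTerms T.hom := by
  let D : SigmaPiEqCwF.{u} := T.right
  let F : C ⟶ D.toSigmaPiCwF := T.hom
  let G : C ⟶ Gluing.sigmaPiCwF F :=
    s ≫ (show Realized.sigmaPiCwF C ⟶ Gluing.sigmaPiCwF F from Realized.toGluing F)
  let b : Gluing.sigmaPiEqCwF F ⟶ D := Gluing.baseEqHom F
  let T' : StructuredArrow C SigmaPiEqCwF.forget.{u} :=
    StructuredArrow.mk (Y := Gluing.sigmaPiEqCwF F) G
  have hb : G ≫ b.hom = F := by
    change s ≫ (show Realized.sigmaPiCwF C ⟶ C from Realized.forget C) ≫ F = F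
    rw [← Category.assoc, hs, Category.id_comp]
  let r : T ⟶ T' := hT.to T'
  let R : D.toSigmaPiCwF ⟶ Gluing.sigmaPiCwF F := SigmaPiEqCwF.forget.map r.right
  have hR : F ≫ R = G := StructuredArrow.w r
  -- The composite of `r` with the projection is an endomorphism of an initial object.
  have hRb : R ≫ b.hom = 𝟙 D.toSigmaPiCwF := by
    have : r ≫ StructuredArrow.homMk (f := T') (f' := T) b hb = 𝟙 T := hT.hom_ext _ _
    exact congrArg (fun m : T ⟶ T => SigmaPiEqCwF.forget.map m.right) this
  have hinj : ∀ {Γ : C.Ctx} (A : C.Ty Γ) (t t' : C.Term A), G.tm t.1 = G.tm t'.1 → t = t' := by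
    intro Γ A t t' h
    refine Subtype.ext (tm_injective_of_eq_id hs ?_)
    refine congrArg Realized.Tm.tm (Realized.toTm_injective (F := F) ?_ h)
    exact (s.typ_tm t.1).trans ((congrArg s.ty (t.2.trans t'.2.symm)).trans (s.typ_tm t'.1).symm)
  have hsurj : ∀ {Γ : C.Ctx} (A : C.Ty Γ) (v : (Gluing.sigmaPiCwF F).Term (G.ty A)),
      ∃ t : C.Term A, (G ≫ b.hom).tm t.1 = b.hom.tm v.1 := by
    intro Γ A v
    obtain ⟨t, ht⟩ := Realized.exists_tm_eq (F := F) (A := s.ty A) v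
    obtain ⟨t', ht'⟩ := exists_tm_eq_of_eq_id hs A t
    exact ⟨t', (congrArg F.tm ht').trans ht⟩
  -- With `G` rewritten as `F ≫ R`, terms of `G A` are terms of `R (F A)`, and images under `R` can
  -- be fed in without transport.
  rw [← hR] at hinj hsurj
  intro Γ A
  refine ⟨fun t t' h => hinj A t t' ?_, fun u => ?_⟩
  · exact congrArg R.tm (congrArg Subtype.val h)
  · obtain ⟨t, ht⟩ := hsurj A (u.map R.toHom rfl)
    exact ⟨t, Subtype.ext (tm_injective_of_eq_id hRb ht)⟩

end SigmaPiCwF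

theorem mainTheorem6 {T : SigmaPiCwF.{u}} (P : SigmaPiCwF.SOGAT T)
    (R : SigmaPiCwF.HomotopyRelations P) (E : Set R.Homotopy)
    {TE : SigmaPiCwF.{u}} (i : T ⟶ TE)
    (hTE : SigmaPiCwF.HomotopyRelations.IsEquationalExtension E i)
    (T1 : StructuredArrow TE SigmaPiEqCwF.forget.{u}) (hT1 : Limits.IsInitial T1) :
    SigmaPiCwF.BijectiveOnTerms T1.hom := by
  obtain ⟨s, hs⟩ := (SigmaPiCwF.Realized.isTrivialFibration_forget TE).exists_section P hTE
  exact SigmaPiCwF.bijectiveOnTerms_of_isInitial hs T1 hT1
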